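/- **Theorem B.** Let $Y_n=Y(\mathfrak{gl}_n)$ be the Yangian over $\mathbb C$: the associative $\mathbb{C}$-algebra on generators $T_{i,j}^{(r)}$ ($1\le i,j\le n$, $r\ge 1$) subject to the relations $$(u-v)[T_{i,j}(u),T_{h,k}(v)]=T_{h,j}(u)T_{i,k}(v)-T_{h,j}(v)T_{i,k}(u),$$ where $T_{i,j}(u)=\sum_{r\ge 0}T_{i,j}^{(r)}u^{-r}$ and $T_{i,j}^{(0)}=\delta_{i,j}$. Let $\nu=(\nu_1,\dots,\nu_m)$ be a tuple of positive integers summing to $n$, and let $T(u)=F(u)D(u)E(u)$ be the unique factorization of the matrix $T(u)=(T_{i,j}(u))$ into block matrices of shape $\nu$ with entries in $Y_n[[u^{-1}]]$, where $D(u)$ is block diagonal with diagonal blocks $D_a(u)=\big(\sum_{r\ge0}D_{a;i,j}^{(r)}u^{-r}\big)_{1\le i,j\le\nu_a}$, $E(u)$ is block upper unitriangular and $F(u)$ is block lower unitriangular, the off-diagonal blocks of $E(u)$ and $F(u)$ having zero constant term. Write $E_{a;i,j}^{(r)}$ ($1\le i\le\nu_a$, $1\le j\le \nu_{a+1}$)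 for the $u^{-r}$-coefficients of the entries of the $(a,a+1)$ block of $E(u)$, and $F_{a;i,j}^{(r)}$ ($1\le i\le\nu_{a+1}$, $1\le j\le\nu_a$) for those of the $(a+1,a)$ block of $F(u)$, $r\ge 1$. Let $Y_\nu$, $Y_\nu^+$, $Y_\nu^-$ be the subalgebras of $Y_n$ generated by all $D_{a;i,j}^{(r)}$, all $E_{a;i,j}^{(r)}$ and all $F_{a;i,j}^{(r)}$, respectively. Set $E_{a,a+1;i,j}^{(r)}:=E_{a;i,j}^{(r)}$, $F_{a,a+1;j,i}^{(r)}:=F_{a;j,i}^{(r)}$ and, inductively for $b>a+1$, $$E_{a,b;i,j}^{(r)}:=[E_{a,b-1;i,k}^{(r)},E_{b-1;k,j}^{(1)}],\qquad F_{a,b;j,i}^{(r)}:=[F_{b-1;j,k}^{(1)},F_{a,b-1;k,i}^{(r)}]\qquad(1\le i\le\nu_a,\ 1\le j\le\nu_b),$$ for any $1\le k\le\nu_{b-1}$. These elements do not depend on the choice of $k$, and, for any fixed total orders on the index sets of the families concerned, the following hold. (i) The ordered monomials in $\{D_{a;i,j}^{(r)}\}_{1\le a\le m,\,1\le i,j\le\nu_a,\,r\ge1}$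 form a basis of $Y_\nu$. (ii) The ordered monomials in $\{E_{a,b;i,j}^{(r)}\}_{1\le a<b\le m,\,1\le i\le\nu_a,\,1\le j\le\nu_b,\,r\ge1}$ form a basis of $Y_\nu^+$. (iii) The ordered monomials in $\{F_{a,b;i,j}^{(r)}\}_{1\le a<b\le m,\,1\le i\le\nu_b,\,1\le j\le\nu_a,\,r\ge1}$ form a basis of $Y_\nu^-$. (iv) The ordered monomials in the union of the three families form a basis of $Y_n$. In particular the multiplication map $Y_\nu^-\otimes Y_\nu\otimes Y_\nu^+\to Y_n$ is an isomorphism of vector spaces. -/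

import Mathlib

open scoped TensorProduct

noncomputable section

namespace Yang

/-! ### The Yangian of `gl_n` over `ℂ` -/

/-- The free generator `T_{i,j}^{(r)}`, with the convention `T_{i,j}^{(0)} = δ_{i,j}`. -/
def freeT (n : ℕ) (i j : Fin n) (r : ℕ) : FreeAlgebra ℂ (Fin n × Fin n × ℕ+) :=
  if h : 0 < r then FreeAlgebra.ι ℂ (i, j, ⟨r, h⟩) else if i = j then 1 else 0

/-- The defining relations
`(u - v) [T_{i,j}(u), T_{h,k}(v)] = T_{h,j}(u) T_{i,k}(v) - T_{h,j}(v) T_{i,k}(u)`,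
read off at the coefficient of `u^{-r} v^{-s}`. -/
inductive Rel (n : ℕ) :
    FreeAlgebra ℂ (Fin n × Fin n × ℕ+) → FreeAlgebra ℂ (Fin n × Fin n × ℕ+) → Prop
  | rtt (i j h k : Fin n) (r s : ℕ) :
      Rel n
        (⁅freeT n i j (r + 1), freeT n h k s⁆ - ⁅freeT n i j r, freeT n h k (s + 1)⁆)
        (freeT n h j r * freeT n i k s - freeT n h j s * freeT n i k r)

/-- The Yangian `Y_n = Y(gl_n)`. -/
def Yangian (n : ℕ) : Type := RingQuot (Rel n)

instance (n : ℕ) : Ring (Yangian n) := inferInstanceAs (Ring (RingQuot (Rel n)))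

instance (n : ℕ) : Algebra ℂ (Yangian n) := inferInstanceAs (Algebra ℂ (RingQuot (Rel n)))

/-- The quotient map onto `Y_n`. -/
def proj (n : ℕ) : FreeAlgebra ℂ (Fin n × Fin n × ℕ+) →ₐ[ℂ] Yangian n :=
  RingQuot.mkAlgHom ℂ (Rel n)

/-- The element `T_{i,j}^{(r)}` of `Y_n`. -/
def T (n : ℕ) (i j : Fin n) (r : ℕ) : Yangian n := proj n (freeT n i j r)

theorem T_zero (n : ℕ) (i j : Fin n) : T n i j 0 = if i = j then 1 else 0 := by
  simp only [T, freeT, lt_irrefl, dite_false]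
  split_ifs <;> simp

/-! ### Block Gauss factorization -/

section Gauss

variable {ι β R : Type*} [Fintype ι] [DecidableEq ι] [LinearOrder β] [Ring R]

/-- `M = F D E` is the Gauss factorization of a square matrix of power series, relative to the
partition of the rows and columns into the blocks given by `b`: `D` is block diagonal, `E` is block
upper unitriangular, `F` is block lower unitriangular, and the off-diagonal blocks of `E` and `F`
have no constant term. -/
structure IsBlockGauss (b : ι → β) (M F D E : Matrix ι ι (PowerSeries R)) : Prop where
  factor : M = F * D * E
  diag : ∀ i j, b i ≠ b j → D i j = 0
  upper : ∀ i j, b j ≤ b i → E i j = if i = j then 1 else 0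
  lower : ∀ i j, b i ≤ b j → F i j = if i = j then 1 else 0
  upper_const : ∀ i j, b i < b j → PowerSeries.constantCoeff (E i j) = 0
  lower_const : ∀ i j, b j < b i → PowerSeries.constantCoeff (F i j) = 0

def truncBelow {A : Type*} [Zero A] (r : ℕ) (f : ℕ → A) (p : ℕ) : A := if p < r then f p else 0

theorem coeff_mul3 {A : Type*} [Ring A] (f d e : ℕ → A) (hf : f 0 = 1) (hd : d 0 = 1)
    (he : e 0 = 1) (r : ℕ) (hr : 0 < r) :
    PowerSeries.coeff r (PowerSeries.mk f * PowerSeries.mk d * PowerSeries.mk e) =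
      f r + d r + e r + PowerSeries.coeff r (PowerSeries.mk (truncBelow r f) *
        PowerSeries.mk (truncBelow r d) * PowerSeries.mk (truncBelow r e)) := by
  have key : ∀ g : ℕ → A, PowerSeries.mk g =
      PowerSeries.mk (truncBelow r g) + PowerSeries.X ^ r * PowerSeries.mk (fun p => g (p + r)) := by
    intro g
    ext p
    rw [map_add, PowerSeries.coeff_X_pow_mul']
    simp only [PowerSeries.coeff_mk, truncBelow]
    by_cases h : p < r
    · simp [h, not_le.mpr h]
    · simp [h, not_lt.mp h]
  have split : PowerSeries.mk f * PowerSeries.mk d * PowerSeries.mk e =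
      PowerSeries.mk (truncBelow r f) * PowerSeries.mk (truncBelow r d) *
          PowerSeries.mk (truncBelow r e) +
        PowerSeries.X ^ r *
          (PowerSeries.mk (fun p => f (p + r)) * PowerSeries.mk d * PowerSeries.mk e +
            PowerSeries.mk (truncBelow r f) * PowerSeries.mk (fun p => d (p + r)) *
              PowerSeries.mk e +
            PowerSeries.mk (truncBelow r f) * PowerSeries.mk (truncBelow r d) *
              PowerSeries.mk (fun p => e (p + r))) := by
    have c : ∀ φ ψ : PowerSeries A, φ * (PowerSeries.X ^ r * ψ) = PowerSeries.X ^ r * (φ * ψ) := by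
      intro φ ψ
      rw [← mul_assoc, (PowerSeries.commute_X_pow φ r).eq, mul_assoc]
    have h1 : PowerSeries.mk f * PowerSeries.mk d * PowerSeries.mk e =
        PowerSeries.mk (truncBelow r f) * PowerSeries.mk d * PowerSeries.mk e +
        PowerSeries.X ^ r *
          (PowerSeries.mk (fun p => f (p + r)) * PowerSeries.mk d * PowerSeries.mk e) := by
      conv_lhs => rw [key f]
      simp only [add_mul, mul_assoc]
    have h2 : PowerSeries.mk (truncBelow r f) * PowerSeries.mk d * PowerSeries.mk e =
        PowerSeries.mk (truncBelow r f) * PowerSeries.mk (truncBelow r d) * PowerSeries.mk e +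
        PowerSeries.X ^ r * (PowerSeries.mk (truncBelow r f) *
          PowerSeries.mk (fun p => d (p + r)) * PowerSeries.mk e) := by
      conv_lhs => rw [key d]
      simp only [add_mul, mul_add, mul_assoc, c]
    have h3 : PowerSeries.mk (truncBelow r f) * PowerSeries.mk (truncBelow r d) *
          PowerSeries.mk e =
        PowerSeries.mk (truncBelow r f) * PowerSeries.mk (truncBelow r d) *
          PowerSeries.mk (truncBelow r e) +
        PowerSeries.X ^ r * (PowerSeries.mk (truncBelow r f) * PowerSeries.mk (truncBelow r d) *
          PowerSeries.mk (fun p => e (p + r))) := by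
      conv_lhs => rw [key e]
      rw [mul_add, c]
    rw [h1, h2, h3, mul_add, mul_add]
    abel
  rw [split, map_add, PowerSeries.coeff_X_pow_mul', if_pos le_rfl, Nat.sub_self, add_comm]
  congr 1
  simp only [PowerSeries.coeff_zero_eq_constantCoeff, map_add, map_mul,
    ← PowerSeries.coeff_zero_eq_constantCoeff_apply, PowerSeries.coeff_mk, truncBelow, hr, if_true,
    hf, hd, he]
  simp

/-- The matrix of `r`-th coefficients. -/
def matCoeff (M : Matrix ι ι (PowerSeries R)) (r : ℕ) : Matrix ι ι R :=
  Matrix.of fun i j => PowerSeries.coeff r (M i j)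

theorem mk_matCoeff_mul (M N : Matrix ι ι (PowerSeries R)) :
    PowerSeries.mk (matCoeff (M * N)) =
      PowerSeries.mk (matCoeff M) * PowerSeries.mk (matCoeff N) := by
  ext r i j
  simp only [PowerSeries.coeff_mk, PowerSeries.coeff_mul, matCoeff, Matrix.mul_apply, map_sum,
    Matrix.sum_apply]
  exact Finset.sum_comm

/-- Coefficientwise recursion for the sum of the three factors of a Gauss factorization. -/
def gaussSum {A : Type*} [Ring A] (lo di up : A → A) (t : ℕ → A) (r : ℕ) : A :=
  t r - PowerSeries.coeff r
    (PowerSeries.mk (fun p => if _h : p < r then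
        (if p = 0 then 1 else lo (gaussSum lo di up t p)) else 0) *
      PowerSeries.mk (fun p => if _h : p < r then
        (if p = 0 then 1 else di (gaussSum lo di up t p)) else 0) *
      PowerSeries.mk (fun p => if _h : p < r then
        (if p = 0 then 1 else up (gaussSum lo di up t p)) else 0))
termination_by r

theorem exists_mul3 {A : Type*} [Ring A] (lo di up : A → A) (h : ∀ a, lo a + di a + up a = a)
    (t : ℕ → A) (ht : t 0 = 1) :
    ∃ g : ℕ → A, PowerSeries.mk t =
      PowerSeries.mk (fun p => if p = 0 then 1 else lo (g p)) *
      PowerSeries.mk (fun p => if p = 0 then 1 else di (g p)) *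
      PowerSeries.mk (fun p => if p = 0 then 1 else up (g p)) := by
  refine ⟨gaussSum lo di up t, ?_⟩
  ext r
  rcases Nat.eq_zero_or_pos r with rfl | hr
  · simp [ht]
  · rw [coeff_mul3 (fun p => if p = 0 then 1 else lo (gaussSum lo di up t p))
      (fun p => if p = 0 then 1 else di (gaussSum lo di up t p))
      (fun p => if p = 0 then 1 else up (gaussSum lo di up t p))
      (if_pos rfl) (if_pos rfl) (if_pos rfl) r hr]
    simp only [hr.ne', if_false, h]
    have e := gaussSum.eq_1 lo di up t r
    rw [eq_sub_iff_add_eq] at e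
    simp only [dite_eq_ite] at e
    rw [PowerSeries.coeff_mk]
    exact e.symm

/-- Existence of the block Gauss factorization. -/
theorem exists_isBlockGauss (b : ι → β) (M : Matrix ι ι (PowerSeries R))
    (hM : matCoeff M 0 = 1) :
    ∃ X : Matrix ι ι (PowerSeries R) × Matrix ι ι (PowerSeries R) × Matrix ι ι (PowerSeries R),
      IsBlockGauss b M X.1 X.2.1 X.2.2 := by
  obtain ⟨g, hg⟩ := exists_mul3 (A := Matrix ι ι R)
    (fun a => Matrix.of fun i j => if b j < b i then a i j else 0)
    (fun a => Matrix.of fun i j => if b i = b j then a i j else 0)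
    (fun a => Matrix.of fun i j => if b i < b j then a i j else 0)
    (by
      intro a
      ext i j
      simp only [Matrix.add_apply, Matrix.of_apply]
      rcases lt_trichotomy (b i) (b j) with h | h | h
      · simp [h, h.ne, h.not_gt]
      · simp [h]
      · simp [h, h.ne', h.not_gt])
    (matCoeff M) hM
  set f : ℕ → Matrix ι ι R := fun p =>
    if p = 0 then 1 else Matrix.of fun i j => if b j < b i then g p i j else 0 with hf
  set d : ℕ → Matrix ι ι R := fun p =>
    if p = 0 then 1 else Matrix.of fun i j => if b i = b j then g p i j else 0 with hd
  set e : ℕ → Matrix ι ι R := fun p =>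
    if p = 0 then 1 else Matrix.of fun i j => if b i < b j then g p i j else 0 with he
  have back : ∀ x : ℕ → Matrix ι ι R,
      matCoeff (Matrix.of fun i j => PowerSeries.mk fun r => x r i j) = x := by
    intro x
    ext r i j
    simp [matCoeff]
  refine ⟨(Matrix.of fun i j => PowerSeries.mk fun r => f r i j, Matrix.of fun i j => PowerSeries.mk fun r => d r i j,
    Matrix.of fun i j => PowerSeries.mk fun r => e r i j), ?_, ?_, ?_, ?_, ?_, ?_⟩
  · have h := hg
    rw [← back f, ← back d, ← back e, ← mk_matCoeff_mul, ← mk_matCoeff_mul] at h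
    ext i j r
    have h' := congrArg (PowerSeries.coeff r) h
    simp only [PowerSeries.coeff_mk] at h'
    exact congrFun (congrFun h' i) j
  · intro i j hij
    have hne : i ≠ j := fun h => hij (h ▸ rfl)
    ext r
    rcases Nat.eq_zero_or_pos r with rfl | hr
    · simp [hd, hne]
    · simp [hd, hr.ne', hij]
  · intro i j hij
    ext r
    rcases Nat.eq_zero_or_pos r with rfl | hr
    · by_cases h : i = j <;>
        simp [he, h]
    · by_cases h : i = j
      · simp [he, h, hr.ne', PowerSeries.coeff_one]
      · simp [he, h, hr.ne', hij.not_gt]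
  · intro i j hij
    ext r
    rcases Nat.eq_zero_or_pos r with rfl | hr
    · by_cases h : i = j <;>
        simp [hf, h]
    · by_cases h : i = j
      · simp [hf, h, hr.ne', PowerSeries.coeff_one]
      · simp [hf, h, hr.ne', hij.not_gt]
  · intro i j hij
    have hne : i ≠ j := fun h => hij.ne (h ▸ rfl)
    simp [he, hne]
  · intro i j hij
    have hne : i ≠ j := fun h => hij.ne (h ▸ rfl)
    simp [hf, hne]

namespace IsBlockGauss

theorem coeff_zero {b : ι → β} {M F D E : Matrix ι ι (PowerSeries R)} (hM : matCoeff M 0 = 1)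
    (h : IsBlockGauss b M F D E) :
    matCoeff F 0 = 1 ∧ matCoeff D 0 = 1 ∧ matCoeff E 0 = 1 := by
  have hF : matCoeff F 0 = 1 := by
    ext i j
    rcases le_or_gt (b i) (b j) with hij | hij
    · by_cases e : i = j
      · subst e
        simp [matCoeff, h.lower i i hij]
      · simp [matCoeff, h.lower i j hij, e]
    · have hne : i ≠ j := fun e => hij.ne (e ▸ rfl)
      simp [matCoeff, h.lower_const i j hij, hne]
  have hE : matCoeff E 0 = 1 := by
    ext i j
    rcases le_or_gt (b j) (b i) with hij | hij
    · by_cases e : i = j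
      · subst e
        simp [matCoeff, h.upper i i hij]
      · simp [matCoeff, h.upper i j hij, e]
    · have hne : i ≠ j := fun e => hij.ne (e ▸ rfl)
      simp [matCoeff, h.upper_const i j hij, hne]
  refine ⟨hF, ?_, hE⟩
  have hm := congrArg (fun N => PowerSeries.coeff 0 (PowerSeries.mk (matCoeff N))) h.factor
  simp only [mk_matCoeff_mul, PowerSeries.coeff_mk] at hm
  simpa [hF, hE, hM] using hm.symm

/-- Uniqueness of the block Gauss factorization. -/
theorem unique {b : ι → β} {M F D E F' D' E' : Matrix ι ι (PowerSeries R)}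
    (hM : matCoeff M 0 = 1) (h : IsBlockGauss b M F D E) (h' : IsBlockGauss b M F' D' E') :
    F = F' ∧ D = D' ∧ E = E' := by
  obtain ⟨f0, d0, e0⟩ := h.coeff_zero hM
  obtain ⟨f0', d0', e0'⟩ := h'.coeff_zero hM
  have main : ∀ r, matCoeff F r = matCoeff F' r ∧ matCoeff D r = matCoeff D' r ∧
      matCoeff E r = matCoeff E' r := by
    intro r
    induction r using Nat.strong_induction_on with
    | _ r ih =>
      rcases Nat.eq_zero_or_pos r with rfl | hr
      · exact ⟨f0.trans f0'.symm, d0.trans d0'.symm, e0.trans e0'.symm⟩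
      have tF : truncBelow r (matCoeff F) = truncBelow r (matCoeff F') := by
        funext p
        by_cases hp : p < r
        · simp [truncBelow, hp, (ih p hp).1]
        · simp [truncBelow, hp]
      have tD : truncBelow r (matCoeff D) = truncBelow r (matCoeff D') := by
        funext p
        by_cases hp : p < r
        · simp [truncBelow, hp, (ih p hp).2.1]
        · simp [truncBelow, hp]
      have tE : truncBelow r (matCoeff E) = truncBelow r (matCoeff E') := by
        funext p
        by_cases hp : p < r
        · simp [truncBelow, hp, (ih p hp).2.2]
        · simp [truncBelow, hp]
      have hm := congrArg (fun N => PowerSeries.coeff r (PowerSeries.mk (matCoeff N)))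
        (h.factor.symm.trans h'.factor)
      simp only [mk_matCoeff_mul] at hm
      rw [coeff_mul3 _ _ _ f0 d0 e0 r hr, coeff_mul3 _ _ _ f0' d0' e0' r hr, tF, tD, tE] at hm
      have hs := add_right_cancel hm
      have entry : ∀ i j, matCoeff F r i j + matCoeff D r i j + matCoeff E r i j =
          matCoeff F' r i j + matCoeff D' r i j + matCoeff E' r i j := fun i j =>
        congrFun (congrFun hs i) j
      refine ⟨?_, ?_, ?_⟩ <;> ext i j <;> have en := entry i j <;>
        rcases lt_trichotomy (b i) (b j) with hij | hij | hij
      all_goals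
        first
        | simpa [matCoeff, h.lower i j hij.le, h'.lower i j hij.le, h.diag i j hij.ne,
            h'.diag i j hij.ne] using en
        | simpa [matCoeff, h.lower i j hij.le, h'.lower i j hij.le, h.upper i j hij.ge,
            h'.upper i j hij.ge] using en
        | simpa [matCoeff, h.upper i j hij.le, h'.upper i j hij.le, h.diag i j hij.ne',
            h'.diag i j hij.ne'] using en
  have fin : ∀ N N' : Matrix ι ι (PowerSeries R), (∀ r, matCoeff N r = matCoeff N' r) →
      N = N' := by
    intro N N' hN
    ext i j r
    exact congrFun (congrFun (hN r) i) j
  exact ⟨fin _ _ fun r => (main r).1, fin _ _ fun r => (main r).2.1, fin _ _ fun r => (main r).2.2⟩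

end IsBlockGauss

end Gauss

/-! ### Block generators

A tuple `(ν_1, …, ν_m)` of positive integers summing to `n` is a `ν : Composition n`, with
`m = ν.length` and `ν_a = ν.blocksFun a`; all indices start at `0`. -/

variable {n : ℕ}

/-- Positions `(a, i)` with `i` in the block `a`; the position `(a, i)` stands for the row or column
`ν_1 + ⋯ + ν_{a-1} + i` of an `n × n` matrix. -/
abbrev Pos (ν : Composition n) : Type := Σ a : Fin ν.length, Fin (ν.blocksFun a)

/-- The matrix `T(u)`, written in block form; the power series variable is `u⁻¹`. -/
def blockT (ν : Composition n) : Matrix (Pos ν) (Pos ν) (PowerSeries (Yangian n)) :=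
  Matrix.of fun x y => PowerSeries.mk fun r => T n (ν.embedding x.1 x.2) (ν.embedding y.1 y.2) r

theorem matCoeff_blockT_zero (ν : Composition n) : matCoeff (blockT ν) 0 = 1 := by
  ext x y
  have h : ν.embedding x.1 x.2 = ν.embedding y.1 y.2 ↔ x = y :=
    ν.blocksFinEquiv.injective.eq_iff (a := x) (b := y)
  simp only [matCoeff, blockT, Matrix.of_apply, PowerSeries.coeff_mk, T_zero, h, Matrix.one_apply]

/-- The block matrices `(F(u), D(u), E(u))` with `T(u) = F(u) D(u) E(u)`. -/
def gauss (ν : Composition n) : Matrix (Pos ν) (Pos ν) (PowerSeries (Yangian n)) ×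
    Matrix (Pos ν) (Pos ν) (PowerSeries (Yangian n)) ×
    Matrix (Pos ν) (Pos ν) (PowerSeries (Yangian n)) :=
  Classical.choose (exists_isBlockGauss Sigma.fst (blockT ν) (matCoeff_blockT_zero ν))

theorem isBlockGauss_gauss (ν : Composition n) :
    IsBlockGauss Sigma.fst (blockT ν) (gauss ν).1 (gauss ν).2.1 (gauss ν).2.2 :=
  Classical.choose_spec (exists_isBlockGauss Sigma.fst (blockT ν) (matCoeff_blockT_zero ν))

/-- `D_{a;i,j}^{(r)}`. -/
def D (ν : Composition n) (a : Fin ν.length) (i j : Fin (ν.blocksFun a)) (r : ℕ) : Yangian n :=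
  PowerSeries.coeff r ((gauss ν).2.1 ⟨a, i⟩ ⟨a, j⟩)

/-- `E_{a;i,j}^{(r)}`, the coefficients of the block of `E(u)` in position `(a, a + 1)`. -/
def E (ν : Composition n) (a : ℕ) (ha : a + 1 < ν.length)
    (i : Fin (ν.blocksFun ⟨a, a.lt_succ_self.trans ha⟩)) (j : Fin (ν.blocksFun ⟨a + 1, ha⟩))
    (r : ℕ) : Yangian n :=
  PowerSeries.coeff r ((gauss ν).2.2 ⟨⟨a, a.lt_succ_self.trans ha⟩, i⟩ ⟨⟨a + 1, ha⟩, j⟩)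

/-- `F_{a;i,j}^{(r)}`, the coefficients of the block of `F(u)` in position `(a + 1, a)`. -/
def F (ν : Composition n) (a : ℕ) (ha : a + 1 < ν.length)
    (i : Fin (ν.blocksFun ⟨a + 1, ha⟩)) (j : Fin (ν.blocksFun ⟨a, a.lt_succ_self.trans ha⟩))
    (r : ℕ) : Yangian n :=
  PowerSeries.coeff r ((gauss ν).1 ⟨⟨a + 1, ha⟩, i⟩ ⟨⟨a, a.lt_succ_self.trans ha⟩, j⟩)

/-- The first index of a block. -/
def firstIdx (ν : Composition n) (a : Fin ν.length) : Fin (ν.blocksFun a) :=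
  ⟨0, ν.one_le_blocksFun a⟩

/-- `E_{a,b;i,j}^{(r)}` for `a < b` (and `0` for `b ≤ a`), by recursion on `b`:
`E_{a,a+1;i,j}^{(r)} = E_{a;i,j}^{(r)}` and, for `a < b`,
`E_{a,b+1;i,j}^{(r)} = [E_{a,b;i,k}^{(r)}, E_{b;k,j}^{(1)}]`, where `k` is the first index of the
block `b`. -/
def EE (ν : Composition n) (a : ℕ) (ha : a < ν.length) (i : Fin (ν.blocksFun ⟨a, ha⟩)) (r : ℕ) :
    (b : ℕ) → (hb : b < ν.length) → Fin (ν.blocksFun ⟨b, hb⟩) → Yangian n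
  | 0, _, _ => 0
  | b + 1, hb, j =>
    if h : a = b then E ν b hb (Fin.cast (by subst h; rfl) i) j r
    else
      ⁅EE ν a ha i r b (b.lt_succ_self.trans hb) (firstIdx ν _), E ν b hb (firstIdx ν _) j 1⁆

/-- `F_{a,b;j,i}^{(r)}` for `a < b` (and `0` for `b ≤ a`), by recursion on `b`:
`F_{a,a+1;j,i}^{(r)} = F_{a;j,i}^{(r)}` and, for `a < b`,
`F_{a,b+1;j,i}^{(r)} = [F_{b;j,k}^{(1)}, F_{a,b;k,i}^{(r)}]`, where `k` is the first index of the
block `b`. The arguments of `FF` are in the order `a, i, r, b, j`. -/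
def FF (ν : Composition n) (a : ℕ) (ha : a < ν.length) (i : Fin (ν.blocksFun ⟨a, ha⟩)) (r : ℕ) :
    (b : ℕ) → (hb : b < ν.length) → Fin (ν.blocksFun ⟨b, hb⟩) → Yangian n
  | 0, _, _ => 0
  | b + 1, hb, j =>
    if h : a = b then F ν b hb j (Fin.cast (by subst h; rfl) i) r
    else
      ⁅F ν b hb j (firstIdx ν _) 1, FF ν a ha i r b (b.lt_succ_self.trans hb) (firstIdx ν _)⁆

/-! ### The subalgebras -/

/-- `Y_ν`, generated by all `D_{a;i,j}^{(r)}`. -/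
def levi (ν : Composition n) : Subalgebra ℂ (Yangian n) :=
  Algebra.adjoin ℂ {x | ∃ a i j r, x = D ν a i j r}

/-- `Y_ν^+`, generated by all `E_{a;i,j}^{(r)}` with `r ≥ 1`. -/
def plus (ν : Composition n) : Subalgebra ℂ (Yangian n) :=
  Algebra.adjoin ℂ {x | ∃ a ha i j, ∃ r ≥ 1, x = E ν a ha i j r}

/-- `Y_ν^-`, generated by all `F_{a;i,j}^{(r)}` with `r ≥ 1`. -/
def minus (ν : Composition n) : Subalgebra ℂ (Yangian n) :=
  Algebra.adjoin ℂ {x | ∃ a ha i j, ∃ r ≥ 1, x = F ν a ha i j r}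

/-! ### Families of root elements -/

/-- Index set of the elements `D_{a;i,j}^{(r)}` with `r ≥ 1`. -/
structure DIndex (ν : Composition n) where
  a : Fin ν.length
  i : Fin (ν.blocksFun a)
  j : Fin (ν.blocksFun a)
  r : ℕ+

/-- Index set of the elements `E_{a,b;i,j}^{(r)}` with `a < b` and `r ≥ 1`. -/
structure EIndex (ν : Composition n) where
  a : Fin ν.length
  b : Fin ν.length
  lt : a < b
  i : Fin (ν.blocksFun a)
  j : Fin (ν.blocksFun b)
  r : ℕ+

/-- Index set of the elements `F_{a,b;i,j}^{(r)}` with `a < b` and `r ≥ 1`. -/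
structure FIndex (ν : Composition n) where
  a : Fin ν.length
  b : Fin ν.length
  lt : a < b
  i : Fin (ν.blocksFun b)
  j : Fin (ν.blocksFun a)
  r : ℕ+

def DFamily (ν : Composition n) (x : DIndex ν) : Yangian n := D ν x.a x.i x.j x.r

def EFamily (ν : Composition n) (x : EIndex ν) : Yangian n :=
  EE ν x.a x.a.isLt x.i x.r x.b x.b.isLt x.j

def FFamily (ν : Composition n) (x : FIndex ν) : Yangian n :=
  FF ν x.a x.a.isLt x.j x.r x.b x.b.isLt x.i

/-- The union of the three families. -/
def allFamily (ν : Composition n) : DIndex ν ⊕ EIndex ν ⊕ FIndex ν → Yangian n :=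
  Sum.elim (DFamily ν) (Sum.elim (EFamily ν) (FFamily ν))

/-! ### Ordered monomials and the multiplication map -/

/-- The monomial `x_{i_1} x_{i_2} ⋯ x_{i_k}` with `i_1 ≤ i_2 ≤ ⋯ ≤ i_k`, indexed by the multiset
`{i_1, …, i_k}`. -/
def orderedMonomial {I A : Type*} [Monoid A] (lo : LinearOrder I) (x : I → A) (s : Multiset I) : A :=
  ((s.sort (fun i j => i ≤ j)).map x).prod

/-- The ordered monomials in the family `x`, indexed by multisets, form a basis of `S`. -/
def IsPBWBasis {I A : Type*} [Ring A] [Algebra ℂ A] (lo : LinearOrder I) (x : I → A)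
    (S : Subalgebra ℂ A) : Prop :=
  LinearIndependent ℂ (orderedMonomial lo x) ∧
    Submodule.span ℂ (Set.range (orderedMonomial lo x)) = Subalgebra.toSubmodule S

/-- The multiplication map `x ⊗ y ⊗ z ↦ x y z`. -/
def mulMap3 {A : Type*} [Ring A] [Algebra ℂ A] (P Q S : Subalgebra ℂ A) :
    (P ⊗[ℂ] Q) ⊗[ℂ] S →ₗ[ℂ] A :=
  LinearMap.mul' ℂ A ∘ₗ
    TensorProduct.map
      (LinearMap.mul' ℂ A ∘ₗ TensorProduct.map P.val.toLinearMap Q.val.toLinearMap)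
      S.val.toLinearMap

end Yang

end

/-!
Spanning.  The relations between the coefficients of `T(u)` pass to its Gauss factors: the inverse
of a corner of `T(u)⁻¹` is again a solution of the RTT relation, and the entries of the
unitriangular factors satisfy exchange relations.  Modulo lower filtration degree the generators
therefore commute like root vectors of `gl_n[t]`, and every word can be straightened into ordered
monomials.

Independence.  Let `Y_n` act through the comultiplication and evaluations at the points `p t²`,
`p < m`, with `m` large, where the matrix units act by differential operators `∂ + t z`.  Each
generator of degree `r` becomes a polynomial in `t` of degree at most `2 r - 1`, whose coefficient
in that degree is multiplication by the sum over `p` of `p ^ (r - 1)` times the `p`-th copy of a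
variable `z`.  By the Vandermonde determinant these sums are algebraically independent for `r ≤ m`,
so no ordered monomials are linearly related.

Triangular decomposition.  Order the generators so that the `F`s precede the `D`s and the `D`s
precede the `E`s: multiplication then maps the product of the three bases onto the basis of `Y_n`.
-/

noncomputable section

namespace Yang

open Matrix
open scoped Polynomial

attribute [local instance] LieRing.ofAssociativeRing

/-! ### Exchange relations -/

section Exchange

variable {k B ι κ : Type*} [CommRing k] [Ring B] [Algebra k B]

/-- The exchange relation `z [T_{ij}, T'_{hl}] = w (T_{hj} T'_{il} - T'_{hj} T_{il})` with
commuting scalars `z`, `w`. In the Yangian `T = T(u)`, `T' = T(v)`, `z = v⁻¹ - u⁻¹` and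
`w = u⁻¹ v⁻¹`. -/
def Exchange (z w : k) (T T' : Matrix ι κ B) : Prop :=
  ∀ i j h l, z • ⁅T i j, T' h l⁆ = w • (T h j * T' i l - T' h j * T i l)

theorem Exchange.submatrix {z w : k} {T T' : Matrix ι κ B} (H : Exchange z w T T') {ι' κ' : Type*}
    (r : ι' → ι) (c : κ' → κ) : Exchange z w (T.submatrix r c) (T'.submatrix r c) :=
  fun i j h l => H (r i) (c j) (r h) (c l)

variable [Fintype ι]

section Legs

variable [DecidableEq ι]

/-- The matrix `M ⊗ 1` on the two-fold tensor power of the free module on `ι`. -/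
def leg₁ : Matrix ι ι B →+* Matrix (ι × ι) (ι × ι) B :=
  (blockDiagonalRingHom ι ι B).comp (Pi.constRingHom ι (Matrix ι ι B))

variable (B ι) in
/-- The permutation of the two tensor factors. -/
def flipMatrix : Matrix (ι × ι) (ι × ι) B := (1 : Matrix (ι × ι) (ι × ι) B).submatrix Prod.swap id

theorem flip_mul_apply (X : Matrix (ι × ι) (ι × ι) B) (i h : ι) (q : ι × ι) :
    (flipMatrix B ι * X) (i, h) q = X (h, i) q :=
  congrFun (congrFun (one_submatrix_mul Prod.swap (Equiv.refl _) X) (i, h)) q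

theorem mul_flip_apply (X : Matrix (ι × ι) (ι × ι) B) (p : ι × ι) (j l : ι) :
    (X * flipMatrix B ι) p (j, l) = X p (l, j) := by
  have : flipMatrix B ι = (1 : Matrix (ι × ι) (ι × ι) B).submatrix id (Equiv.prodComm ι ι) := by
    ext p q
    simp [flipMatrix, one_apply, Prod.ext_iff, and_comm]
  rw [this]
  exact congrFun (congrFun (mul_submatrix_one (Equiv.refl _) _ X) p) (j, l)

theorem flip_mul_flip : flipMatrix B ι * flipMatrix B ι = 1 := by
  ext ⟨i, h⟩ q
  rw [flip_mul_apply]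
  rfl

/-- The matrix `1 ⊗ M` on the two-fold tensor power of the free module on `ι`. -/
def leg₂ (M : Matrix ι ι B) : Matrix (ι × ι) (ι × ι) B := flipMatrix B ι * leg₁ M * flipMatrix B ι

theorem leg₂_mul (M N : Matrix ι ι B) : leg₂ (M * N) = leg₂ M * leg₂ N := by
  simp only [leg₂, map_mul, mul_assoc]
  rw [← mul_assoc (flipMatrix B ι) (flipMatrix B ι), flip_mul_flip, one_mul]

theorem leg₂_one : leg₂ (1 : Matrix ι ι B) = 1 := by
  rw [leg₂, map_one, mul_one, flip_mul_flip]

theorem leg₁_apply (M : Matrix ι ι B) (i h j l : ι) :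
    leg₁ M (i, h) (j, l) = if h = l then M i j else 0 := rfl

theorem leg₂_apply (M : Matrix ι ι B) (i h j l : ι) :
    leg₂ M (i, h) (j, l) = if i = j then M h l else 0 := by
  rw [leg₂, mul_flip_apply, flip_mul_apply, leg₁_apply]

theorem leg₁_mul_leg₂_apply (M N : Matrix ι ι B) (i h j l : ι) :
    (leg₁ M * leg₂ N) (i, h) (j, l) = M i j * N h l := by
  simp [mul_apply, Fintype.sum_prod_type, leg₁_apply, leg₂_apply]

theorem leg₂_mul_leg₁_apply (M N : Matrix ι ι B) (i h j l : ι) :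
    (leg₂ N * leg₁ M) (i, h) (j, l) = N h l * M i j := by
  simp [mul_apply, Fintype.sum_prod_type, leg₁_apply, leg₂_apply]

theorem leg₂_mul_flip (M : Matrix ι ι B) : leg₂ M * flipMatrix B ι = flipMatrix B ι * leg₁ M := by
  rw [leg₂, mul_assoc, flip_mul_flip, mul_one]

theorem flip_mul_leg₂ (M : Matrix ι ι B) : flipMatrix B ι * leg₂ M = leg₁ M * flipMatrix B ι := by
  rw [leg₂, ← mul_assoc, ← mul_assoc, flip_mul_flip, one_mul]

theorem commute_leg {M N : Matrix ι ι B} (h : ∀ i j k l, Commute (M i j) (N k l)) :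
    Commute (leg₁ M) (leg₂ N) := by
  ext ⟨i, h'⟩ ⟨j, l⟩
  rw [leg₁_mul_leg₂_apply, leg₂_mul_leg₁_apply, (h i j h' l).eq]

variable (B ι) in
/-- Yang's R-matrix `z - w P`, where `P` is the flip. -/
def rMatrix (z w : k) : Matrix (ι × ι) (ι × ι) B := z • 1 - w • flipMatrix B ι

theorem exchange_iff {z w : k} {T T' : Matrix ι ι B} :
    Exchange z w T T' ↔
      rMatrix B ι z w * (leg₁ T * leg₂ T') = leg₂ T' * leg₁ T * rMatrix B ι z w := by
  simp only [rMatrix, sub_mul, mul_sub, smul_mul_assoc, mul_smul_comm, one_mul, mul_one]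
  rw [← Matrix.ext_iff, Prod.forall]
  simp only [Prod.forall, Matrix.sub_apply, Matrix.smul_apply, flip_mul_apply, mul_flip_apply,
    leg₁_mul_leg₂_apply, leg₂_mul_leg₁_apply, Exchange, Ring.lie_def, smul_sub]
  have rearrange (a b c d : B) : a - b = c - d ↔ a - c = b - d := by
    rw [sub_eq_sub_iff_add_eq_add, sub_eq_sub_iff_add_eq_add, add_comm c b]
  exact ⟨fun H i h j l => (rearrange _ _ _ _).1 (H i j h l),
    fun H i j h l => (rearrange _ _ _ _).2 (H i h j l)⟩

end Legs

theorem Exchange.mul {z w : k} {T T' S S' : Matrix ι ι B} (hT : Exchange z w T T')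
    (hS : Exchange z w S S') (h₁ : ∀ a b c d, Commute (T a b) (S' c d))
    (h₂ : ∀ a b c d, Commute (S a b) (T' c d)) : Exchange z w (T * S) (T' * S') := by
  classical
  rw [exchange_iff] at hT hS ⊢
  set R := rMatrix B ι z w
  calc R * (leg₁ (T * S) * leg₂ (T' * S'))
      = R * (leg₁ T * (leg₁ S * leg₂ T') * leg₂ S') := by
        rw [map_mul, leg₂_mul]; simp only [mul_assoc]
    _ = R * (leg₁ T * leg₂ T') * (leg₁ S * leg₂ S') := by
        rw [(commute_leg h₂).eq]; simp only [mul_assoc]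
    _ = leg₂ T' * leg₁ T * (R * (leg₁ S * leg₂ S')) := by rw [hT]; simp only [mul_assoc]
    _ = leg₂ T' * (leg₁ T * leg₂ S') * leg₁ S * R := by rw [hS]; simp only [mul_assoc]
    _ = leg₂ (T' * S') * leg₁ (T * S) * R := by
        rw [(commute_leg h₁).eq, map_mul, leg₂_mul]; simp only [mul_assoc]

theorem Exchange.lie_inv [DecidableEq ι] {z w : k} {T T' N' : Matrix ι ι B} (H : Exchange z w T T')
    (hTN : T' * N' = 1) (hNT : N' * T' = 1) (i j h l : ι) :
    z • ⁅T i j, N' h l⁆ =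
      w • ((if h = j then (T * N') i l else 0) - if i = l then (N' * T) h j else 0) := by
  have key : leg₂ N' * rMatrix B ι z w * leg₁ T = leg₁ T * rMatrix B ι z w * leg₂ N' := by
    have h₁ : leg₂ T' * leg₂ N' = 1 := by rw [← leg₂_mul, hTN, leg₂_one]
    have h₂ : leg₂ N' * leg₂ T' = 1 := by rw [← leg₂_mul, hNT, leg₂_one]
    calc leg₂ N' * rMatrix B ι z w * leg₁ T
        = leg₂ N' * (rMatrix B ι z w * (leg₁ T * leg₂ T')) * leg₂ N' := by
          simp only [mul_assoc, h₁, mul_one]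
      _ = leg₁ T * rMatrix B ι z w * leg₂ N' := by
          rw [exchange_iff.1 H]; simp only [← mul_assoc, h₂, one_mul]
  have entry := congrFun (congrFun key (i, h)) (j, l)
  simp only [rMatrix, sub_mul, mul_sub, smul_mul_assoc, mul_smul_comm, mul_one, mul_assoc,
    ← leg₂_mul_flip, flip_mul_leg₂] at entry
  rw [← mul_assoc (leg₂ N'), ← leg₂_mul, ← mul_assoc (leg₁ T) (leg₁ N'), ← map_mul] at entry
  simp only [Matrix.sub_apply, Matrix.smul_apply, mul_flip_apply, leg₁_mul_leg₂_apply,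
    leg₂_mul_leg₁_apply, leg₁_apply, leg₂_apply] at entry
  rw [Ring.lie_def, smul_sub, smul_sub]
  linear_combination (norm := module) -entry

theorem Exchange.inv [DecidableEq ι] {z w : k} {T T' N N' : Matrix ι ι B} (H : Exchange z w T T')
    (hTN : T * N = 1) (hNT : N * T = 1) (hTN' : T' * N' = 1) (hNT' : N' * T' = 1) (i j h l : ι) :
    z • ⁅N i j, N' h l⁆ = w • (N i l * N' h j - N' i l * N h j) := by
  have key : leg₁ N * leg₂ N' * rMatrix B ι z w = rMatrix B ι z w * (leg₂ N' * leg₁ N) := by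
    have left_inv : leg₁ N * leg₂ N' * (leg₂ T' * leg₁ T) = 1 := by
      rw [mul_assoc, ← mul_assoc (leg₂ N'), ← leg₂_mul, hNT', leg₂_one, one_mul, ← map_mul, hNT,
        map_one]
    have right_inv : leg₁ T * leg₂ T' * (leg₂ N' * leg₁ N) = 1 := by
      rw [mul_assoc, ← mul_assoc (leg₂ T'), ← leg₂_mul, hTN', leg₂_one, one_mul, ← map_mul, hTN,
        map_one]
    calc leg₁ N * leg₂ N' * rMatrix B ι z w
        = leg₁ N * leg₂ N' * (rMatrix B ι z w * (leg₁ T * leg₂ T')) * (leg₂ N' * leg₁ N) := by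
          rw [← mul_assoc _ (rMatrix B ι z w), mul_assoc _ (leg₁ T * leg₂ T'), right_inv,
            mul_one]
      _ = rMatrix B ι z w * (leg₂ N' * leg₁ N) := by
          rw [exchange_iff.1 H, ← mul_assoc (leg₁ N * leg₂ N'), left_inv, one_mul]
  have entry := congrFun (congrFun key (i, h)) (j, l)
  simp only [rMatrix, sub_mul, mul_sub, smul_mul_assoc, mul_smul_comm, one_mul, mul_one,
    Matrix.sub_apply, Matrix.smul_apply, flip_mul_apply, mul_flip_apply, leg₁_mul_leg₂_apply,
    leg₂_mul_leg₁_apply] at entry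
  rw [Ring.lie_def, smul_sub, smul_sub]
  linear_combination (norm := module) entry

end Exchange

/-! ### Exchange relations for the coefficients of dependent rows -/

section Rows

variable {k B ι J : Type*} [CommRing k] [Ring B] [Algebra k B] [Fintype J]

theorem smul_lie_vecMul (z : k) (x : B) (e : J → B) {K : Type*} (m : Matrix J K B) (l : K) :
    z • ⁅x, (e ᵥ* m) l⁆ = ((fun s => z • ⁅x, e s⁆) ᵥ* m) l + ∑ s, e s * z • ⁅x, m s l⁆ := by
  simp only [vecMul, dotProduct, ← Finset.sum_add_distrib, Ring.lie_def, Finset.mul_sum,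
    Finset.sum_mul, ← Finset.sum_sub_distrib, Finset.smul_sum]
  refine Finset.sum_congr rfl fun s _ => ?_
  rw [smul_mul_assoc, mul_smul_comm, ← smul_add]
  congr 1
  noncomm_ring

theorem smul_vecMul_lie (z : k) (x : B) (e : J → B) {K : Type*} (m : Matrix J K B) (l : K) :
    z • ⁅(e ᵥ* m) l, x⁆ = ((fun s => z • ⁅e s, x⁆) ᵥ* m) l + ∑ s, e s * z • ⁅m s l, x⁆ := by
  have swap (a b : B) : z • ⁅a, b⁆ = (-z) • ⁅b, a⁆ := by rw [← lie_skew, smul_neg, neg_smul]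
  simp only [swap _ x, smul_lie_vecMul]

variable [DecidableEq J]

theorem eq_vecMul_of_vecMul_eq {m V : Matrix J J B} (hV : m * V = 1) {u v : J → B}
    (h : u ᵥ* m = v) : u = v ᵥ* V := by
  rw [← h, vecMul_vecMul, hV, vecMul_one]

variable {c : J → ι} {z w : k} {n n' : Matrix ι J B} {V V' : Matrix J J B} {ε ε' η η' : J → B}
  {h i : ι}

/-- Here row `h` of `n` is the combination of the rows in `c` with coefficients `-ε`; when `n`
consists of columns of the inverse of `T`, these coefficients form a row of the upper
unitriangular factor of `T`. -/
theorem Exchange.lie_coeff (H : Exchange z w n n') (hε : n h = -(ε ᵥ* n.submatrix c id))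
    (hε' : n' h = -(ε' ᵥ* n'.submatrix c id)) (hV' : n'.submatrix c id * V' = 1) (i : ι)
    (j p : J) :
    z • ⁅n i j, ε' p⁆ = w • (((ε - ε') ᵥ* n.submatrix c id) j * (n' i ᵥ* V') p) := by
  set nJ := n.submatrix c id
  set n'J := n'.submatrix c id
  have row (l : J) : ((fun s => z • ⁅n i j, ε' s⁆) ᵥ* n'J) l =
      w • (((ε - ε') ᵥ* nJ) j * n' i l) := by
    have leibniz := smul_lie_vecMul z (n i j) ε' n'J l
    have rest : ∑ s, ε' s * z • ⁅n i j, n'J s l⁆ =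
        w • ((ε' ᵥ* nJ) j * n' i l - (ε' ᵥ* n'J) j * n i l) := by
      simp only [n'J, nJ, submatrix_apply, id_eq, H i j, vecMul, dotProduct, Finset.sum_mul,
        ← Finset.sum_sub_distrib, Finset.smul_sum, mul_smul_comm, mul_sub, mul_assoc]
    have expand (l : J) : (ε' ᵥ* n'J) l = -n' h l := by rw [hε', Pi.neg_apply, neg_neg]
    have expand' : (ε ᵥ* nJ) j = -n h j := by rw [hε, Pi.neg_apply, neg_neg]
    rw [rest, expand, expand, lie_neg, smul_neg, H i j h l] at leibniz
    rw [sub_vecMul, Pi.sub_apply, expand', sub_mul]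
    linear_combination (norm := (simp only [neg_mul]; module)) -leibniz
  rw [congrFun (eq_vecMul_of_vecMul_eq hV' (funext row)) p]
  simp only [vecMul, dotProduct, smul_mul_assoc, mul_assoc, Finset.mul_sum, Finset.smul_sum]

theorem Exchange.lie_coeff_of_mem (H : Exchange z w n n') (hε : n h = -(ε ᵥ* n.submatrix c id))
    (hε' : n' h = -(ε' ᵥ* n'.submatrix c id)) (hV' : n'.submatrix c id * V' = 1) (s j p : J) :
    z • ⁅n (c s) j, ε' p⁆ =
      if s = p then w • ((ε - ε') ᵥ* n.submatrix c id) j else 0 := by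
  have unit_row : n' (c s) ᵥ* V' = (1 : Matrix J J B) s := by
    rw [← hV', mul_apply_eq_vecMul]; rfl
  rw [H.lie_coeff hε hε' hV', unit_row, one_apply, mul_ite, mul_one, mul_zero, smul_ite, smul_zero]

/-- Here `e` consists of the coefficients of the row `c i` with respect to the rows in `c ∘ c'`. -/
theorem Exchange.lie_coeff_of_lt {J' : Type*} [Fintype J'] [DecidableEq J'] {c' : J' → J}
    (H : Exchange z w n n') (hε : n h = -(ε ᵥ* n.submatrix c id))
    (hε' : n' h = -(ε' ᵥ* n'.submatrix c id)) (hV' : n'.submatrix c id * V' = 1)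
    {e : J' → B} {i : J}
    (he : (fun l => n (c i) (c' l)) = -(e ᵥ* n.submatrix (c ∘ c') c'))
    {U : Matrix J' J' B} (hU : n.submatrix (c ∘ c') c' * U = 1) (q : J') (p : J) :
    z • ⁅e q, ε' p⁆ = -(w • (((if i = p then 1 else 0) + ∑ s, if c' s = p then e s else 0) *
      ((fun l => ((ε - ε') ᵥ* n.submatrix c id) (c' l)) ᵥ* U) q)) := by
  set Y := (ε - ε') ᵥ* n.submatrix c id
  have lie_row (s j p : J) : z • ⁅n (c s) j, ε' p⁆ = if s = p then w • Y j else 0 :=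
    H.lie_coeff_of_mem hε hε' hV' s j p
  have row (l : J') : ((fun s => z • ⁅e s, ε' p⁆) ᵥ* n.submatrix (c ∘ c') c') l =
      -(w • (((if i = p then 1 else 0) + ∑ s, if c' s = p then e s else 0) * Y (c' l))) := by
    have leibniz := smul_vecMul_lie z (ε' p) e (n.submatrix (c ∘ c') c') l
    have expand : (e ᵥ* n.submatrix (c ∘ c') c') l = -n (c i) (c' l) := by
      rw [congrFun he l, Pi.neg_apply, neg_neg]
    simp only [expand, neg_lie, smul_neg, submatrix_apply, Function.comp_apply, lie_row] at leibniz
    rw [eq_sub_of_add_eq leibniz.symm, add_mul, Finset.sum_mul, smul_add, neg_add, Finset.smul_sum,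
      sub_eq_add_neg]
    congr 2
    · split_ifs <;> simp
    · exact Finset.sum_congr rfl fun s _ => by split_ifs <;> simp
  rw [congrFun (eq_vecMul_of_vecMul_eq hU (funext row)) q]
  simp only [vecMul, dotProduct, neg_mul, smul_mul_assoc, mul_assoc, Finset.mul_sum,
    Finset.smul_sum, Finset.sum_neg_distrib]

theorem Exchange.lie_vecMul_coeff (H : Exchange z w n n') (hε : n h = -(ε ᵥ* n.submatrix c id))
    (hε' : n' h = -(ε' ᵥ* n'.submatrix c id)) (hη : n i = -(η ᵥ* n.submatrix c id))
    (hη' : n' i = -(η' ᵥ* n'.submatrix c id)) (hV' : n'.submatrix c id * V' = 1) (p l : J) :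
    ((fun s => z • ⁅η s, ε' p⁆) ᵥ* n.submatrix c id) l =
      w • (((ε - ε') ᵥ* n.submatrix c id) l * η' p - η p * ((ε - ε') ᵥ* n.submatrix c id) l) := by
  have leibniz := smul_vecMul_lie z (ε' p) η (n.submatrix c id) l
  have expand : (η ᵥ* n.submatrix c id) l = -n i l := by rw [hη, Pi.neg_apply, neg_neg]
  have coeffs : n' i ᵥ* V' = -η' := by
    rw [hη', neg_vecMul, vecMul_vecMul, hV', vecMul_one]
  simp only [expand, neg_lie, smul_neg, H.lie_coeff hε hε' hV' i l p, coeffs,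
    submatrix_apply, id_eq, H.lie_coeff_of_mem hε hε' hV', mul_ite, mul_zero,
    Finset.sum_ite_eq', Finset.mem_univ, if_true, mul_smul_comm] at leibniz
  rw [eq_sub_of_add_eq leibniz.symm, smul_sub, Pi.neg_apply, mul_neg, smul_neg, neg_neg]

theorem Exchange.vecMul_mul_coeff (H : Exchange z w n n')
    (hη : n i = -(η ᵥ* n.submatrix c id)) (hη' : n' i = -(η' ᵥ* n'.submatrix c id))
    (hV' : n'.submatrix c id * V' = 1) (x : J → B) (p l : J) :
    z • ((x ᵥ* n.submatrix c id) l * η' p) =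
      z • ((fun s => x s * η' p) ᵥ* n.submatrix c id) l +
        w • (x p * ((η - η') ᵥ* n.submatrix c id) l) := by
  set nJ := n.submatrix c id
  set Z := (η - η') ᵥ* nJ
  have lie_row (s : J) : z • (nJ s l * η' p) =
      z • (η' p * nJ s l) + if s = p then w • Z l else 0 := by
    rw [← sub_eq_iff_eq_add', ← smul_sub]
    exact H.lie_coeff_of_mem hη hη' hV' s l p
  have term (s : J) : z • (x s * nJ s l * η' p) = z • (x s * η' p * nJ s l) +
      if s = p then w • (x s * Z l) else 0 := by
    rw [mul_assoc, ← mul_smul_comm, lie_row, mul_add, mul_smul_comm, mul_assoc, mul_ite, mul_zero,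
      mul_smul_comm]
  simp only [vecMul, dotProduct, Finset.sum_mul, Finset.smul_sum, term,
    Finset.sum_add_distrib, Finset.sum_ite_eq', Finset.mem_univ, if_true]

theorem Exchange.lie_coeff_same (H : Exchange z w n n') (hε : n h = -(ε ᵥ* n.submatrix c id))
    (hε' : n' h = -(ε' ᵥ* n'.submatrix c id)) (hη : n i = -(η ᵥ* n.submatrix c id))
    (hη' : n' i = -(η' ᵥ* n'.submatrix c id)) (hV : n.submatrix c id * V = 1)
    (hV' : n'.submatrix c id * V' = 1) (q p : J) :
    z • z • ⁅η q, ε' p⁆ = w • (z • ((ε - ε') q * η' p - η p * (ε - ε') q) +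
      w • ((ε - ε') p * (η - η') q)) := by
  set nJ := n.submatrix c id
  have row (l : J) : ((fun s => z • z • ⁅η s, ε' p⁆) ᵥ* nJ) l =
      ((fun s => w • (z • ((ε - ε') s * η' p - η p * (ε - ε') s) +
        w • ((ε - ε') p * (η - η') s))) ᵥ* nJ) l := by
    calc ((fun s => z • z • ⁅η s, ε' p⁆) ᵥ* nJ) l
        = w • (z • (((ε - ε') ᵥ* nJ) l * η' p) - z • (η p * ((ε - ε') ᵥ* nJ) l)) := by
          rw [show (fun s => z • z • ⁅η s, ε' p⁆) = z • fun s => z • ⁅η s, ε' p⁆ from rfl,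
            smul_vecMul, Pi.smul_apply, H.lie_vecMul_coeff hε hε' hη hη' hV']
          module
      _ = _ := by
          rw [H.vecMul_mul_coeff hη hη' hV']
          simp only [vecMul, dotProduct, Finset.mul_sum, Finset.smul_sum,
            ← Finset.sum_add_distrib, ← Finset.sum_sub_distrib]
          refine Finset.sum_congr rfl fun s _ => ?_
          simp only [smul_mul_assoc, add_mul, sub_mul (_ : B) _ (nJ s l), mul_assoc]
          module
  have := congrFun (eq_vecMul_of_vecMul_eq hV (funext row)) q
  rwa [vecMul_vecMul, hV, vecMul_one] at this

end Rows

/-! ### Power series in two variables -/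

section TwoVariables

open PowerSeries Finset.HasAntidiagonal

variable {A : Type*} [Ring A]

/-- Series in the commuting variables `x = u⁻¹` and `y = v⁻¹`, encoded as series in `x` whose
coefficients are series in `y`. -/
abbrev Series₂ (A : Type*) [Ring A] : Type _ := A⟦X⟧⟦X⟧

/-- The series `f(x)`. -/
def inX : A⟦X⟧ →+* Series₂ A := PowerSeries.map C

/-- The series `f(y)`. -/
def inY : A⟦X⟧ →+* Series₂ A := C

/-- The coefficient of `x ^ r * y ^ s`. -/
def coeff₂ (r s : ℕ) : Series₂ A →+ A := (coeff s).toAddMonoidHom.comp (coeff r).toAddMonoidHom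

theorem coeff₂_apply (r s : ℕ) (f : Series₂ A) : coeff₂ r s f = coeff s (coeff r f) := rfl

theorem ext₂ {f g : Series₂ A} (h : ∀ r s, coeff₂ r s f = coeff₂ r s g) : f = g := by
  ext r s
  exact h r s

theorem coeff₂_inX_mul_inY (f g : A⟦X⟧) (r s : ℕ) :
    coeff₂ r s (inX f * inY g) = coeff r f * coeff s g := by
  simp [coeff₂_apply, inX, inY, coeff_mul_C, coeff_C_mul]

theorem coeff₂_inY_mul_inX (f g : A⟦X⟧) (r s : ℕ) :
    coeff₂ r s (inY g * inX f) = coeff s g * coeff r f := by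
  simp [coeff₂_apply, inX, inY, coeff_mul_C, coeff_C_mul]

theorem coeff₂_lie (f g : A⟦X⟧) (r s : ℕ) :
    coeff₂ r s ⁅inX f, inY g⁆ = ⁅coeff r f, coeff s g⁆ := by
  simp only [Ring.lie_def, map_sub, coeff₂_inX_mul_inY, coeff₂_inY_mul_inX]

theorem coeff₂_mul (f g : Series₂ A) (r s : ℕ) :
    coeff₂ r s (f * g) = ∑ p ∈ antidiagonal r, ∑ q ∈ antidiagonal s,
      coeff₂ p.1 q.1 f * coeff₂ p.2 q.2 g := by
  simp [coeff₂_apply, coeff_mul]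

theorem commute_inX_inY_iff {f g : A⟦X⟧} :
    Commute (inX f) (inY g) ↔ ∀ r s, Commute (coeff r f) (coeff s g) := by
  refine ⟨fun h r s => ?_, fun h => ext₂ fun r s => ?_⟩
  · rw [Commute, SemiconjBy, ← coeff₂_inX_mul_inY, h.eq, coeff₂_inY_mul_inX]
  · rw [coeff₂_inX_mul_inY, coeff₂_inY_mul_inX, (h r s).eq]

variable (A)

theorem X_mem_center : X ∈ Subring.center (Series₂ A) :=
  Subring.mem_center_iff.mpr fun f => (commute_X f).eq

theorem C_X_mem_center : C X ∈ Subring.center (Series₂ A) := by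
  refine Subring.mem_center_iff.mpr fun f => ?_
  ext r : 1
  rw [coeff_mul_C, coeff_C_mul, (commute_X _).eq]

/-- The central element `y - x` of the ring of series in `x` and `y`. -/
def diffYX : Subring.center (Series₂ A) := ⟨C X - X, sub_mem (C_X_mem_center A) (X_mem_center A)⟩

/-- The central element `x * y` of the ring of series in `x` and `y`. -/
def prodXY : Subring.center (Series₂ A) := ⟨X * C X, mul_mem (X_mem_center A) (C_X_mem_center A)⟩

variable {A}

theorem diffYX_smul (f : Series₂ A) : diffYX A • f = C X * f - X * f := sub_mul _ _ _

theorem prodXY_smul (f : Series₂ A) : prodXY A • f = X * (C X * f) := mul_assoc _ _ _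

theorem coeff₂_diffYX_smul_zero_zero (f : Series₂ A) : coeff₂ 0 0 (diffYX A • f) = 0 := by
  simp [diffYX_smul, coeff₂_apply]

theorem coeff₂_diffYX_smul_zero_succ (f : Series₂ A) (s : ℕ) :
    coeff₂ 0 (s + 1) (diffYX A • f) = coeff₂ 0 s f := by
  simp [diffYX_smul, coeff₂_apply, coeff_succ_X_mul]

theorem coeff₂_diffYX_smul_succ_zero (f : Series₂ A) (r : ℕ) :
    coeff₂ (r + 1) 0 (diffYX A • f) = -coeff₂ r 0 f := by
  simp [diffYX_smul, coeff₂_apply, coeff_succ_X_mul, coeff_C_mul]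

theorem coeff₂_diffYX_smul_succ_succ (f : Series₂ A) (r s : ℕ) :
    coeff₂ (r + 1) (s + 1) (diffYX A • f) = coeff₂ (r + 1) s f - coeff₂ r (s + 1) f := by
  simp [diffYX_smul, coeff₂_apply, coeff_succ_X_mul, coeff_C_mul]

theorem coeff₂_prodXY_smul_zero_left (f : Series₂ A) (s : ℕ) :
    coeff₂ 0 s (prodXY A • f) = 0 := by
  simp [prodXY_smul, coeff₂_apply]

theorem coeff₂_prodXY_smul_zero_right (f : Series₂ A) (r : ℕ) :
    coeff₂ r 0 (prodXY A • f) = 0 := by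
  cases r <;> simp [prodXY_smul, coeff₂_apply, coeff_succ_X_mul, coeff_C_mul]

theorem coeff₂_prodXY_smul_succ_succ (f : Series₂ A) (r s : ℕ) :
    coeff₂ (r + 1) (s + 1) (prodXY A • f) = coeff₂ r s f := by
  simp [prodXY_smul, coeff₂_apply, coeff_succ_X_mul, coeff_C_mul]

theorem diffYX_smul_eq_prodXY_smul_iff {f g : Series₂ A} :
    diffYX A • f = prodXY A • g ↔ (∀ s, coeff₂ 0 s f = 0) ∧ (∀ r, coeff₂ r 0 f = 0) ∧
      ∀ r s, coeff₂ (r + 1) s f - coeff₂ r (s + 1) f = coeff₂ r s g := by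
  refine ⟨fun h => ⟨fun s => ?_, fun r => ?_, fun r s => ?_⟩, fun ⟨h₀, h₁, h⟩ => ext₂ ?_⟩
  · rw [← coeff₂_diffYX_smul_zero_succ, h, coeff₂_prodXY_smul_zero_left]
  · rw [← neg_eq_zero, ← coeff₂_diffYX_smul_succ_zero, h, coeff₂_prodXY_smul_zero_right]
  · rw [← coeff₂_diffYX_smul_succ_succ, h, coeff₂_prodXY_smul_succ_succ]
  · rintro (_ | r) (_ | s)
    · rw [coeff₂_diffYX_smul_zero_zero, coeff₂_prodXY_smul_zero_left]
    · rw [coeff₂_diffYX_smul_zero_succ, coeff₂_prodXY_smul_zero_left, h₀]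
    · rw [coeff₂_diffYX_smul_succ_zero, coeff₂_prodXY_smul_zero_right, h₁, neg_zero]
    · rw [coeff₂_diffYX_smul_succ_succ, coeff₂_prodXY_smul_succ_succ, h]

theorem coeff₂_mem_of_diffYX_smul {f g : Series₂ A} (h : diffYX A • f = prodXY A • g)
    {S : ℕ → AddSubgroup A} {d : ℕ} (hg : ∀ r s, coeff₂ r s g ∈ S (r + s + d + 1)) (r s : ℕ) :
    coeff₂ r s f ∈ S (r + s + d) := by
  obtain ⟨h₀, -, h⟩ := diffYX_smul_eq_prodXY_smul_iff.mp h
  induction r generalizing s with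
  | zero => rw [h₀]; exact zero_mem _
  | succ r ih =>
    rw [sub_eq_iff_eq_add'.mp (h r s), show r + 1 + s + d = r + s + d + 1 by ring]
    refine add_mem ?_ (hg r s)
    rw [show r + s + d + 1 = r + (s + 1) + d by ring]
    exact ih (s + 1)

theorem diffYX_smul_injective : Function.Injective (diffYX A • · : Series₂ A → Series₂ A) := by
  intro f g hfg
  have h : diffYX A • (f - g) = prodXY A • (0 : Series₂ A) := by
    rw [smul_sub, smul_zero, sub_eq_zero]
    exact hfg
  refine sub_eq_zero.mp (ext₂ fun r s => ?_)
  simpa only [map_zero, AddSubgroup.mem_bot] using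
    coeff₂_mem_of_diffYX_smul h (S := fun _ => ⊥) (d := 0) (fun r s => map_zero (coeff₂ r s)) r s

theorem prodXY_smul_injective : Function.Injective (prodXY A • · : Series₂ A → Series₂ A) := by
  intro f g hfg
  refine ext₂ fun r s => ?_
  rw [← coeff₂_prodXY_smul_succ_succ f, ← coeff₂_prodXY_smul_succ_succ g]
  exact congrArg (coeff₂ (r + 1) (s + 1)) hfg

theorem exists_eq_prodXY_smul {f g : Series₂ A} (h : diffYX A • f = prodXY A • g) :
    ∃ e, f = prodXY A • e := by
  obtain ⟨left, right, -⟩ := diffYX_smul_eq_prodXY_smul_iff.mp h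
  refine ⟨mk fun r => mk fun s => coeff₂ (r + 1) (s + 1) f, ext₂ fun r s => ?_⟩
  rcases r with _ | r
  · rw [left, coeff₂_prodXY_smul_zero_left]
  rcases s with _ | s
  · rw [right, coeff₂_prodXY_smul_zero_right]
  rw [coeff₂_prodXY_smul_succ_succ, coeff₂_apply r s, coeff_mk, coeff_mk]

/-! ### The RTT relation for matrices of power series -/

variable {ι : Type*} {ħ : ℤ} {M N : Matrix ι ι A⟦X⟧}

/-- The RTT relation
`(u - v) [M_{ij}(u), M_{hl}(v)] = ħ (M_{hj}(u) M_{il}(v) - M_{hj}(v) M_{il}(u))`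
for a matrix of power series in `u⁻¹`, multiplied by `u⁻¹ v⁻¹` to clear denominators. -/
def RTT (ħ : ℤ) (M : Matrix ι ι A⟦X⟧) : Prop :=
  Exchange (diffYX A) (ħ • prodXY A) (M.map inX) (M.map inY)

theorem RTT.submatrix (h : RTT ħ M) {κ : Type*} (c : κ → ι) : RTT ħ (M.submatrix c c) :=
  Exchange.submatrix h c c

theorem diffYX_smul_lie_iff {f g a b c d : A⟦X⟧} :
    diffYX A • ⁅inX f, inY g⁆ = (ħ • prodXY A) • (inX a * inY b - inY c * inX d) ↔
      (∀ s, ⁅coeff 0 f, coeff s g⁆ = 0) ∧ (∀ r, ⁅coeff r f, coeff 0 g⁆ = 0) ∧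
        ∀ r s, ⁅coeff (r + 1) f, coeff s g⁆ - ⁅coeff r f, coeff (s + 1) g⁆ =
          ħ • (coeff r a * coeff s b - coeff s c * coeff r d) := by
  rw [smul_assoc, smul_comm, diffYX_smul_eq_prodXY_smul_iff]
  simp only [coeff₂_lie, map_zsmul, map_sub, coeff₂_inX_mul_inY, coeff₂_inY_mul_inX]

theorem rtt_iff : RTT ħ M ↔
    (∀ i j h l s, ⁅coeff 0 (M i j), coeff s (M h l)⁆ = 0) ∧ ∀ i j h l r s,
      ⁅coeff (r + 1) (M i j), coeff s (M h l)⁆ - ⁅coeff r (M i j), coeff (s + 1) (M h l)⁆ =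
        ħ • (coeff r (M h j) * coeff s (M i l) - coeff s (M h j) * coeff r (M i l)) := by
  refine ⟨fun H => ?_, fun ⟨H₀, H⟩ i j h l => diffYX_smul_lie_iff.mpr ⟨H₀ i j h l, fun r => ?_,
    H i j h l⟩⟩
  · have coeffs := fun i j h l => diffYX_smul_lie_iff.mp (H i j h l)
    exact ⟨fun i j h l => (coeffs i j h l).1, fun i j h l => (coeffs i j h l).2.2⟩
  · rw [← lie_skew (coeff r (M i j)), H₀ h l i j r, neg_zero]

variable [Fintype ι]

theorem RTT.mul (hM : RTT ħ M) (hN : RTT ħ N)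
    (hc : ∀ i j h l r s, Commute (coeff r (M i j)) (coeff s (N h l))) : RTT ħ (M * N) := by
  rw [RTT, Matrix.map_mul, Matrix.map_mul]
  refine Exchange.mul hM hN (fun a b c d => ?_) fun a b c d => ?_
  · exact commute_inX_inY_iff.mpr (hc a b c d)
  · exact commute_inX_inY_iff.mpr fun r s => (hc c d a b s r).symm

variable [DecidableEq ι]

theorem map_mul_map_eq_one {R S : Type*} [Ring R] [Ring S] (f : R →+* S) {P Q : Matrix ι ι R}
    (h : P * Q = 1) : P.map f * Q.map f = 1 := by
  rw [← Matrix.map_mul, h]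
  exact Matrix.map_one f (map_zero f) (map_one f)

theorem RTT.inv (H : RTT ħ M) (hMN : M * N = 1) (hNM : N * M = 1) : RTT (-ħ) N := by
  have hx := map_mul_map_eq_one inX hMN
  have hx' := map_mul_map_eq_one inX hNM
  have hy := map_mul_map_eq_one inY hMN
  have hy' := map_mul_map_eq_one inY hNM
  have coeffs := fun i j h l => diffYX_smul_lie_iff.mp (Exchange.inv H hx hx' hy hy' i j h l)
  refine rtt_iff.mpr ⟨fun i j h l => (coeffs i j h l).1, fun i j h l r s => ?_⟩
  -- `Exchange.inv` multiplies the entries of `N` in the opposite order: swap `u` and `v` in it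
  have swapped := (coeffs h l i j).2.2 s r
  rw [neg_smul, ← smul_neg, neg_sub, ← swapped]
  simp only [Ring.lie_def]
  abel

theorem RTT.commute_inv (H : RTT ħ M) (hMN : M * N = 1) (hNM : N * M = 1) {i j h l : ι}
    (hj : h ≠ j) (hl : i ≠ l) (r s : ℕ) : Commute (coeff r (M i j)) (coeff s (N h l)) := by
  have hy := map_mul_map_eq_one inY hMN
  have hy' := map_mul_map_eq_one inY hNM
  have lie := Exchange.lie_inv H hy hy' i j h l
  rw [if_neg hj, if_neg hl, sub_zero, smul_zero, ← smul_zero (diffYX A)] at lie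
  exact commute_inX_inY_iff.mp (commute_iff_lie_eq.mpr (diffYX_smul_injective lie)) r s

end TwoVariables

/-! ### Inverses of matrices of power series -/

section MatrixSeries

open PowerSeries

variable {ι κ A : Type*} [Ring A]

/-- Matrices of power series are power series of matrices. -/
def matCoeffEquiv (ι A : Type*) [Fintype ι] [DecidableEq ι] [Ring A] :
    Matrix ι ι A⟦X⟧ ≃+* (Matrix ι ι A)⟦X⟧ where
  toFun M := mk (matCoeff M)
  invFun φ := of fun i j => mk fun r => coeff r φ i j
  left_inv M := by ext; simp [matCoeff]
  right_inv φ := by ext; simp [matCoeff]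
  map_mul' := mk_matCoeff_mul
  map_add' M N := by ext; simp [matCoeff]

theorem matCoeff_mul [Fintype ι] (M N : Matrix ι ι A⟦X⟧) (r : ℕ) :
    matCoeff (M * N) r =
      ∑ p ∈ Finset.HasAntidiagonal.antidiagonal r, matCoeff M p.1 * matCoeff N p.2 := by
  classical
  simpa [coeff_mul] using congrArg (coeff r) (mk_matCoeff_mul M N)

variable [DecidableEq ι]

theorem matCoeff_one (r : ℕ) :
    matCoeff (1 : Matrix ι ι A⟦X⟧) r = if r = 0 then 1 else 0 := by
  ext i j
  by_cases h : i = j <;> by_cases hr : r = 0 <;> simp [matCoeff, coeff_one, one_apply, h, hr]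

theorem matCoeff_submatrix_zero [DecidableEq κ] {M : Matrix ι ι A⟦X⟧} (h : matCoeff M 0 = 1)
    {c : κ → ι} (hc : Function.Injective c) : matCoeff (M.submatrix c c) 0 = 1 := by
  change (matCoeff M 0).submatrix c c = 1
  rw [h, submatrix_one _ hc]

variable [Fintype ι] {M N : Matrix ι ι A⟦X⟧}

theorem exists_inverse (h0 : matCoeff M 0 = 1) :
    ∃ N : Matrix ι ι A⟦X⟧, M * N = 1 ∧ N * M = 1 := by
  set e := matCoeffEquiv ι A
  have unit : constantCoeff (e M) = ((1 : (Matrix ι ι A)ˣ) : Matrix ι ι A) := by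
    simp [e, matCoeffEquiv, h0]
  refine ⟨e.symm ((e M).invOfUnit 1), e.injective ?_, e.injective ?_⟩
  · rw [map_mul, e.apply_symm_apply, mul_invOfUnit _ _ unit, map_one]
  · rw [map_mul, e.apply_symm_apply, invOfUnit_mul _ _ unit, map_one]

theorem mul_eq_one_of_mul_eq_one (h0 : matCoeff M 0 = 1) (h : M * N = 1) : N * M = 1 := by
  obtain ⟨N', -, hN'⟩ := exists_inverse h0
  rwa [← left_inv_eq_right_inv hN' h]

theorem matCoeff_inverse_mem (S : ℕ → AddSubgroup (Matrix ι ι A)) (one : 1 ∈ S 0)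
    (mul : ∀ p q a b, a ∈ S p → b ∈ S q → a * b ∈ S (p + q)) (h0 : matCoeff M 0 = 1)
    (hM : ∀ r, matCoeff M r ∈ S r) (hMN : M * N = 1) (r : ℕ) : matCoeff N r ∈ S r := by
  induction r using Nat.strong_induction_on with
  | _ r ih =>
    have h := congrArg (fun K => matCoeff K r) hMN
    simp only [matCoeff_mul, matCoeff_one] at h
    rcases r with _ | r
    · rw [Finset.Nat.antidiagonal_zero, Finset.sum_singleton, h0, one_mul, if_pos rfl] at h
      rwa [h]
    · rw [Finset.Nat.antidiagonal_succ, Finset.sum_cons, h0, one_mul, if_neg (Nat.succ_ne_zero r),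
        Finset.sum_map, ← eq_neg_iff_add_eq_zero] at h
      rw [h]
      refine neg_mem (sum_mem fun p hp => ?_)
      have hp' : p.1 + p.2 = r := Finset.HasAntidiagonal.mem_antidiagonal.mp hp
      rw [show r + 1 = p.1 + 1 + p.2 by omega]
      exact mul _ _ _ _ (hM (p.1 + 1)) (ih p.2 (by omega))

theorem matCoeff_inverse_zero (h0 : matCoeff M 0 = 1) (hMN : M * N = 1) : matCoeff N 0 = 1 := by
  have h := congrArg (fun K => matCoeff K 0) hMN
  simpa [matCoeff_mul, matCoeff_one, h0] using h

theorem blockTriangular_of_mul_eq_one {β : Type*} [LinearOrder β] {b : ι → β}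
    (h0 : matCoeff M 0 = 1) (hM : BlockTriangular M b) (hMN : M * N = 1) :
    BlockTriangular N b := by
  let S : ℕ → AddSubgroup (Matrix ι ι A) := fun _ =>
    { carrier := {K | BlockTriangular K b}
      add_mem' := BlockTriangular.add
      zero_mem' := blockTriangular_zero
      neg_mem' := BlockTriangular.neg }
  intro i j hij
  ext r
  refine matCoeff_inverse_mem S blockTriangular_one (fun _ _ _ _ => BlockTriangular.mul) h0
    (fun r i j hij => ?_) hMN r hij
  change coeff r (M i j) = 0
  rw [hM hij, map_zero]

end MatrixSeries

section Blocks

variable {ι R : Type*} [Fintype ι] [Ring R]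

theorem sum_eq_sum_subtype {M : Type*} [AddCommMonoid M] (p : ι → Prop) [DecidablePred p]
    {f : ι → M} (h : ∀ i, ¬p i → f i = 0) : ∑ i, f i = ∑ i : {i // p i}, f i := by
  rw [← Finset.sum_subtype (Finset.univ.filter p) (by simp) f,
    Finset.sum_filter_of_ne fun i _ hi => not_imp_comm.mp (h i) hi]

theorem submatrix_mul_of_subtype (p : ι → Prop) [DecidablePred p] {κ κ' : Type*}
    {P Q : Matrix ι ι R} (f : κ → ι) (g : κ' → ι)
    (h : ∀ i j s, ¬p s → P (f i) s * Q s (g j) = 0) :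
    (P * Q).submatrix f g =
      P.submatrix f (Subtype.val : {s // p s} → ι) *
        Q.submatrix (Subtype.val : {s // p s} → ι) g := by
  ext i j
  exact sum_eq_sum_subtype p (h i j)

end Blocks

/-! ### Corners of the inverse of a matrix with a Gauss factorization -/

section GaussInverse

open PowerSeries

variable {ι β A : Type*} [Fintype ι] [DecidableEq ι] [LinearOrder β] [Ring A]
  {b : ι → β} {M F D E N : Matrix ι ι A⟦X⟧}

namespace IsBlockGauss

theorem blockTriangular_upper (hG : IsBlockGauss b M F D E) : BlockTriangular E b :=
  fun i j hij => by rw [hG.upper i j hij.le, if_neg (ne_of_apply_ne b hij.ne')]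

theorem lower_mul_diag_of_le (hG : IsBlockGauss b M F D E) {i j : ι} (h : b i ≤ b j) :
    (F * D) i j = D i j := by
  rw [mul_apply, Finset.sum_eq_single i]
  · rw [hG.lower i i le_rfl, if_pos rfl, one_mul]
  · intro s _ hs
    by_cases hsj : b s = b j
    · rw [hG.lower i s (hsj ▸ h), if_neg hs.symm, zero_mul]
    · rw [hG.diag s j hsj, mul_zero]
  · simp

theorem blockTriangular_lower_mul_diag (hG : IsBlockGauss b M F D E) :
    BlockTriangular (F * D) (OrderDual.toDual ∘ b) := fun i j (hij : b i < b j) => by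
  rw [hG.lower_mul_diag_of_le hij.le, hG.diag i j hij.ne]

theorem matCoeff_lower_mul_diag (hG : IsBlockGauss b M F D E) (h0 : matCoeff M 0 = 1) :
    matCoeff (F * D) 0 = 1 := by
  obtain ⟨hF, hD, -⟩ := hG.coeff_zero h0
  simp [matCoeff_mul, hF, hD]

theorem ite_add_sum_ite_map_upper (hG : IsBlockGauss b M F D E) {S : Type*} [Ring S]
    (f : A⟦X⟧ →+* S) (i p : ι) :
    ((if i = p then 1 else 0) + ∑ s : {s // b i < b s}, if s.1 = p then f (E i s) else 0) =
      f (E i p) := by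
  by_cases hip : b i < b p
  · have val_eq (s : {s // b i < b s}) : s.1 = p ↔ s = ⟨p, hip⟩ :=
      (Subtype.ext_iff (a1 := s) (a2 := ⟨p, hip⟩)).symm
    simp only [val_eq, Finset.sum_ite_eq', Finset.mem_univ, if_true,
      if_neg (ne_of_apply_ne b hip.ne), zero_add]
  · rw [hG.upper i p (not_lt.mp hip), Finset.sum_eq_zero, add_zero]
    · split_ifs <;> simp
    · exact fun s _ => if_neg fun e : s.1 = p => hip (e ▸ s.2)

theorem upper_mul_inverse_apply (hG : IsBlockGauss b M F D E) (h0 : matCoeff M 0 = 1)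
    (hMN : M * N = 1) {i j : ι} (h : b i < b j) : (E * N) i j = 0 := by
  refine blockTriangular_of_mul_eq_one (hG.matCoeff_lower_mul_diag h0)
    hG.blockTriangular_lower_mul_diag ?_ h
  rw [← mul_assoc, ← hG.factor, hMN]

theorem inverse_mul_lower_mul_upper (hG : IsBlockGauss b M F D E) (h0 : matCoeff M 0 = 1)
    (hMN : M * N = 1) : N * (F * D) * E = 1 := by
  rw [mul_assoc, ← hG.factor, mul_eq_one_of_mul_eq_one h0 hMN]

theorem upper_mul_inverse_mul_lower (hG : IsBlockGauss b M F D E) (h0 : matCoeff M 0 = 1)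
    (hMN : M * N = 1) : E * (N * (F * D)) = 1 := by
  rw [← mul_assoc]
  refine mul_eq_one_of_mul_eq_one (hG.matCoeff_lower_mul_diag h0) ?_
  rw [← mul_assoc, ← hG.factor, hMN]

theorem blockTriangular_inverse_mul_lower (hG : IsBlockGauss b M F D E)
    (h0 : matCoeff M 0 = 1) (hMN : M * N = 1) : BlockTriangular (N * (F * D)) b :=
  blockTriangular_of_mul_eq_one (hG.coeff_zero h0).2.2 hG.blockTriangular_upper
    (hG.upper_mul_inverse_mul_lower h0 hMN)

end IsBlockGauss

/-- For an upper set `p` of blocks, the inverse of the corner of `M⁻¹` cut out by `p`. -/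
def cornerInv (p : ι → Prop) [DecidablePred p] (F D E : Matrix ι ι A⟦X⟧) :
    Matrix {i // p i} {i // p i} A⟦X⟧ :=
  (F * D).toBlock p p * E.toBlock p p

namespace IsBlockGauss

theorem submatrix_mul_cornerInv (hG : IsBlockGauss b M F D E) {p : ι → Prop} [DecidablePred p]
    (hp : ∀ i j, b i ≤ b j → p i → p j) {κ : Type*} (f : κ → ι) :
    N.submatrix f (Subtype.val : {i // p i} → ι) * cornerInv p F D E =
      (N * (F * D)).submatrix f (Subtype.val : {i // p i} → ι) * E.toBlock p p := by
  rw [submatrix_mul_of_subtype (P := N) p f Subtype.val fun i j s hs => ?_, Matrix.mul_assoc]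
  · rfl
  · rw [hG.blockTriangular_lower_mul_diag (not_le.mp fun hjs => hs (hp _ _ hjs j.2)), mul_zero]

theorem inverse_corner_mul_cornerInv (hG : IsBlockGauss b M F D E) (h0 : matCoeff M 0 = 1)
    (hMN : M * N = 1) {p : ι → Prop} [DecidablePred p] (hp : ∀ i j, b i ≤ b j → p i → p j) :
    N.toBlock p p * cornerInv p F D E = 1 := by
  rw [toBlock, hG.submatrix_mul_cornerInv hp, toBlock, ← submatrix_mul_of_subtype p,
    hG.inverse_mul_lower_mul_upper h0 hMN, submatrix_one _ Subtype.val_injective]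
  intro i j s hs
  rw [hG.blockTriangular_inverse_mul_lower h0 hMN (not_le.mp fun his => hs (hp _ _ his i.2)),
    zero_mul]

theorem cornerInv_mul_inverse_corner (hG : IsBlockGauss b M F D E) (h0 : matCoeff M 0 = 1)
    (hMN : M * N = 1) {p : ι → Prop} [DecidablePred p] (hp : ∀ i j, b i ≤ b j → p i → p j) :
    cornerInv p F D E * N.toBlock p p = 1 :=
  mul_eq_one_of_mul_eq_one
    (matCoeff_submatrix_zero (matCoeff_inverse_zero h0 hMN) Subtype.val_injective)
    (hG.inverse_corner_mul_cornerInv h0 hMN hp)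

theorem inverse_row (hG : IsBlockGauss b M F D E) (h0 : matCoeff M 0 = 1) (hMN : M * N = 1)
    (h : ι) :
    (fun l : {l // b h < b l} => N h l) =
      -((fun s : {s // b h < b s} => E h s) ᵥ* N.toBlock _ _) := by
  ext1 l
  have vanish := hG.upper_mul_inverse_apply h0 hMN l.2
  have split (s : ι) : E h s * N s l.1 =
      (if h = s then N h l.1 else 0) + if b h < b s then E h s * N s l.1 else 0 := by
    by_cases hs : b h < b s
    · rw [if_neg (ne_of_apply_ne b hs.ne), zero_add, if_pos hs]
    · rw [hG.upper h s (not_lt.mp hs), if_neg hs, add_zero, ite_mul, one_mul, zero_mul]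
      exact ite_congr rfl (fun e => congrArg (N · l.1) e.symm) fun _ => rfl
  rw [mul_apply, Finset.sum_congr rfl fun s _ => split s, Finset.sum_add_distrib,
    Finset.sum_ite_eq, if_pos (Finset.mem_univ _),
    sum_eq_sum_subtype (fun s => b h < b s) fun s hs => if_neg hs] at vanish
  rw [eq_neg_of_add_eq_zero_left vanish]
  exact congrArg Neg.neg (Finset.sum_congr rfl fun s _ => if_pos s.2)

end IsBlockGauss

/-! ### Exchange relations for the upper unitriangular factor -/

omit [Fintype ι] [DecidableEq ι] in
theorem RTT.exchange_neg_one {κ κ' : Type*} (hN : RTT (-1) N) (f : κ → ι) (g : κ' → ι) :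
    Exchange (diffYX A) (-prodXY A) ((N.submatrix f g).map inX) ((N.submatrix f g).map inY) := by
  rw [← neg_one_smul ℤ (prodXY A)]
  exact Exchange.submatrix hN f g

namespace IsBlockGauss

variable (hG : IsBlockGauss b M F D E) (h0 : matCoeff M 0 = 1) (hMN : M * N = 1)
include hG h0 hMN

theorem map_inverse_row {S : Type*} [Ring S] (f : A⟦X⟧ →+* S) {h i : ι} (hi : b i = b h) :
    (N.submatrix id (Subtype.val : {l // b h < b l} → ι)).map f i =
      -((fun s : {l // b h < b l} => f (E i s)) ᵥ*
        ((N.submatrix id Subtype.val).map f).submatrix Subtype.val id) := by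
  rw [← hi]
  ext1 l
  have row := congrArg f (congrFun (hG.inverse_row h0 hMN i) l)
  rw [Pi.neg_apply, map_neg, vecMul, dotProduct, map_sum] at row
  simp only [map_mul] at row
  exact row

theorem map_corner_mul_cornerInv {S : Type*} [Ring S] (f : A⟦X⟧ →+* S) (a : β) :
    (N.toBlock (a < b ·) (a < b ·)).map f *
      (cornerInv (a < b ·) F D E).map f = 1 :=
  map_mul_map_eq_one f (hG.inverse_corner_mul_cornerInv h0 hMN fun _ _ hij hi => hi.trans_le hij)

theorem upper_lie_of_eq (hN : RTT (-1) N) {i h p q : ι} (hi : b i = b h) (hp : b h < b p)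
    (hq : b h < b q) :
    diffYX A • diffYX A • ⁅inX (E i q), inY (E h p)⁆ =
      prodXY A • (diffYX A • (inX (E i p) * (inX (E h q) - inY (E h q)) -
          (inX (E h q) - inY (E h q)) * inY (E i p)) +
        prodXY A • ((inX (E h p) - inY (E h p)) * (inX (E i q) - inY (E i q)))) := by
  have rel := (hN.exchange_neg_one id (Subtype.val : {l // b h < b l} → ι)).lie_coeff_same
    (hG.map_inverse_row h0 hMN inX rfl) (hG.map_inverse_row h0 hMN inY rfl)
    (hG.map_inverse_row h0 hMN inX hi) (hG.map_inverse_row h0 hMN inY hi)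
    (hG.map_corner_mul_cornerInv h0 hMN inX (b h)) (hG.map_corner_mul_cornerInv h0 hMN inY (b h))
    ⟨q, hq⟩ ⟨p, hp⟩
  simp only [Pi.sub_apply] at rel
  rw [rel]
  module

theorem upper_lie_of_lt (hN : RTT (-1) N) {i h p q : ι} (hi : b h < b i) (hp : b h < b p)
    (hq : b i < b q) :
    diffYX A • ⁅inX (E i q), inY (E h p)⁆ =
      prodXY A • (inX (E i p) * ∑ t : {t // b h < b t}, (inX (E h t) - inY (E h t)) *
        inX (∑ s : {s // b i < b s}, (N * (F * D)) t s * E s q)) := by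
  let below (s : {s // b i < b s}) : {l // b h < b l} := ⟨s, hi.trans s.2⟩
  set n := (N.submatrix id (Subtype.val : {l // b h < b l} → ι)).map inX
  have row : (fun l => n i (below l)) = -((fun s : {s // b i < b s} => inX (E i s)) ᵥ*
      n.submatrix (Subtype.val ∘ below) below) :=
    hG.map_inverse_row h0 hMN inX (h := i) rfl
  have corner : n.submatrix (Subtype.val ∘ below) below *
      (cornerInv (b i < b ·) F D E).map inX = 1 :=
    hG.map_corner_mul_cornerInv h0 hMN inX (b i)
  have rel := (hN.exchange_neg_one id (Subtype.val : {l // b h < b l} → ι)).lie_coeff_of_lt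
    (hG.map_inverse_row h0 hMN inX rfl) (hG.map_inverse_row h0 hMN inY rfl)
    (hG.map_corner_mul_cornerInv h0 hMN inY (b h)) (i := ⟨i, hi⟩) row corner ⟨q, hq⟩ ⟨p, hp⟩
  have factor_left := hG.ite_add_sum_ite_map_upper inX i p
  have factor_right (t : {t // b h < b t}) :
      (n.submatrix Subtype.val below * (cornerInv (b i < b ·) F D E).map inX) t ⟨q, hq⟩ =
        inX (∑ s : {s // b i < b s}, (N * (F * D)) t s * E s q) := by
    have prod := hG.submatrix_mul_cornerInv (N := N) (p := (b i < b ·))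
      (fun _ _ hij hi => hi.trans_le hij) (Subtype.val : {t // b h < b t} → ι)
    have mapped := congrArg (fun X => X.map inX) prod
    rw [Matrix.map_mul] at mapped
    exact congrFun (congrFun mapped t) ⟨q, hq⟩
  have assoc (v : {t // b h < b t} → Series₂ A) :
      (fun l => (v ᵥ* n.submatrix Subtype.val id) (below l)) ᵥ*
        (cornerInv (b i < b ·) F D E).map inX =
      v ᵥ* (n.submatrix Subtype.val below * (cornerInv (b i < b ·) F D E).map inX) :=
    vecMul_vecMul v (n.submatrix Subtype.val below) _
  simp only [below, Subtype.mk.injEq, factor_left] at rel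
  rw [rel, neg_smul, neg_neg, assoc]
  simp only [vecMul, dotProduct, factor_right, Pi.sub_apply]

end IsBlockGauss

end GaussInverse

/-! ### Filtrations -/

section Filtration

open PowerSeries Finset.HasAntidiagonal

variable {A : Type*} [Ring A]

/-- An increasing multiplicative filtration; `P m` consists of the elements of degree `< m`. -/
structure IsFiltration (P : ℕ → AddSubgroup A) : Prop where
  one_mem : 1 ∈ P 1
  mul_mem : ∀ m n x y, x ∈ P (m + 1) → y ∈ P (n + 1) → x * y ∈ P (m + n + 1)
  le_succ : ∀ m, P m ≤ P (m + 1)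

namespace IsFiltration

variable {P : ℕ → AddSubgroup A} (hP : IsFiltration P)
include hP

theorem mono {m n : ℕ} (h : m ≤ n) : P m ≤ P n :=
  monotone_nat_of_le_succ hP.le_succ h

/-- The series whose coefficient of `u⁻ʳ` has degree at most `r`. -/
def seriesSubring : Subring A⟦X⟧ where
  carrier := {f | ∀ r, coeff r f ∈ P (r + 1)}
  mul_mem' hf hg r := by
    rw [coeff_mul]
    refine sum_mem fun p hp => ?_
    rw [← mem_antidiagonal.mp hp]
    exact hP.mul_mem _ _ _ _ (hf p.1) (hg p.2)
  one_mem' r := by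
    rw [coeff_one]
    split_ifs with hr
    exacts [hr ▸ hP.one_mem, zero_mem _]
  add_mem' hf hg r := by rw [map_add]; exact add_mem (hf r) (hg r)
  zero_mem' r := by rw [map_zero]; exact zero_mem _
  neg_mem' hf r := by rw [map_neg]; exact neg_mem (hf r)

/-- The series whose coefficient of `u⁻ʳ v⁻ˢ` has degree at most `r + s`. -/
def series₂Subring : Subring (Series₂ A) where
  carrier := {f | ∀ r s, coeff₂ r s f ∈ P (r + s + 1)}
  mul_mem' hf hg r s := by
    rw [coeff₂_mul]
    refine sum_mem fun p hp => sum_mem fun q hq => ?_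
    rw [← mem_antidiagonal.mp hp, ← mem_antidiagonal.mp hq, add_add_add_comm]
    exact hP.mul_mem _ _ _ _ (hf p.1 q.1) (hg p.2 q.2)
  one_mem' r s := by
    rw [coeff₂_apply, coeff_one]
    split_ifs with hr
    · rw [hr, zero_add]
      exact hP.seriesSubring.one_mem s
    · rw [map_zero]
      exact zero_mem _
  add_mem' hf hg r s := by rw [map_add]; exact add_mem (hf r s) (hg r s)
  zero_mem' r s := by rw [map_zero]; exact zero_mem _
  neg_mem' hf r s := by rw [map_neg]; exact neg_mem (hf r s)

theorem inX_mem {f : A⟦X⟧} (hf : f ∈ hP.seriesSubring) : inX f ∈ hP.series₂Subring := by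
  intro r s
  rw [coeff₂_apply, inX, coeff_map, coeff_C]
  split_ifs
  · exact hP.mono (by omega) (hf r)
  · exact zero_mem _

theorem inY_mem {f : A⟦X⟧} (hf : f ∈ hP.seriesSubring) : inY f ∈ hP.series₂Subring := by
  intro r s
  rw [coeff₂_apply, inY, coeff_C]
  split_ifs
  · exact hP.mono (by omega) (hf s)
  · rw [map_zero]
    exact zero_mem _

theorem coeff₂_mem_of_diffYX_smul_smul {f g₁ g₂ : Series₂ A}
    (h : diffYX A • diffYX A • f = prodXY A • (diffYX A • g₁ + prodXY A • g₂))
    (hg₁ : g₁ ∈ hP.series₂Subring) (hg₂ : g₂ ∈ hP.series₂Subring) (r s : ℕ) :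
    coeff₂ r s f ∈ P (r + s) := by
  have first : diffYX A • (diffYX A • f - prodXY A • g₁) = prodXY A • prodXY A • g₂ := by
    rw [smul_sub, h, smul_add, smul_comm (diffYX A) (prodXY A), add_sub_cancel_left]
  obtain ⟨e, he⟩ := exists_eq_prodXY_smul first
  have second : diffYX A • e = prodXY A • g₂ := by
    refine prodXY_smul_injective ?_
    change prodXY A • _ = prodXY A • _
    rw [← first, he, smul_comm]
  have he_mem (r s : ℕ) : coeff₂ r s e ∈ P (r + s) :=
    coeff₂_mem_of_diffYX_smul (d := 0) second hg₂ r s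
  have divided : diffYX A • f = prodXY A • (e + g₁) := by
    rw [smul_add, ← he, sub_add_cancel]
  refine coeff₂_mem_of_diffYX_smul (d := 0) divided (fun r s => ?_) r s
  rw [map_add]
  exact add_mem (hP.le_succ _ (he_mem r s)) (hg₁ r s)

variable {ι : Type*} [Fintype ι] [DecidableEq ι]

theorem inverse_mem {M N : Matrix ι ι A⟦X⟧} (h0 : matCoeff M 0 = 1)
    (hM : ∀ i j, M i j ∈ hP.seriesSubring) (hMN : M * N = 1) (i j : ι) :
    N i j ∈ hP.seriesSubring := by
  let S : ℕ → AddSubgroup (Matrix ι ι A) := fun r =>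
    { carrier := {K | ∀ i j, K i j ∈ P (r + 1)}
      add_mem' := fun hx hy i j => add_mem (hx i j) (hy i j)
      zero_mem' := fun _ _ => zero_mem _
      neg_mem' := fun hx i j => neg_mem (hx i j) }
  refine fun r => matCoeff_inverse_mem S (fun i j => ?_) (fun p q x y hx hy i j => ?_) h0
    (fun r i j => hM i j r) hMN r i j
  · rw [one_apply]
    split_ifs
    exacts [hP.one_mem, zero_mem _]
  · rw [mul_apply]
    exact sum_mem fun s _ => hP.mul_mem _ _ _ _ (hx i s) (hy s j)

variable {β : Type*} [LinearOrder β] {b : ι → β} {M F D E : Matrix ι ι A⟦X⟧}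

theorem lie_upper_mem (hG : IsBlockGauss b M F D E) (h0 : matCoeff M 0 = 1) (hM : RTT 1 M)
    (hE : ∀ i j, E i j ∈ hP.seriesSubring) {i j h l : ι} (hij : b i < b j) (hhl : b h < b l)
    (r s : ℕ) : ⁅coeff r (E i j), coeff s (E h l)⁆ ∈ P (r + s) := by
  obtain ⟨N, hMN, hNM⟩ := exists_inverse h0
  have hN : RTT (-1) N := hM.inv hMN hNM
  have hX (i j) : inX (E i j) ∈ hP.series₂Subring := hP.inX_mem (hE i j)
  have hXY (i j) : inX (E i j) - inY (E i j) ∈ hP.series₂Subring :=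
    sub_mem (hX i j) (hP.inY_mem (hE i j))
  have lt {i j h l : ι} (hij : b i < b j) (hhl : b h < b l) (hlt : b h < b i) (r s : ℕ) :
      ⁅coeff r (E i j), coeff s (E h l)⁆ ∈ P (r + s) := by
    have rel := hG.upper_lie_of_lt h0 hMN hN hlt hhl hij
    rw [← coeff₂_lie]
    refine coeff₂_mem_of_diffYX_smul (d := 0) rel ?_ r s
    refine hP.series₂Subring.mul_mem (hX _ _) (sum_mem fun t _ => MulMemClass.mul_mem (hXY _ _) ?_)
    refine hP.inX_mem (sum_mem fun s _ => MulMemClass.mul_mem ?_ (hE _ _))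
    exact hP.inverse_mem (hG.coeff_zero h0).2.2 hE (hG.upper_mul_inverse_mul_lower h0 hMN) _ _
  rcases lt_trichotomy (b i) (b h) with hih | hih | hih
  · rw [← lie_skew, add_comm]
    exact neg_mem (lt hhl hij hih s r)
  · have rel := hG.upper_lie_of_eq h0 hMN hN hih hhl (hih ▸ hij)
    rw [← coeff₂_lie]
    exact hP.coeff₂_mem_of_diffYX_smul_smul rel
      (sub_mem (MulMemClass.mul_mem (hX _ _) (hXY _ _))
        (MulMemClass.mul_mem (hXY _ _) (hP.inY_mem (hE _ _))))
      (MulMemClass.mul_mem (hXY _ _) (hXY _ _)) r s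
  · exact lt hij hhl hih r s

end IsFiltration

end Filtration

section Recursion

open PowerSeries

variable {ι β A : Type*} [Fintype ι] [DecidableEq ι] [LinearOrder β] [Ring A]
  {b : ι → β} {M F D E : Matrix ι ι A⟦X⟧}

omit [Fintype ι] in
theorem constantCoeff_apply_of_matCoeff_zero {M : Matrix ι ι A⟦X⟧} (h : matCoeff M 0 = 1)
    (i j : ι) : constantCoeff (M i j) = if i = j then 1 else 0 := by
  rw [← coeff_zero_eq_constantCoeff_apply, ← one_apply, ← h]
  rfl

theorem constantCoeff_inX (f : A⟦X⟧) : constantCoeff (inX f) = C (constantCoeff f) := by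
  rw [inX, ← coeff_zero_eq_constantCoeff_apply, coeff_map, coeff_zero_eq_constantCoeff_apply]

theorem constantCoeff_inY (f : A⟦X⟧) : constantCoeff (inY f) = f := constantCoeff_C f

theorem IsBlockGauss.upper_recursion (hG : IsBlockGauss b M F D E) (h0 : matCoeff M 0 = 1)
    (hM : RTT 1 M) {h i q : ι} (hi : b h < b i) (hq : b i < b q) (r : ℕ) :
    coeff r (E h q) = ⁅coeff r (E h i), coeff 1 (E i q)⁆ := by
  obtain ⟨N, hMN, hNM⟩ := exists_inverse h0
  have hE := (hG.coeff_zero h0).2.2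
  have hU := matCoeff_inverse_zero hE (hG.upper_mul_inverse_mul_lower h0 hMN)
  have rel := congrArg (coeff₂ 1 (r + 1)) (hG.upper_lie_of_lt h0 hMN (hM.inv hMN hNM) hi hi hq)
  have entry (t : {t // b h < b t}) :
      ∑ s : {s // b i < b s}, constantCoeff ((N * (F * D)) t s * E s q) =
        if t.1 = q then 1 else 0 := by
    have E_const (s : {s // b i < b s}) :
        constantCoeff (E s q) = if s = ⟨q, hq⟩ then 1 else 0 := by
      rw [constantCoeff_apply_of_matCoeff_zero hE]
      exact if_congr (Subtype.ext_iff (a2 := ⟨q, hq⟩)).symm rfl rfl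
    simp only [map_mul, E_const, mul_ite, mul_one, mul_zero, Finset.sum_ite_eq', Finset.mem_univ,
      if_true, constantCoeff_apply_of_matCoeff_zero hU]
  have at_zero : constantCoeff (inX (E i i) * ∑ t : {t // b h < b t}, (inX (E h t) - inY (E h t)) *
      inX (∑ s : {s // b i < b s}, (N * (F * D)) t s * E s q)) = -E h q := by
    rw [hG.upper i i le_rfl, if_pos rfl, map_one, one_mul, map_sum]
    have summand (t : {t // b h < b t}) : constantCoeff ((inX (E h t) - inY (E h t)) *
        inX (∑ s : {s // b i < b s}, (N * (F * D)) t s * E s q)) =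
        if t = ⟨q, hi.trans hq⟩ then -E h q else 0 := by
      rw [map_mul, map_sub, constantCoeff_inX, constantCoeff_inX, constantCoeff_inY,
        hG.upper_const h t t.2, map_sum, entry, map_zero, zero_sub]
      by_cases ht : t.1 = q
      · rw [if_pos ht, if_pos (Subtype.ext ht), map_one, mul_one, ht]
      · rw [if_neg ht, if_neg fun e => ht (congrArg Subtype.val e), map_zero, mul_zero]
    simp only [summand, Finset.sum_ite_eq', Finset.mem_univ, if_true]
  rw [coeff₂_diffYX_smul_succ_succ, coeff₂_prodXY_smul_succ_succ, coeff₂_lie, coeff₂_lie,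
    coeff_zero_eq_constantCoeff_apply, hG.upper_const i q hq, zero_lie, sub_zero, coeff₂_apply,
    coeff_zero_eq_constantCoeff_apply, at_zero, map_neg] at rel
  rw [← lie_skew, rel, neg_neg]

end Recursion

/-! ### Coefficients of the Gauss factors -/

section GaussCoeff

open PowerSeries Finset.HasAntidiagonal

variable {ι β A : Type*} [Fintype ι] [DecidableEq ι] [LinearOrder β] [Ring A]
  {b : ι → β} {M F D E : Matrix ι ι A⟦X⟧}

theorem coeff_add_sub_mul_mem (hF : matCoeff F 0 = 1) (hD : matCoeff D 0 = 1)
    (hE : matCoeff E 0 = 1) (Q : AddSubgroup A) {r : ℕ} (hr : 0 < r)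
    (h : ∀ p q s, p < r → q < r → s < r → p + q + s = r → ∀ i k l j,
      coeff p (F i k) * coeff q (D k l) * coeff s (E l j) ∈ Q) (i j : ι) :
    coeff r (F i j) + coeff r (D i j) + coeff r (E i j) - coeff r ((F * D * E) i j) ∈ Q := by
  have expansion := coeff_mul3 (matCoeff F) (matCoeff D) (matCoeff E) hF hD hE r hr
  rw [← mk_matCoeff_mul, ← mk_matCoeff_mul, coeff_mk] at expansion
  have entry : coeff r ((F * D * E) i j) = coeff r (F i j) + coeff r (D i j) +
      coeff r (E i j) + _ := congrFun (congrFun expansion i) j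
  rw [entry, sub_add_cancel_left, coeff_mul, Matrix.sum_apply]
  refine neg_mem (sum_mem fun x hx => ?_)
  rw [coeff_mul, Finset.sum_mul, Matrix.sum_apply]
  refine sum_mem fun y hy => ?_
  rw [mem_antidiagonal] at hx hy
  simp only [coeff_mk, truncBelow]
  split_ifs with hp hq hs
  · rw [mul_apply]
    refine sum_mem fun l _ => ?_
    rw [mul_apply, Finset.sum_mul]
    exact sum_mem fun k _ => h _ _ _ hp hq hs (by omega) i k l j
  all_goals simp only [mul_zero, zero_mul, Matrix.zero_apply, zero_mem]

namespace IsBlockGauss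

omit [Fintype ι] in
theorem coeff_ite_one {r : ℕ} (hr : r ≠ 0) (p : Prop) [Decidable p] :
    coeff r (if p then (1 : A⟦X⟧) else 0) = 0 := by
  split_ifs
  · rw [coeff_one, if_neg hr]
  · exact map_zero _

theorem coeff_lower_eq_zero (hG : IsBlockGauss b M F D E) {r : ℕ} (hr : r ≠ 0) {i j : ι}
    (h : b i ≤ b j) : coeff r (F i j) = 0 := by
  rw [hG.lower i j h, coeff_ite_one hr]

theorem coeff_upper_eq_zero (hG : IsBlockGauss b M F D E) {r : ℕ} (hr : r ≠ 0) {i j : ι}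
    (h : b j ≤ b i) : coeff r (E i j) = 0 := by
  rw [hG.upper i j h, coeff_ite_one hr]

/-- At most one of the three summands is nonzero. -/
theorem coeff_mem_of_sum_mem (hG : IsBlockGauss b M F D E) {Q : AddSubgroup A} {r : ℕ}
    (hr : r ≠ 0) {i j : ι} (h : coeff r (F i j) + coeff r (D i j) + coeff r (E i j) ∈ Q) :
    coeff r (F i j) ∈ Q ∧ coeff r (D i j) ∈ Q ∧ coeff r (E i j) ∈ Q := by
  rcases lt_trichotomy (b i) (b j) with hij | hij | hij
  · rw [hG.coeff_lower_eq_zero hr hij.le, hG.diag i j hij.ne, map_zero, zero_add, zero_add] at *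
    exact ⟨zero_mem _, zero_mem _, h⟩
  · rw [hG.coeff_lower_eq_zero hr hij.le, hG.coeff_upper_eq_zero hr hij.ge, zero_add,
      add_zero] at *
    exact ⟨zero_mem _, h, zero_mem _⟩
  · rw [hG.coeff_upper_eq_zero hr hij.le, hG.diag i j hij.ne', map_zero, add_zero, add_zero] at *
    exact ⟨h, zero_mem _, zero_mem _⟩

end IsBlockGauss

theorem IsFiltration.gauss_mem {P : ℕ → AddSubgroup A} (hP : IsFiltration P)
    (hG : IsBlockGauss b M F D E) (h0 : matCoeff M 0 = 1) (hM : ∀ i j, M i j ∈ hP.seriesSubring)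
    (i j : ι) : F i j ∈ hP.seriesSubring ∧ D i j ∈ hP.seriesSubring ∧
      E i j ∈ hP.seriesSubring := by
  obtain ⟨hF, hD, hE⟩ := hG.coeff_zero h0
  suffices ∀ r i j, coeff r (F i j) ∈ P (r + 1) ∧ coeff r (D i j) ∈ P (r + 1) ∧
      coeff r (E i j) ∈ P (r + 1) from
    ⟨fun r => (this r i j).1, fun r => (this r i j).2.1, fun r => (this r i j).2.2⟩
  intro r
  induction r using Nat.strong_induction_on with
  | _ r ih =>
    intro i j
    rcases eq_or_ne r 0 with rfl | hr
    · have const {K : Matrix ι ι A⟦X⟧} (hK : matCoeff K 0 = 1) : coeff 0 (K i j) ∈ P 1 := by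
        rw [coeff_zero_eq_constantCoeff_apply, constantCoeff_apply_of_matCoeff_zero hK]
        split_ifs
        exacts [hP.one_mem, zero_mem _]
      exact ⟨const hF, const hD, const hE⟩
    · have sum_sub_mem := coeff_add_sub_mul_mem hF hD hE (P (r + 1)) (Nat.pos_of_ne_zero hr)
        (fun p q s hp hq hs hpqs i k l j => by
          rw [← hpqs]
          exact hP.mul_mem _ _ _ _ (hP.mul_mem _ _ _ _ (ih p hp i k).1 (ih q hq k l).2.1)
            (ih s hs l j).2.2) i j
      rw [← hG.factor] at sum_sub_mem
      refine hG.coeff_mem_of_sum_mem hr ?_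
      rw [← sub_add_cancel (_ + coeff r (E i j)) (coeff r (M i j))]
      exact add_mem sum_sub_mem (hM i j r)

/-- For this filtration, `seriesSubring` consists of the series commuting with `x`. -/
theorem isFiltration_centralizer (x : A) :
    IsFiltration fun _ => (Subring.centralizer {x}).toAddSubgroup where
  one_mem := one_mem (Subring.centralizer {x})
  mul_mem _ _ _ _ hx hy := (Subring.centralizer {x}).mul_mem hx hy
  le_succ _ := le_rfl

theorem mem_centralizer_singleton {x y : A} : y ∈ Subring.centralizer {x} ↔ Commute x y := by
  simp only [Subring.mem_centralizer_iff, Set.mem_singleton_iff, forall_eq, commute_iff_eq]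

/-! ### The block diagonal factor -/

namespace IsBlockGauss

theorem toBlock (hG : IsBlockGauss b M F D E) (p : ι → Prop) [DecidablePred p]
    (hp : ∀ i j, b i ≤ b j → p j → p i) :
    IsBlockGauss (fun i : {i // p i} => b i) (M.toBlock p p) (F.toBlock p p) (D.toBlock p p)
      (E.toBlock p p) where
  factor := by
    have upper_zero (j : {j // p j}) (t : ι) (ht : ¬p t) : E t j = 0 := by
      have hlt : b j < b t := not_le.mp fun h => ht (hp _ _ h j.2)
      rw [hG.upper t j hlt.le, if_neg (ne_of_apply_ne b hlt.ne')]
    have lower_zero (i : {i // p i}) (s : ι) (hs : ¬p s) : F i s = 0 := by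
      have hlt : b i < b s := not_le.mp fun h => hs (hp _ _ h i.2)
      rw [hG.lower i s hlt.le, if_neg (ne_of_apply_ne b hlt.ne)]
    rw [hG.factor]
    exact (submatrix_mul_of_subtype p (Subtype.val : {i // p i} → ι) Subtype.val
      fun i j t ht => by rw [upper_zero j t ht, mul_zero]).trans
      (congrArg (· * E.toBlock p p) (submatrix_mul_of_subtype p Subtype.val Subtype.val
        fun i j s hs => by rw [lower_zero i s hs, zero_mul]))
  diag i j h := hG.diag i j h
  upper i j h := (hG.upper i j h).trans (if_congr Subtype.ext_iff.symm rfl rfl)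
  lower i j h := (hG.lower i j h).trans (if_congr Subtype.ext_iff.symm rfl rfl)
  upper_const i j h := hG.upper_const i j h
  lower_const i j h := hG.lower_const i j h

theorem cornerInv_apply (hG : IsBlockGauss b M F D E) {i j : ι} (hij : b i = b j) :
    cornerInv (fun l => b i ≤ b l) F D E ⟨i, le_rfl⟩ ⟨j, hij.le⟩ = D i j := by
  rw [cornerInv, mul_apply, Finset.sum_eq_single ⟨j, hij.le⟩]
  · rw [toBlock_apply, toBlock_apply, hG.upper j j le_rfl, if_pos rfl, mul_one,
      hG.lower_mul_diag_of_le hij.le]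
  · intro t _ ht
    have hne : (t : ι) ≠ j := fun e => ht (Subtype.ext e)
    rw [toBlock_apply E, hG.upper t j (hij ▸ t.2), if_neg hne, mul_zero]
  · exact fun h => absurd (Finset.mem_univ _) h

theorem rtt_diag (hG : IsBlockGauss b M F D E) (h0 : matCoeff M 0 = 1) (hM : RTT 1 M) (a : β) :
    RTT 1 (D.submatrix (Subtype.val : {i // b i = a} → ι) Subtype.val) := by
  obtain ⟨N, hMN, hNM⟩ := exists_inverse h0
  have hp (i j : ι) (hij : b i ≤ b j) (hi : a ≤ b i) : a ≤ b j := hi.trans hij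
  have rtt_corner := ((hM.inv hMN hNM).submatrix (Subtype.val : {i // a ≤ b i} → ι)).inv
    (hG.inverse_corner_mul_cornerInv h0 hMN hp) (hG.cornerInv_mul_inverse_corner h0 hMN hp)
  have rtt_block := rtt_corner.submatrix
    (fun i : {i // b i = a} => (⟨i, i.2.ge⟩ : {i // a ≤ b i}))
  rw [neg_neg] at rtt_block
  convert rtt_block using 1
  ext1 ⟨i, hi⟩ j
  subst hi
  exact (hG.cornerInv_apply j.2.symm).symm

theorem commute_diag (hG : IsBlockGauss b M F D E) (h0 : matCoeff M 0 = 1) (hM : RTT 1 M)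
    {i j h l : ι} (hij : b i = b j) (hhl : b h = b l) (hlt : b i < b h) (r s : ℕ) :
    Commute (coeff r (D i j)) (coeff s (D h l)) := by
  obtain ⟨N, hMN, hNM⟩ := exists_inverse h0
  have commute_corner (i j : {i // b i < b h}) (r : ℕ) :
      Commute (coeff r (M i j)) (coeff s (D h l)) := by
    have hp (i j : ι) (hij : b i ≤ b j) (hi : b h ≤ b i) : b h ≤ b j := hi.trans hij
    rw [← hG.cornerInv_apply hhl, ← mem_centralizer_singleton]
    refine (isFiltration_centralizer _).inverse_mem
      (matCoeff_submatrix_zero (matCoeff_inverse_zero h0 hMN) Subtype.val_injective)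
      (fun i' j' r' => ?_) (hG.inverse_corner_mul_cornerInv h0 hMN hp) _ _ s
    exact mem_centralizer_singleton.mpr (hM.commute_inv hMN hNM
      (ne_of_apply_ne b (j.2.trans_le i'.2).ne') (ne_of_apply_ne b (i.2.trans_le j'.2).ne) r r')
  have mem := (isFiltration_centralizer (coeff s (D h l))).gauss_mem
    (hG.toBlock (fun i => b i < b h) fun i j hij hj => hij.trans_lt hj)
    (matCoeff_submatrix_zero h0 Subtype.val_injective)
    (fun i j r => mem_centralizer_singleton.mpr (commute_corner i j r).symm)
    ⟨i, hlt⟩ ⟨j, hij ▸ hlt⟩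
  exact (mem_centralizer_singleton.mp (mem.2.1 r)).symm

end IsBlockGauss

namespace IsFiltration

variable {P : ℕ → AddSubgroup A} (hP : IsFiltration P)
include hP

omit [Fintype ι] [DecidableEq ι] in
theorem lie_mem_of_rtt (hM : RTT 1 M) (hMP : ∀ i j, M i j ∈ hP.seriesSubring) (i j h l : ι)
    (r s : ℕ) : ⁅coeff r (M i j), coeff s (M h l)⁆ ∈ P (r + s) := by
  have rel := hM i j h l
  rw [one_smul] at rel
  rw [← coeff₂_lie]
  exact coeff₂_mem_of_diffYX_smul (d := 0) rel
    (sub_mem (MulMemClass.mul_mem (hP.inX_mem (hMP _ _)) (hP.inY_mem (hMP _ _)))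
      (MulMemClass.mul_mem (hP.inY_mem (hMP _ _)) (hP.inX_mem (hMP _ _)))) r s

theorem lie_diag_mem (hG : IsBlockGauss b M F D E) (h0 : matCoeff M 0 = 1) (hM : RTT 1 M)
    (hD : ∀ i j, D i j ∈ hP.seriesSubring) {i j h l : ι} (hij : b i = b j) (hhl : b h = b l)
    (r s : ℕ) : ⁅coeff r (D i j), coeff s (D h l)⁆ ∈ P (r + s) := by
  rcases lt_trichotomy (b i) (b h) with hih | hih | hih
  · rw [(hG.commute_diag h0 hM hij hhl hih r s).lie_eq]
    exact zero_mem _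
  · exact hP.lie_mem_of_rtt (hG.rtt_diag h0 hM (b h)) (fun _ _ => hD _ _)
      ⟨i, hih⟩ ⟨j, hij ▸ hih⟩ ⟨h, rfl⟩ ⟨l, hhl.symm⟩ r s
  · rw [(hG.commute_diag h0 hM hhl hij hih s r).symm.lie_eq]
    exact zero_mem _

end IsFiltration

/-! ### Transposition -/

section Transpose

open MulOpposite

/-- The power series obtained by moving the coefficients to the opposite ring. -/
def opSeries : A⟦X⟧ →+ Aᵐᵒᵖ⟦X⟧ where
  toFun f := mk fun r => op (coeff r f)
  map_zero' := by ext r; rw [coeff_mk, map_zero, op_zero, map_zero]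
  map_add' f g := by ext r; simp only [coeff_mk, map_add, op_add]

theorem coeff_opSeries (r : ℕ) (f : A⟦X⟧) : coeff r (opSeries f) = op (coeff r f) :=
  coeff_mk r fun r => op (coeff r f)

theorem opSeries_one : opSeries (1 : A⟦X⟧) = 1 := by
  ext r
  rw [coeff_opSeries, coeff_one, coeff_one, apply_ite op, op_one, op_zero]

theorem opSeries_mul (f g : A⟦X⟧) : opSeries (f * g) = opSeries g * opSeries f := by
  ext r
  rw [coeff_opSeries, coeff_mul, coeff_mul, ← Finset.Nat.sum_antidiagonal_swap, Finset.op_sum]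
  exact Finset.sum_congr rfl fun p _ => by
    rw [coeff_opSeries, coeff_opSeries, ← op_mul, Prod.fst_swap, Prod.snd_swap]

/-- The transposed matrix over the opposite ring; it interchanges the roles of `F` and `E`. -/
def opTranspose (M : Matrix ι ι A⟦X⟧) : Matrix ι ι Aᵐᵒᵖ⟦X⟧ :=
  Mᵀ.map opSeries

omit [Fintype ι] [DecidableEq ι] in
theorem coeff_opTranspose (M : Matrix ι ι A⟦X⟧) (i j : ι) (r : ℕ) :
    coeff r (opTranspose M i j) = op (coeff r (M j i)) :=
  coeff_opSeries _ _

omit [DecidableEq ι] in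
theorem opTranspose_mul (M N : Matrix ι ι A⟦X⟧) :
    opTranspose (M * N) = opTranspose N * opTranspose M := by
  ext1 i j
  simp only [opTranspose, map_apply, transpose_apply, mul_apply, map_sum, opSeries_mul]

omit [Fintype ι] in
theorem matCoeff_opTranspose_zero (h0 : matCoeff M 0 = 1) : matCoeff (opTranspose M) 0 = 1 := by
  ext i j
  calc coeff 0 (opTranspose M i j) = op (matCoeff M 0 j i) := coeff_opTranspose M i j 0
    _ = (1 : Matrix ι ι Aᵐᵒᵖ) i j := by
      rw [h0, one_apply, one_apply, apply_ite op, op_one, op_zero]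
      exact if_congr eq_comm rfl rfl

omit [Fintype ι] [DecidableEq ι] in
theorem RTT.opTranspose (hM : RTT 1 M) : RTT 1 (opTranspose M) := by
  have lie_op (x y : A) : ⁅op x, op y⁆ = op ⁅y, x⁆ := by
    rw [Ring.lie_def, Ring.lie_def, op_sub, op_mul, op_mul]
  obtain ⟨zero, succ⟩ := rtt_iff.mp hM
  refine rtt_iff.mpr ⟨fun i j h l s => ?_, fun i j h l r s => ?_⟩
  · rw [coeff_opTranspose, coeff_opTranspose, lie_op, ← lie_skew, zero, neg_zero, op_zero]
  · have rel := congrArg op (succ j i l h r s)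
    simp only [one_smul, op_sub, op_mul] at rel
    simp only [coeff_opTranspose, one_smul, lie_op, ← lie_skew (coeff _ (M j i)), op_neg] at rel ⊢
    rw [← neg_inj, neg_sub, neg_sub]
    calc _ = _ := by abel
      _ = _ := rel

theorem IsBlockGauss.opTranspose (hG : IsBlockGauss b M F D E) :
    IsBlockGauss b (opTranspose M) (opTranspose E) (opTranspose D) (opTranspose F) where
  factor := by rw [hG.factor, opTranspose_mul, opTranspose_mul, mul_assoc]
  diag i j h := by
    rw [Yang.opTranspose, map_apply, transpose_apply, hG.diag j i h.symm, map_zero]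
  upper i j h := by
    rw [Yang.opTranspose, map_apply, transpose_apply, hG.lower j i h, apply_ite opSeries,
      opSeries_one, map_zero]
    exact if_congr eq_comm rfl rfl
  lower i j h := by
    rw [Yang.opTranspose, map_apply, transpose_apply, hG.upper j i h, apply_ite opSeries,
      opSeries_one, map_zero]
    exact if_congr eq_comm rfl rfl
  upper_const i j h := by
    rw [← coeff_zero_eq_constantCoeff_apply, coeff_opTranspose,
      coeff_zero_eq_constantCoeff_apply, hG.lower_const j i h, op_zero]
  lower_const i j h := by
    rw [← coeff_zero_eq_constantCoeff_apply, coeff_opTranspose,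
      coeff_zero_eq_constantCoeff_apply, hG.upper_const j i h, op_zero]

theorem IsBlockGauss.lower_recursion (hG : IsBlockGauss b M F D E) (h0 : matCoeff M 0 = 1)
    (hM : RTT 1 M) {h i q : ι} (hi : b h < b i) (hq : b i < b q) (r : ℕ) :
    coeff r (F q h) = ⁅coeff 1 (F q i), coeff r (F i h)⁆ := by
  have upper := hG.opTranspose.upper_recursion (matCoeff_opTranspose_zero h0) hM.opTranspose hi hq r
  simp only [coeff_opTranspose, Ring.lie_def, ← op_mul, ← op_sub] at upper
  exact op_injective upper

theorem IsFiltration.op {P : ℕ → AddSubgroup A} (hP : IsFiltration P) :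
    IsFiltration fun m => (P m).comap (opAddEquiv (α := A)).symm.toAddMonoidHom where
  one_mem := hP.one_mem
  mul_mem m n x y hx hy := by
    rw [add_comm m n]
    exact hP.mul_mem n m _ _ hy hx
  le_succ m _ hx := hP.le_succ m hx

theorem IsFiltration.lie_lower_mem {P : ℕ → AddSubgroup A} (hP : IsFiltration P)
    (hG : IsBlockGauss b M F D E) (h0 : matCoeff M 0 = 1) (hM : RTT 1 M)
    (hF : ∀ i j, F i j ∈ hP.seriesSubring) {i j h l : ι} (hij : b j < b i) (hhl : b l < b h)
    (r s : ℕ) : ⁅coeff r (F i j), coeff s (F h l)⁆ ∈ P (r + s) := by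
  have upper := hP.op.lie_upper_mem hG.opTranspose (matCoeff_opTranspose_zero h0) hM.opTranspose
    (fun i j r => by rw [coeff_opTranspose]; exact hF j i r) hhl hij s r
  rw [coeff_opTranspose, coeff_opTranspose, add_comm] at upper
  exact upper

end Transpose

end GaussCoeff

/-! ### Spans of words and straightening -/

section Words

theorem IsFiltration.list_prod_mem {I A : Type*} [Ring A] {P : ℕ → AddSubgroup A}
    (hP : IsFiltration P) {x : I → A} {w : I → ℕ} (h : ∀ i, x i ∈ P (w i + 1)) (l : List I) :
    (l.map x).prod ∈ P ((l.map w).sum + 1) := by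
  induction l with
  | nil => exact hP.one_mem
  | cons i l ih =>
    simp only [List.map_cons, List.prod_cons, List.sum_cons]
    exact hP.mul_mem _ _ _ _ (h i) ih

variable {k I A : Type*} [CommRing k] [Ring A] [Algebra k A]

variable (k) in
/-- The span of the words of weight `< m` in the letters `x i`, where `x i` has weight `w i`. -/
def wordSpan (x : I → A) (w : I → ℕ) (m : ℕ) : Submodule k A :=
  Submodule.span k {y | ∃ l : List I, (l.map w).sum < m ∧ (l.map x).prod = y}

variable {x : I → A} {w : I → ℕ}

theorem list_prod_mem_wordSpan (l : List I) {m : ℕ} (h : (l.map w).sum < m) :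
    (l.map x).prod ∈ wordSpan k x w m :=
  Submodule.subset_span ⟨l, h, rfl⟩

theorem mem_wordSpan (i : I) : x i ∈ wordSpan k x w (w i + 1) := by
  simpa only [List.map_singleton, List.prod_singleton] using
    list_prod_mem_wordSpan (k := k) (x := x) (w := w) (m := w i + 1) [i] (by simp)

theorem wordSpan_mono {m n : ℕ} (h : m ≤ n) : wordSpan k x w m ≤ wordSpan k x w n :=
  Submodule.span_mono fun _ ⟨l, hl, e⟩ => ⟨l, hl.trans_le h, e⟩

/-- Weights being `< m` and `< n` means `≤ m - 1` and `≤ n - 1`, whence the additional `1`. -/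
theorem mul_mem_wordSpan {m n p : ℕ} (h : m + n ≤ p + 1) {y z : A} (hy : y ∈ wordSpan k x w m)
    (hz : z ∈ wordSpan k x w n) : y * z ∈ wordSpan k x w p := by
  have product := Submodule.mul_mem_mul hy hz
  rw [wordSpan, wordSpan, Submodule.span_mul_span] at product
  refine Submodule.span_mono ?_ product
  rintro _ ⟨_, ⟨l, hl, rfl⟩, _, ⟨l', hl', rfl⟩, rfl⟩
  refine ⟨l ++ l', ?_, ?_⟩
  · rw [List.map_append, List.sum_append]
    omega
  · rw [List.map_append, List.prod_append]

theorem isFiltration_wordSpan : IsFiltration fun m => (wordSpan k x w m).toAddSubgroup where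
  one_mem := list_prod_mem_wordSpan [] Nat.zero_lt_one
  mul_mem _ _ _ _ hy hz := mul_mem_wordSpan (by omega) hy hz
  le_succ m := wordSpan_mono m.le_succ

theorem wordSpan_le {J : Type*} {y : J → A} {v : J → ℕ}
    (h : ∀ i, x i ∈ wordSpan k y v (w i + 1)) (m : ℕ) : wordSpan k x w m ≤ wordSpan k y v m := by
  refine Submodule.span_le.mpr ?_
  rintro _ ⟨l, hl, rfl⟩
  exact wordSpan_mono hl (isFiltration_wordSpan.list_prod_mem h l)

theorem list_prod_mem_adjoin (l : List I) : (l.map x).prod ∈ Algebra.adjoin k (Set.range x) := by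
  refine list_prod_mem fun y hy => ?_
  obtain ⟨i, -, rfl⟩ := List.mem_map.mp hy
  exact Algebra.subset_adjoin ⟨i, rfl⟩

theorem wordSpan_le_adjoin (m : ℕ) :
    wordSpan k x w m ≤ Subalgebra.toSubmodule (Algebra.adjoin k (Set.range x)) := by
  refine Submodule.span_le.mpr ?_
  rintro _ ⟨l, -, rfl⟩
  exact list_prod_mem_adjoin l

variable (k) in
/-- Commutators of letters are combinations of words of smaller weight, so that words can be
reordered modulo smaller weight. -/
def Straightens (x : I → A) (w : I → ℕ) : Prop :=
  ∀ i j, ⁅x i, x j⁆ ∈ wordSpan k x w (w i + w j)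

namespace Straightens

variable (hx : Straightens k x w)
include hx

theorem prod_sub_prod_mem {l l' : List I} (h : l.Perm l') :
    (l.map x).prod - (l'.map x).prod ∈ wordSpan k x w (l.map w).sum := by
  induction h with
  | nil =>
    rw [sub_self]
    exact zero_mem _
  | cons a _ ih =>
    simp only [List.map_cons, List.prod_cons, List.sum_cons, ← mul_sub]
    exact mul_mem_wordSpan (by omega) (mem_wordSpan a) ih
  | swap a b l =>
    simp only [List.map_cons, List.prod_cons, List.sum_cons, ← mul_assoc, ← sub_mul, ← add_assoc]
    exact mul_mem_wordSpan (m := w b + w a) (n := (l.map w).sum + 1) (by omega) (hx b a)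
      (list_prod_mem_wordSpan l (Nat.lt_succ_self _))
  | trans h₁ _ ih₁ ih₂ =>
    rw [← (h₁.map w).sum_eq] at ih₂
    simpa only [sub_add_sub_cancel] using add_mem ih₁ ih₂

theorem lie_mem {m n : ℕ} {y z : A} (hy : y ∈ wordSpan k x w (m + 1))
    (hz : z ∈ wordSpan k x w (n + 1)) : ⁅y, z⁆ ∈ wordSpan k x w (m + n) := by
  induction hy, hz using Submodule.span_induction₂ with
  | mem_mem y z hy hz =>
    obtain ⟨l, hl, rfl⟩ := hy
    obtain ⟨l', hl', rfl⟩ := hz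
    have swap := hx.prod_sub_prod_mem (List.perm_append_comm (l₁ := l) (l₂ := l'))
    simp only [List.map_append, List.prod_append, List.sum_append] at swap
    exact wordSpan_mono (by omega) swap
  | zero_left z => rw [zero_lie]; exact zero_mem _
  | zero_right y => rw [lie_zero]; exact zero_mem _
  | add_left y y' z _ _ _ h h' => rw [add_lie]; exact add_mem h h'
  | add_right y z z' _ _ _ h h' => rw [lie_add]; exact add_mem h h'
  | smul_left c y z _ _ h =>
    rw [Ring.lie_def, smul_mul_assoc, mul_smul_comm, ← smul_sub]
    exact Submodule.smul_mem _ _ h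
  | smul_right c y z _ _ h =>
    rw [Ring.lie_def, smul_mul_assoc, mul_smul_comm, ← smul_sub]
    exact Submodule.smul_mem _ _ h

theorem wordSpan_le_span (lo : LinearOrder I) (m : ℕ) :
    wordSpan k x w m ≤ Submodule.span k (Set.range (orderedMonomial lo x)) := by
  induction m using Nat.strong_induction_on with
  | _ m ih =>
    refine Submodule.span_le.mpr ?_
    rintro _ ⟨l, hl, rfl⟩
    have smaller : (l.map x).prod - orderedMonomial lo x (l : Multiset I) ∈
        wordSpan k x w (l.map w).sum :=
      hx.prod_sub_prod_mem (Multiset.coe_eq_coe.mp (Multiset.sort_eq _ _).symm)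
    rw [← sub_add_cancel (l.map x).prod (orderedMonomial lo x (l : Multiset I))]
    exact add_mem (ih _ hl smaller) (Submodule.subset_span ⟨l, rfl⟩)

theorem span_orderedMonomial (lo : LinearOrder I) :
    Submodule.span k (Set.range (orderedMonomial lo x)) =
      Subalgebra.toSubmodule (Algebra.adjoin k (Set.range x)) := by
  refine le_antisymm (Submodule.span_le.mpr ?_) ?_
  · rintro _ ⟨s, rfl⟩
    exact list_prod_mem_adjoin _
  · rw [Algebra.adjoin_eq_span]
    refine Submodule.span_le.mpr fun y hy => ?_
    obtain ⟨l, hl, rfl⟩ := Submonoid.exists_list_of_mem_closure hy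
    obtain ⟨l, rfl⟩ : l ∈ Set.range (List.map x) := by rwa [Set.range_list_map]
    exact hx.wordSpan_le_span lo _ (list_prod_mem_wordSpan l (Nat.lt_succ_self _))

end Straightens

end Words

/-! ### Differential operators satisfying the relations of `gl_n` -/

section Model

open Polynomial

section

variable {ι R : Type*} [Ring R]

theorem lie_C_add_monomial (a a' b b' : R) :
    ⁅C a + monomial 1 a', C b + monomial 1 b'⁆ =
      C ⁅a, b⁆ + monomial 1 (⁅a, b'⁆ - ⁅b, a'⁆) + monomial 2 ⁅a', b'⁆ := by
  simp only [Ring.lie_def, add_mul, mul_add, ← monomial_zero_left, monomial_mul_monomial, map_sub]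
  abel

variable [DecidableEq ι]

/-- The commutation relations of the matrix units of `gl_n`. -/
def MatrixUnitRelations (e : Matrix ι ι R) : Prop :=
  ∀ i j h l, ⁅e i j, e h l⁆ = (if h = j then e i l else 0) - (if i = l then e h j else 0)

theorem MatrixUnitRelations.add_monomial {d z : Matrix ι ι R} (hd : MatrixUnitRelations d)
    (hdz : ∀ i j h l, ⁅d i j, z h l⁆ = if h = j then z i l else 0)
    (hz : ∀ i j h l, ⁅z i j, z h l⁆ = 0) :
    MatrixUnitRelations (of fun i j => C (d i j) + monomial 1 (z i j)) := by
  intro i j h l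
  simp only [of_apply, lie_C_add_monomial, hd i j h l, hdz, hz, map_zero, add_zero, map_sub,
    apply_ite C, apply_ite (monomial 1)]
  split_ifs <;> abel

end

/-- Polynomials in the entries of countably many matrices of variables; the variable `(p, i, j)` is
the `(i, j)` entry of the matrix number `p`. -/
abbrev MatrixPoly (ι : Type*) : Type _ := MvPolynomial (ℕ × ι × ι) ℂ

/-- The linear operators on `MatrixPoly ι`. -/
abbrev Op (ι : Type*) : Type _ := Module.End ℂ (MatrixPoly ι)

variable {ι : Type*}

/-- The operators of multiplication by polynomials. -/
def mulOp : MatrixPoly ι →ₐ[ℂ] Op ι := Algebra.lmul ℂ (MatrixPoly ι)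

theorem mulOp_injective : Function.Injective (mulOp (ι := ι)) := Algebra.lmul_injective

theorem lie_mulOp (f g : MatrixPoly ι) : ⁅mulOp f, mulOp g⁆ = 0 :=
  ((Commute.all f g).map mulOp).lie_eq

variable [DecidableEq ι]

/-- The derivation induced by the matrix unit `e_{ij}` acting on the matrix of variables number `p`
by left multiplication. -/
def rowDer (p : ℕ) (i j : ι) : Derivation ℂ (MatrixPoly ι) (MatrixPoly ι) :=
  MvPolynomial.mkDerivation ℂ fun v =>
    if v.1 = p ∧ v.2.1 = j then MvPolynomial.X (p, i, v.2.2) else 0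

theorem rowDer_X (p : ℕ) (i j : ι) (v : ℕ × ι × ι) :
    rowDer p i j (MvPolynomial.X v) =
      if v.1 = p ∧ v.2.1 = j then MvPolynomial.X (p, i, v.2.2) else 0 :=
  MvPolynomial.mkDerivation_X _ _ _

theorem lie_rowDer (p : ℕ) (i j h l : ι) :
    ⁅rowDer p i j, rowDer p h l⁆ =
      (if h = j then rowDer p i l else 0) - (if i = l then rowDer p h j else 0) := by
  refine MvPolynomial.derivation_ext fun ⟨a, b, c⟩ => ?_
  rw [Derivation.commutator_apply, rowDer_X, rowDer_X, apply_ite (rowDer p i j),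
    apply_ite (rowDer p h l), map_zero, map_zero, rowDer_X, rowDer_X]
  by_cases hhj : h = j <;> by_cases hil : i = l <;>
    simp only [hhj, hil, if_true, if_false, Derivation.sub_apply, Derivation.zero_apply,
      rowDer_X, and_true, and_false] <;> split_ifs <;> simp_all

theorem lie_rowDer_of_ne {p q : ℕ} (h : p ≠ q) (i j i' j' : ι) :
    ⁅rowDer p i j, rowDer q i' j'⁆ = 0 := by
  refine MvPolynomial.derivation_ext fun v => ?_
  rw [Derivation.commutator_apply, rowDer_X, rowDer_X, apply_ite (rowDer p i j),
    apply_ite (rowDer q i' j'), map_zero, map_zero, rowDer_X, rowDer_X]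
  simp [h, h.symm]

/-- The derivation `rowDer` as an operator. -/
def derOp (p : ℕ) : Matrix ι ι (Op ι) :=
  of fun i j => (rowDer p i j : MatrixPoly ι →ₗ[ℂ] MatrixPoly ι)

theorem matrixUnitRelations_derOp (p : ℕ) : MatrixUnitRelations (derOp (ι := ι) p) := by
  intro i j h l
  rw [derOp, of_apply, of_apply, ← Derivation.commutator_coe_linear_map, lie_rowDer]
  split_ifs <;> rfl

theorem commute_derOp {p q : ℕ} (hpq : p ≠ q) (i j h l : ι) :
    Commute (derOp p i j) (derOp q h l) := by
  rw [commute_iff_lie_eq, derOp, derOp, of_apply, of_apply, ← Derivation.commutator_coe_linear_map,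
    lie_rowDer_of_ne hpq]
  rfl

theorem lie_derOp_mulOp (p : ℕ) (i j : ι) (f : MatrixPoly ι) :
    ⁅derOp p i j, mulOp f⁆ = mulOp (rowDer p i j f) := by
  refine LinearMap.ext fun g => ?_
  change rowDer p i j (f * g) - f * rowDer p i j g = rowDer p i j f * g
  rw [Derivation.leibniz, smul_eq_mul, smul_eq_mul, add_sub_cancel_left, mul_comm]

/-- The operators `e_{ij} = ∂_{ij} + t z_{ij}`, where `t` is the variable of the polynomial ring:
multiplication by the independent variables is their leading coefficient. -/
def matUnit (p : ℕ) : Matrix ι ι (Op ι)[X] :=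
  of fun i j => C (derOp p i j) + monomial 1 (mulOp (MvPolynomial.X (p, i, j)))

theorem matrixUnitRelations_matUnit (p : ℕ) : MatrixUnitRelations (matUnit (ι := ι) p) := by
  refine (matrixUnitRelations_derOp p).add_monomial
    (z := of fun i j => mulOp (MvPolynomial.X (p, i, j))) (fun i j h l => ?_) fun i j h l => ?_
  · rw [of_apply, of_apply, lie_derOp_mulOp, rowDer_X]
    split_ifs <;> simp_all
  · exact lie_mulOp _ _

theorem commute_matUnit {p q : ℕ} (hpq : p ≠ q) (i j h l : ι) :
    Commute (matUnit p i j) (matUnit q h l) := by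
  have hder (p q : ℕ) (hpq : p ≠ q) (i j h l : ι) :
      ⁅derOp p i j, mulOp (MvPolynomial.X (q, h, l))⁆ = 0 := by
    rw [lie_derOp_mulOp, rowDer_X, if_neg fun h => hpq h.1.symm, map_zero]
  refine commute_iff_lie_eq.mpr ((lie_C_add_monomial _ _ _ _).trans ?_)
  rw [(commute_derOp hpq i j h l).lie_eq, hder p q hpq, hder q p hpq.symm, lie_mulOp]
  simp only [map_zero, sub_zero, add_zero]

end Model

/-! ### Products of evaluation matrices -/

section Evaluation

open PowerSeries

variable {ι k B : Type*} [DecidableEq ι] [CommRing k] [Ring B] [Algebra k B]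

/-- The evaluation matrix `1 + (u - c)⁻¹ e`. -/
def evalMatrix (c : k) (e : Matrix ι ι B) : Matrix ι ι B⟦X⟧ :=
  of fun i j => C ((1 : Matrix ι ι B) i j) + X * mk fun r => c ^ r • e i j

theorem coeff_evalMatrix_zero (c : k) (e : Matrix ι ι B) (i j : ι) :
    coeff 0 (evalMatrix c e i j) = (1 : Matrix ι ι B) i j := by
  simp [evalMatrix]

theorem coeff_evalMatrix_succ (c : k) (e : Matrix ι ι B) (i j : ι) (r : ℕ) :
    coeff (r + 1) (evalMatrix c e i j) = c ^ r • e i j := by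
  rw [evalMatrix, of_apply, map_add, coeff_succ_X_mul, coeff_mk, coeff_C, if_neg r.succ_ne_zero,
    zero_add]

theorem matCoeff_evalMatrix_zero (c : k) (e : Matrix ι ι B) : matCoeff (evalMatrix c e) 0 = 1 :=
  Matrix.ext (coeff_evalMatrix_zero c e)

theorem commute_one_apply (i j : ι) (y : B) : Commute ((1 : Matrix ι ι B) i j) y := by
  rw [one_apply]
  split_ifs
  exacts [Commute.one_left y, Commute.zero_left y]

theorem rtt_evalMatrix (c : k) {e : Matrix ι ι B} (he : MatrixUnitRelations e) :
    RTT 1 (evalMatrix c e) := by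
  have lie_one (i j : ι) (y : B) : ⁅(1 : Matrix ι ι B) i j, y⁆ = 0 :=
    (commute_one_apply i j y).lie_eq
  have one_lie (i j : ι) (y : B) : ⁅y, (1 : Matrix ι ι B) i j⁆ = 0 :=
    (commute_one_apply i j y).symm.lie_eq
  have smul_lie_smul (a b : k) (y z : B) : ⁅a • y, b • z⁆ = (a * b) • ⁅y, z⁆ := by
    rw [Ring.lie_def, smul_mul_smul_comm, smul_mul_smul_comm, mul_comm b, ← smul_sub, Ring.lie_def]
  refine rtt_iff.mpr ⟨fun i j h l s => ?_, fun i j h l r s => ?_⟩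
  · rw [coeff_evalMatrix_zero, lie_one]
  rw [one_smul]
  rcases r with _ | r <;> rcases s with _ | s <;>
    simp only [coeff_evalMatrix_zero, coeff_evalMatrix_succ, lie_one, one_lie, sub_self, zero_add]
  · rw [smul_lie_smul, he, pow_zero, one_mul, sub_zero, smul_sub, one_apply, one_apply]
    split_ifs <;> simp
  · rw [smul_lie_smul, he, pow_zero, mul_one, zero_sub, smul_sub, neg_sub, one_apply, one_apply]
    split_ifs <;> simp
  · simp only [smul_lie_smul, smul_mul_smul_comm, ← pow_add]
    rw [add_right_comm, add_assoc, sub_self, add_comm s, sub_self]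

theorem commute_evalMatrix (c d : k) {e f : Matrix ι ι B}
    (hef : ∀ i j h l, Commute (e i j) (f h l)) (i j h l : ι) (r s : ℕ) :
    Commute (coeff r (evalMatrix c e i j)) (coeff s (evalMatrix d f h l)) := by
  rcases r with _ | r
  · rw [coeff_evalMatrix_zero]
    exact commute_one_apply _ _ _
  rcases s with _ | s
  · rw [coeff_evalMatrix_zero]
    exact (commute_one_apply _ _ _).symm
  rw [coeff_evalMatrix_succ, coeff_evalMatrix_succ]
  exact ((hef i j h l).smul_left _).smul_right _

end Evaluation

section EvaluationProduct

variable {ι k B : Type*} [DecidableEq ι] [CommRing k] [Ring B] [Algebra k B]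

theorem matCoeff_one_zero : matCoeff (1 : Matrix ι ι (PowerSeries B)) 0 = 1 :=
  (matCoeff_one 0).trans (if_pos rfl)

theorem rtt_one : RTT 1 (1 : Matrix ι ι (PowerSeries B)) := by
  have evalMatrix_zero : evalMatrix (0 : ℤ) (0 : Matrix ι ι B) = 1 := by
    ext i j r
    rcases r with _ | r
    · rw [coeff_evalMatrix_zero, one_apply, one_apply, apply_ite (PowerSeries.coeff 0),
        PowerSeries.coeff_zero_one, map_zero]
    · rw [coeff_evalMatrix_succ, Matrix.zero_apply, smul_zero, one_apply,
        apply_ite (PowerSeries.coeff (r + 1)), PowerSeries.coeff_one, if_neg r.succ_ne_zero,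
        map_zero, ite_self]
  rw [← evalMatrix_zero]
  exact rtt_evalMatrix 0 fun i j h l => by simp

variable [Fintype ι]

theorem matCoeff_mul_zero_eq_one {M N : Matrix ι ι (PowerSeries B)} (hM : matCoeff M 0 = 1)
    (hN : matCoeff N 0 = 1) : matCoeff (M * N) 0 = 1 := by
  rw [matCoeff_mul, Finset.Nat.antidiagonal_zero, Finset.sum_singleton, hM, hN, one_mul]

/-- The image of the matrix `T(u)` under the evaluations at `e 0, …, e (m - 1)`, combined by the
comultiplication. -/
def evalProd (c : ℕ → k) (e : ℕ → Matrix ι ι B) : ℕ → Matrix ι ι (PowerSeries B)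
  | 0 => 1
  | m + 1 => evalProd c e m * evalMatrix (c m) (e m)

variable (c : ℕ → k) {e : ℕ → Matrix ι ι B}

theorem matCoeff_evalProd_zero (e : ℕ → Matrix ι ι B) (m : ℕ) :
    matCoeff (evalProd c e m) 0 = 1 := by
  induction m with
  | zero => exact matCoeff_one_zero
  | succ m ih => exact matCoeff_mul_zero_eq_one ih (matCoeff_evalMatrix_zero _ _)

theorem commute_evalProd (comm : ∀ p q, p ≠ q → ∀ i j h l, Commute (e p i j) (e q h l))
    {m q : ℕ} (hmq : m ≤ q) (i j h l : ι) (r s : ℕ) :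
    Commute (PowerSeries.coeff r (evalProd c e m i j))
      (PowerSeries.coeff s (evalMatrix (c q) (e q) h l)) := by
  induction m generalizing i j r with
  | zero =>
    rw [evalProd, one_apply, apply_ite (PowerSeries.coeff r), PowerSeries.coeff_one, map_zero]
    split_ifs <;> first | exact Commute.one_left _ | exact Commute.zero_left _
  | succ m ih =>
    rw [evalProd, mul_apply, map_sum]
    refine Commute.sum_left _ _ _ fun a _ => ?_
    rw [PowerSeries.coeff_mul]
    exact Commute.sum_left _ _ _ fun x _ => (ih (by omega) i a x.1).mul_left
      (commute_evalMatrix _ _ (comm m q (by omega)) a j h l x.2 s)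

theorem rtt_evalProd (he : ∀ p, MatrixUnitRelations (e p))
    (comm : ∀ p q, p ≠ q → ∀ i j h l, Commute (e p i j) (e q h l)) (m : ℕ) :
    RTT 1 (evalProd c e m) := by
  induction m with
  | zero => exact rtt_one
  | succ m ih =>
    exact ih.mul (rtt_evalMatrix _ (he m)) fun i j h l r s =>
      commute_evalProd c comm le_rfl i j h l r s

end EvaluationProduct

/-! ### Leading coefficients -/

section Degree

open Polynomial

variable {R : Type*} [Ring R]

/-- The filtration of `R[X]` in which the polynomials of degree at most `2 r - 1` have level
`r + 1`; the truncated subtractions put the constants in the levels `0` and `1`. -/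
def degreeFiltration (R : Type*) [Ring R] (m : ℕ) : AddSubgroup R[X] :=
  (degreeLE R ((2 * (m - 1) - 1 : ℕ) : WithBot ℕ)).toAddSubgroup

theorem mem_degreeFiltration {m : ℕ} {f : R[X]} :
    f ∈ degreeFiltration R m ↔ f.natDegree ≤ 2 * (m - 1) - 1 :=
  mem_degreeLE.trans natDegree_le_iff_degree_le.symm

theorem isFiltration_degreeFiltration : IsFiltration (degreeFiltration R) where
  one_mem := mem_degreeFiltration.mpr (natDegree_one.le.trans (Nat.zero_le _))
  mul_mem m n f g hf hg := by
    rw [mem_degreeFiltration] at *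
    exact natDegree_mul_le.trans (by omega)
  le_succ m f hf := by
    rw [mem_degreeFiltration] at *
    omega

theorem coeff_mul_mul_eq_zero {p q s r : ℕ} (hp : p ≤ r) (hq : q ≤ r) (hs : s ≤ r)
    (hr : p + q + s = r + 1) {f g h : R[X]} (hf : f ∈ degreeFiltration R (p + 1))
    (hg : g ∈ degreeFiltration R (q + 1)) (hh : h ∈ degreeFiltration R (s + 1)) :
    (f * g * h).coeff (2 * r + 1) = 0 := by
  rw [mem_degreeFiltration] at hf hg hh
  refine coeff_eq_zero_of_natDegree_lt (natDegree_mul_le.trans_lt ?_)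
  have := natDegree_mul_le (p := f) (q := g)
  omega

variable {ι : Type*} [DecidableEq ι]

theorem one_apply_mem {A : Type*} [Ring A] (S : Subring A) (i j : ι) :
    (1 : Matrix ι ι A) i j ∈ S := by
  rw [one_apply]
  split_ifs
  exacts [S.one_mem, S.zero_mem]

theorem coeff_evalMatrix_center (c : Subring.center R[X]) (e : Matrix ι ι R[X]) (i j : ι) (r : ℕ) :
    PowerSeries.coeff (r + 1) (evalMatrix c e i j) = (c : R[X]) ^ r * e i j := by
  rw [coeff_evalMatrix_succ, Subring.smul_def, smul_eq_mul, SubmonoidClass.coe_pow]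

theorem evalMatrix_mem {c : Subring.center R[X]} {e : Matrix ι ι R[X]}
    (hc : (c : R[X]).natDegree ≤ 2) (he : ∀ i j, (e i j).natDegree ≤ 1) (i j : ι) :
    evalMatrix c e i j ∈ isFiltration_degreeFiltration.seriesSubring := by
  intro r
  rcases r with _ | r
  · rw [coeff_evalMatrix_zero, mem_degreeFiltration, one_apply]
    split_ifs <;> simp
  · rw [coeff_evalMatrix_center, mem_degreeFiltration]
    have hcr := natDegree_pow_le_of_le r hc
    have hij := he i j
    exact natDegree_mul_le.trans (by omega)

variable [Fintype ι]

theorem coeff_coeff_mul_mul {F D E : Matrix ι ι (PowerSeries R[X])} (hF : matCoeff F 0 = 1)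
    (hD : matCoeff D 0 = 1) (hE : matCoeff E 0 = 1)
    (hFP : ∀ i j, F i j ∈ isFiltration_degreeFiltration.seriesSubring)
    (hDP : ∀ i j, D i j ∈ isFiltration_degreeFiltration.seriesSubring)
    (hEP : ∀ i j, E i j ∈ isFiltration_degreeFiltration.seriesSubring) (r : ℕ) (i j : ι) :
    (PowerSeries.coeff (r + 1) ((F * D * E) i j)).coeff (2 * r + 1) =
      (PowerSeries.coeff (r + 1) (F i j)).coeff (2 * r + 1) +
        (PowerSeries.coeff (r + 1) (D i j)).coeff (2 * r + 1) +
        (PowerSeries.coeff (r + 1) (E i j)).coeff (2 * r + 1) := by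
  have mem_ker := coeff_add_sub_mul_mem hF hD hE (lcoeff R (2 * r + 1)).toAddMonoidHom.ker
    r.succ_pos (fun p q s hp hq hs hr i k l j => coeff_mul_mul_eq_zero (Nat.lt_succ_iff.mp hp)
      (Nat.lt_succ_iff.mp hq) (Nat.lt_succ_iff.mp hs) hr (hFP i k p) (hDP k l q) (hEP l j s)) i j
  rw [AddMonoidHom.mem_ker, map_sub, map_add, map_add, sub_eq_zero] at mem_ker
  exact mem_ker.symm

variable {c : ℕ → Subring.center R[X]} {e : ℕ → Matrix ι ι R[X]}

theorem evalProd_mem (hc : ∀ p, (c p : R[X]).natDegree ≤ 2)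
    (he : ∀ p i j, (e p i j).natDegree ≤ 1) (m : ℕ) (i j : ι) :
    evalProd c e m i j ∈ isFiltration_degreeFiltration.seriesSubring := by
  induction m generalizing i j with
  | zero => exact one_apply_mem _ i j
  | succ m ih =>
    rw [evalProd, mul_apply]
    exact sum_mem fun a _ => MulMemClass.mul_mem (ih i a) (evalMatrix_mem (hc m) (he m) a j)

theorem coeff_coeff_evalProd (hc : ∀ p, (c p : R[X]).natDegree ≤ 2)
    (he : ∀ p i j, (e p i j).natDegree ≤ 1) (m r : ℕ) (i j : ι) :
    (PowerSeries.coeff (r + 1) (evalProd c e m i j)).coeff (2 * r + 1) =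
      ∑ p ∈ Finset.range m, (c p : R[X]).coeff 2 ^ r * (e p i j).coeff 1 := by
  have coeff_one_apply (i j : ι) :
      PowerSeries.coeff (r + 1) ((1 : Matrix ι ι (PowerSeries R[X])) i j) = 0 := by
    rw [one_apply, apply_ite (PowerSeries.coeff (r + 1)), PowerSeries.coeff_one, map_zero,
      if_neg r.succ_ne_zero, ite_self]
  induction m generalizing i j with
  | zero => rw [evalProd, coeff_one_apply, Finset.sum_range_zero, coeff_zero]
  | succ m ih =>
    have top_mul := coeff_coeff_mul_mul (matCoeff_evalProd_zero c e m)
      (matCoeff_evalMatrix_zero (c m) (e m)) matCoeff_one_zero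
      (evalProd_mem hc he m) (evalMatrix_mem (hc m) (he m)) (one_apply_mem _) r i j
    have top_pow : ((c m : R[X]) ^ r * e m i j).coeff (2 * r + 1) =
        (c m : R[X]).coeff 2 ^ r * (e m i j).coeff 1 := by
      rw [mul_comm 2 r, coeff_mul_add_eq_of_natDegree_le (natDegree_pow_le_of_le r (hc m))
        (he m i j), coeff_pow_of_natDegree_le (hc m)]
    rw [mul_one, coeff_one_apply, coeff_zero, add_zero, ih, coeff_evalMatrix_center,
      top_pow] at top_mul
    rw [evalProd, top_mul, Finset.sum_range_succ]

end Degree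

section Representation

open Polynomial

variable {n : ℕ}

/-- The central element `p t ^ 2`, where `t` is the variable of the polynomial ring. -/
def evalPoint (n p : ℕ) : Subring.center (Op (Fin n))[X] :=
  (p : Subring.center (Op (Fin n))[X]) *
    ⟨X, Subring.mem_center_iff.mpr fun f => (commute_X f).eq.symm⟩ ^ 2

theorem coe_evalPoint (n p : ℕ) :
    (evalPoint n p : (Op (Fin n))[X]) = C (p : Op (Fin n)) * X ^ 2 := by
  rw [evalPoint, MulMemClass.coe_mul, SubmonoidClass.coe_pow, map_natCast]
  rfl

theorem natDegree_evalPoint_le (p : ℕ) : (evalPoint n p : (Op (Fin n))[X]).natDegree ≤ 2 :=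
  (congrArg natDegree (coe_evalPoint n p)).trans_le (natDegree_C_mul_X_pow_le _ _)

theorem natDegree_matUnit_le (p : ℕ) (i j : Fin n) : (matUnit p i j).natDegree ≤ 1 :=
  natDegree_add_le_of_degree_le ((natDegree_C _).trans_le zero_le_one) (natDegree_monomial_le _)

/-- The image of the matrix `T(u)` in the representation `rep n m`. -/
def evalT (n m : ℕ) : Matrix (Fin n) (Fin n) (PowerSeries (Op (Fin n))[X]) :=
  evalProd (evalPoint n) matUnit m

theorem rtt_evalT (m : ℕ) : RTT 1 (evalT n m) :=
  rtt_evalProd _ matrixUnitRelations_matUnit (fun _ _ => commute_matUnit) m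

theorem matCoeff_evalT_zero (m : ℕ) : matCoeff (evalT n m) 0 = 1 :=
  matCoeff_evalProd_zero _ _ m

theorem evalT_mem (m : ℕ) (i j : Fin n) :
    evalT n m i j ∈ isFiltration_degreeFiltration.seriesSubring :=
  evalProd_mem natDegree_evalPoint_le natDegree_matUnit_le m i j

/-- The symbol of `T_{i,j}^{(r+1)}`: its leading coefficient in `rep n m` is the multiplication by
this polynomial. -/
def symb (m r : ℕ) (i j : Fin n) : MatrixPoly (Fin n) :=
  ∑ p ∈ Finset.range m, MvPolynomial.C ((p : ℂ) ^ r) * MvPolynomial.X (p, i, j)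

theorem coeff_coeff_evalT (m r : ℕ) (i j : Fin n) :
    (PowerSeries.coeff (r + 1) (evalT n m i j)).coeff (2 * r + 1) = mulOp (symb m r i j) := by
  refine (coeff_coeff_evalProd natDegree_evalPoint_le natDegree_matUnit_le m r i j).trans ?_
  rw [symb, map_sum]
  refine Finset.sum_congr rfl fun p _ => ?_
  have top_point : (evalPoint n p : (Op (Fin n))[X]).coeff 2 = (p : Op (Fin n)) := by
    rw [coe_evalPoint, coeff_C_mul_X_pow, if_pos rfl]
  have top_matUnit : (matUnit p i j).coeff 1 = mulOp (MvPolynomial.X (p, i, j)) := by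
    rw [matUnit, of_apply, coeff_add, coeff_C_succ, coeff_monomial, if_pos rfl, zero_add]
  rw [top_point, top_matUnit, map_mul, map_pow, map_natCast, map_pow, map_natCast]

theorem freeLift_freeT {B : Type*} [Ring B] [Algebra ℂ B]
    {M : Matrix (Fin n) (Fin n) (PowerSeries B)} (h0 : matCoeff M 0 = 1) (i j : Fin n) (r : ℕ) :
    FreeAlgebra.lift ℂ (fun x : Fin n × Fin n × ℕ+ => PowerSeries.coeff (x.2.2 : ℕ) (M x.1 x.2.1))
      (freeT n i j r) = PowerSeries.coeff r (M i j) := by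
  rcases Nat.eq_zero_or_pos r with rfl | hr
  · rw [freeT, dif_neg (lt_irrefl 0), apply_ite (FreeAlgebra.lift ℂ _), map_one, map_zero]
    exact ((congrFun (congrFun h0 i) j).trans one_apply).symm
  · rw [freeT, dif_pos hr, FreeAlgebra.lift_ι_apply]
    rfl

/-- The algebra homomorphism from the Yangian given by a matrix of series that satisfies the
defining relations. -/
def yangianLift {B : Type*} [Ring B] [Algebra ℂ B]
    (M : Matrix (Fin n) (Fin n) (PowerSeries B)) (h0 : matCoeff M 0 = 1) (hM : RTT 1 M) :
    Yangian n →ₐ[ℂ] B :=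
  RingQuot.liftAlgHom ℂ ⟨FreeAlgebra.lift ℂ fun x : Fin n × Fin n × ℕ+ =>
    PowerSeries.coeff (x.2.2 : ℕ) (M x.1 x.2.1), by
      rintro _ _ ⟨i, j, h, l, r, s⟩
      have relation := (rtt_iff.mp hM).2 i j h l r s
      simp only [Ring.lie_def, one_smul, map_sub, map_mul, freeLift_freeT h0] at relation ⊢
      exact relation⟩

theorem yangianLift_T {B : Type*} [Ring B] [Algebra ℂ B]
    {M : Matrix (Fin n) (Fin n) (PowerSeries B)} (h0 : matCoeff M 0 = 1) (hM : RTT 1 M)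
    (i j : Fin n) (r : ℕ) : yangianLift M h0 hM (T n i j r) = PowerSeries.coeff r (M i j) :=
  (RingQuot.liftAlgHom_mkAlgHom_apply _ _ _ _).trans (freeLift_freeT h0 i j r)

/-- The representation of the Yangian by differential operators on polynomials in the entries of
`m` matrices of variables. -/
def rep (n m : ℕ) : Yangian n →ₐ[ℂ] (Op (Fin n))[X] :=
  yangianLift (evalT n m) (matCoeff_evalT_zero m) (rtt_evalT m)

theorem rep_T (m : ℕ) (i j : Fin n) (r : ℕ) :
    rep n m (T n i j r) = PowerSeries.coeff r (evalT n m i j) :=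
  yangianLift_T _ _ i j r

/-- The linear substitution that replaces the matrix number `r` of variables by the combination of
the matrices of variables with coefficients in the column `r` of `V`. -/
def substColumn {m : ℕ} (V : Matrix (Fin m) (Fin m) ℂ) :
    MatrixPoly (Fin n) →ₐ[ℂ] MatrixPoly (Fin n) :=
  MvPolynomial.aeval fun v => if hv : v.1 < m then
    ∑ q : Fin m, MvPolynomial.C (V q ⟨v.1, hv⟩) * MvPolynomial.X ((q : ℕ), v.2) else 0

theorem substColumn_sum {m : ℕ} (V W : Matrix (Fin m) (Fin m) ℂ) (r : Fin m) (i j : Fin n) :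
    substColumn V (∑ p : Fin m, MvPolynomial.C (W p r) * MvPolynomial.X ((p : ℕ), i, j)) =
      ∑ q : Fin m, MvPolynomial.C ((V * W) q r) * MvPolynomial.X ((q : ℕ), i, j) := by
  have subst_X (p : Fin m) : substColumn V (MvPolynomial.X ((p : ℕ), i, j)) =
      ∑ q : Fin m, MvPolynomial.C (V q p) * MvPolynomial.X ((q : ℕ), i, j) := by
    rw [substColumn, MvPolynomial.aeval_X, dif_pos p.2]
  simp only [map_sum, map_mul, MvPolynomial.algHom_C, subst_X, mul_apply, Finset.sum_mul,
    Finset.mul_sum, MvPolynomial.algebraMap_eq]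
  rw [Finset.sum_comm]
  exact Finset.sum_congr rfl fun q _ => Finset.sum_congr rfl fun p _ => by ring

theorem exists_algHom_symb_eq_X (m : ℕ) :
    ∃ Φ : MatrixPoly (Fin n) →ₐ[ℂ] MatrixPoly (Fin n), ∀ r < m, ∀ i j,
      Φ (symb m r i j) = MvPolynomial.X (r, i, j) := by
  let V : Matrix (Fin m) (Fin m) ℂ := vandermonde fun p => ((p : ℕ) : ℂ)
  have hdet : IsUnit V.det := isUnit_iff_ne_zero.mpr <| det_vandermonde_ne_zero_iff.mpr
    fun p q h => Fin.ext (Nat.cast_injective h)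
  refine ⟨substColumn V⁻¹, fun r hr i j => ?_⟩
  have symb_eq : symb m r i j =
      ∑ p : Fin m, MvPolynomial.C (V p ⟨r, hr⟩) * MvPolynomial.X ((p : ℕ), i, j) :=
    (Fin.sum_univ_eq_sum_range
      (fun p => MvPolynomial.C ((p : ℂ) ^ r) * MvPolynomial.X (p, i, j)) m).symm
  rw [symb_eq, substColumn_sum, nonsing_inv_mul V hdet]
  simp only [one_apply, apply_ite MvPolynomial.C, map_one, map_zero, ite_mul, one_mul, zero_mul,
    Finset.sum_ite_eq', Finset.mem_univ, if_true]

end Representation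

/-! ### Linear independence of ordered monomials -/

section LinearIndependence

open Polynomial

theorem linearIndependent_of_coeff {k R J : Type*} [CommRing k] [Ring R] [Algebra k R]
    {v : J → R[X]} {d : J → ℕ} (hd : ∀ j, (v j).natDegree ≤ d j)
    (h : LinearIndependent k fun j => (v j).coeff (d j)) : LinearIndependent k v := by
  classical
  rw [linearIndependent_iff']
  intro S g hg t ht
  by_contra hgt
  obtain ⟨m, hm, hmax⟩ := (S.filter fun j => g j ≠ 0).exists_max_image d
    ⟨t, Finset.mem_filter.mpr ⟨ht, hgt⟩⟩
  obtain ⟨hmS, hgm⟩ := Finset.mem_filter.mp hm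
  have coeff_term (j : J) (hj : j ∈ S) :
      (if d j = d m then g j else 0) • (v j).coeff (d j) = (g j • v j).coeff (d m) := by
    rw [coeff_smul]
    by_cases hgj : g j = 0
    · rw [hgj, ite_self, zero_smul, zero_smul]
    rcases (hmax j (Finset.mem_filter.mpr ⟨hj, hgj⟩)).lt_or_eq with hlt | heq
    · rw [if_neg hlt.ne, coeff_eq_zero_of_natDegree_lt ((hd j).trans_lt hlt), zero_smul, smul_zero]
    · rw [if_pos heq, heq]
  have top_eq_zero : ∑ j ∈ S, (if d j = d m then g j else 0) • (v j).coeff (d j) = 0 := by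
    rw [Finset.sum_congr rfl coeff_term, ← finsetSum_coeff, hg, coeff_zero]
  have := linearIndependent_iff'.mp h S _ top_eq_zero m hmS
  rw [if_pos rfl] at this
  exact hgm this

theorem prod_map_X_eq_monomial {σ k : Type*} [CommSemiring k] [DecidableEq σ] (s : Multiset σ) :
    (s.map (MvPolynomial.X (R := k))).prod = MvPolynomial.monomial (Multiset.toFinsupp s) 1 := by
  induction s using Multiset.induction with
  | empty => simp
  | cons a s ih =>
    rw [Multiset.map_cons, Multiset.prod_cons, ih, ← Multiset.singleton_add, map_add,
      Multiset.toFinsupp_singleton, MvPolynomial.X, MvPolynomial.monomial_mul, one_mul]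

theorem linearIndependent_prod_X {I σ k : Type*} [CommRing k] {lab : I → σ}
    (hlab : Function.Injective lab) :
    LinearIndependent k fun s : Multiset I =>
      (s.map fun i => (MvPolynomial.X (lab i) : MvPolynomial σ k)).prod := by
  classical
  have prod_eq : (fun s : Multiset I =>
      (s.map fun i => (MvPolynomial.X (lab i) : MvPolynomial σ k)).prod) =
      MvPolynomial.basisMonomials σ k ∘ fun s => Multiset.toFinsupp (s.map lab) := by
    funext s
    rw [Function.comp_apply, MvPolynomial.coe_basisMonomials]
    refine Eq.trans ?_ (prod_map_X_eq_monomial (s.map lab))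
    rw [Multiset.map_map]
    rfl
  rw [prod_eq]
  exact (MvPolynomial.basisMonomials σ k).linearIndependent.comp _
    (Multiset.toFinsupp.injective.comp (Multiset.map_injective hlab))

variable {I : Type*} (lo : LinearOrder I)

theorem map_orderedMonomial {A B φ : Type*} [Monoid A] [Monoid B] [FunLike φ A B]
    [MonoidHomClass φ A B] (f : φ) (x : I → A) (s : Multiset I) :
    f (orderedMonomial lo x s) = orderedMonomial lo (fun i => f (x i)) s := by
  rw [orderedMonomial, map_list_prod, List.map_map]
  rfl

theorem orderedMonomial_eq_prod {A : Type*} [CommMonoid A] (x : I → A) (s : Multiset I) :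
    orderedMonomial lo x s = (s.map x).prod := by
  rw [orderedMonomial, ← Multiset.prod_coe, ← Multiset.map_coe, Multiset.sort_eq]

section

variable {R : Type*} [Ring R] {d : I → ℕ} {y : I → R[X]} (hy : ∀ i, (y i).natDegree ≤ d i)
include hy

theorem natDegree_list_prod_map_le (l : List I) :
    (l.map y).prod.natDegree ≤ (l.map d).sum := by
  refine (natDegree_list_prod_le _).trans ?_
  rw [List.map_map]
  exact List.sum_le_sum fun i _ => hy i

theorem natDegree_orderedMonomial_le (s : Multiset I) :
    (orderedMonomial lo y s).natDegree ≤ (s.map d).sum := by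
  refine (natDegree_list_prod_map_le hy _).trans_eq ?_
  rw [← Multiset.sum_coe, ← Multiset.map_coe, Multiset.sort_eq]

theorem coeff_list_prod_map (l : List I) :
    (l.map y).prod.coeff (l.map d).sum = (l.map fun i => (y i).coeff (d i)).prod := by
  induction l with
  | nil => simp
  | cons i l ih =>
    simp only [List.map_cons, List.prod_cons, List.sum_cons]
    rw [coeff_mul_add_eq_of_natDegree_le (hy i) (natDegree_list_prod_map_le hy l), ih]

theorem coeff_orderedMonomial (s : Multiset I) :
    (orderedMonomial lo y s).coeff (s.map d).sum =
      orderedMonomial lo (fun i => (y i).coeff (d i)) s := by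
  rw [orderedMonomial, orderedMonomial, ← coeff_list_prod_map hy, ← Multiset.sum_coe,
    ← Multiset.map_coe, Multiset.sort_eq]

end

theorem linearIndependent_orderedMonomial_symb {n m : ℕ} {lab : I → ℕ × Fin n × Fin n}
    (hlab : Function.Injective lab) {S : Set (Multiset I)}
    (hm : ∀ s ∈ S, ∀ i ∈ s, (lab i).1 < m) :
    LinearIndependent ℂ fun s : S =>
      orderedMonomial lo (fun i => symb m (lab i).1 (lab i).2.1 (lab i).2.2) s.1 := by
  obtain ⟨Φ, hΦ⟩ := exists_algHom_symb_eq_X (n := n) m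
  have map_eq (s : S) :
      Φ (orderedMonomial lo (fun i => symb m (lab i).1 (lab i).2.1 (lab i).2.2) s.1) =
        (s.1.map fun i => MvPolynomial.X (lab i)).prod := by
    rw [orderedMonomial_eq_prod, map_multiset_prod, Multiset.map_map]
    exact congrArg _ (Multiset.map_congr rfl fun i hi => hΦ _ (hm s s.2 i hi) _ _)
  have independent_map : LinearIndependent ℂ fun s : S =>
      Φ (orderedMonomial lo (fun i => symb m (lab i).1 (lab i).2.1 (lab i).2.2) s.1) :=
    (funext map_eq).symm ▸ (linearIndependent_prod_X hlab).comp _ Subtype.val_injective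
  exact LinearIndependent.of_comp Φ.toLinearMap independent_map

theorem linearIndependent_orderedMonomial {n : ℕ} (x : I → Yangian n)
    (lab : I → ℕ × Fin n × Fin n) (hlab : Function.Injective lab)
    (hdeg : ∀ m i, (rep n m (x i)).natDegree ≤ 2 * (lab i).1 + 1)
    (htop : ∀ m i, (rep n m (x i)).coeff (2 * (lab i).1 + 1) =
      mulOp (symb m (lab i).1 (lab i).2.1 (lab i).2.2)) :
    LinearIndependent ℂ (orderedMonomial lo x) := by
  rw [linearIndependent_iff_finset_linearIndependent]
  intro S
  let m := S.sup fun s => (s.map fun i => (lab i).1 + 1).sum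
  have lab_lt (s : Multiset I) (hs : s ∈ S) (i : I) (hi : i ∈ s) : (lab i).1 < m :=
    (Multiset.single_le_sum (fun _ _ => Nat.zero_le _) _
      (Multiset.mem_map_of_mem (fun i => (lab i).1 + 1) hi)).trans
      (Finset.le_sup (f := fun s : Multiset I => (s.map fun i => (lab i).1 + 1).sum) hs)
  let y (i : I) : MatrixPoly (Fin n) := symb m (lab i).1 (lab i).2.1 (lab i).2.2
  let wt (s : S) : ℕ := (s.1.map fun i => 2 * (lab i).1 + 1).sum
  have natDegree_le (s : S) : (rep n m (orderedMonomial lo x s)).natDegree ≤ wt s :=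
    (congrArg natDegree (map_orderedMonomial lo (rep n m) x s)).trans_le
      (natDegree_orderedMonomial_le lo (hdeg m) s)
  have coeff_eq (s : S) : (rep n m (orderedMonomial lo x s)).coeff (wt s) =
      mulOp (orderedMonomial lo y s) := by
    rw [map_orderedMonomial lo mulOp]
    refine (congrArg (coeff · _) (map_orderedMonomial lo (rep n m) x s)).trans
      ((coeff_orderedMonomial lo (hdeg m) s).trans ?_)
    exact congrArg (orderedMonomial lo · s.1) (funext (htop m))
  have independent_y : LinearIndependent ℂ fun s : S => orderedMonomial lo y s :=
    linearIndependent_orderedMonomial_symb lo hlab lab_lt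
  have independent_coeff :
      LinearIndependent ℂ fun s : S => (rep n m (orderedMonomial lo x s)).coeff (wt s) :=
    (funext coeff_eq).symm ▸ independent_y.map' mulOp.toLinearMap
      (LinearMap.ker_eq_bot.mpr mulOp_injective)
  exact LinearIndependent.of_comp (rep n m).toLinearMap
    (linearIndependent_of_coeff natDegree_le independent_coeff)

end LinearIndependence

/-! ### The Gauss factorization of `T(u)` -/

section GaussMap

variable {ι β R S : Type*} [Fintype ι] [DecidableEq ι] [LinearOrder β] [Ring R] [Ring S]

theorem IsBlockGauss.map {b : ι → β} {M F D E : Matrix ι ι (PowerSeries R)}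
    (hG : IsBlockGauss b M F D E) (f : R →+* S) :
    IsBlockGauss b (M.map (PowerSeries.map f)) (F.map (PowerSeries.map f))
      (D.map (PowerSeries.map f)) (E.map (PowerSeries.map f)) where
  factor := by rw [hG.factor, Matrix.map_mul, Matrix.map_mul]
  diag i j h := by rw [map_apply, hG.diag i j h, map_zero]
  upper i j h := by rw [map_apply, hG.upper i j h, apply_ite (PowerSeries.map f), map_one, map_zero]
  lower i j h := by rw [map_apply, hG.lower i j h, apply_ite (PowerSeries.map f), map_one, map_zero]
  upper_const i j h := by
    rw [map_apply, ← PowerSeries.coeff_zero_eq_constantCoeff_apply, PowerSeries.coeff_map,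
      PowerSeries.coeff_zero_eq_constantCoeff_apply, hG.upper_const i j h, map_zero]
  lower_const i j h := by
    rw [map_apply, ← PowerSeries.coeff_zero_eq_constantCoeff_apply, PowerSeries.coeff_map,
      PowerSeries.coeff_zero_eq_constantCoeff_apply, hG.lower_const i j h, map_zero]

end GaussMap

section BlockGenerators

variable {n : ℕ}

theorem T_rel (i j h l : Fin n) (r s : ℕ) :
    ⁅T n i j (r + 1), T n h l s⁆ - ⁅T n i j r, T n h l (s + 1)⁆ =
      T n h j r * T n i l s - T n h j s * T n i l r := by
  have := RingQuot.mkAlgHom_rel ℂ (Rel.rtt (n := n) i j h l r s)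
  change proj n _ = proj n _ at this
  simp only [Ring.lie_def, map_sub, map_mul] at this ⊢
  exact this

variable (ν : Composition n)

theorem coeff_blockT (x y : Pos ν) (r : ℕ) : PowerSeries.coeff r (blockT ν x y) =
    T n (ν.embedding x.1 x.2) (ν.embedding y.1 y.2) r := by
  rw [blockT, of_apply, PowerSeries.coeff_mk]

theorem rtt_blockT : RTT 1 (blockT ν) := by
  refine rtt_iff.mpr ⟨fun i j h l s => ?_, fun i j h l r s => ?_⟩
  · rw [coeff_blockT, T_zero, Ring.lie_def]
    split_ifs <;> simp
  · simp only [coeff_blockT, one_smul]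
    exact T_rel _ _ _ _ _ _

theorem EE_eq_coeff (a : ℕ) (ha : a < ν.length) (i : Fin (ν.blocksFun ⟨a, ha⟩)) (r b : ℕ)
    (hb : b < ν.length) (j : Fin (ν.blocksFun ⟨b, hb⟩)) (hab : a < b) :
    EE ν a ha i r b hb j = PowerSeries.coeff r ((gauss ν).2.2 ⟨⟨a, ha⟩, i⟩ ⟨⟨b, hb⟩, j⟩) := by
  induction b with
  | zero => exact absurd hab a.not_lt_zero
  | succ b ih =>
    rw [EE]
    split_ifs with h
    · subst h
      rfl
    · rw [ih _ _ (by omega)]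
      exact ((isBlockGauss_gauss ν).upper_recursion (matCoeff_blockT_zero ν) (rtt_blockT ν)
        (h := ⟨⟨a, ha⟩, i⟩) (i := ⟨⟨b, b.lt_succ_self.trans hb⟩, firstIdx ν _⟩)
        (q := ⟨⟨b + 1, hb⟩, j⟩) (Fin.mk_lt_mk.mpr (by omega)) (Fin.mk_lt_mk.mpr (by omega)) r).symm

theorem FF_eq_coeff (a : ℕ) (ha : a < ν.length) (i : Fin (ν.blocksFun ⟨a, ha⟩)) (r b : ℕ)
    (hb : b < ν.length) (j : Fin (ν.blocksFun ⟨b, hb⟩)) (hab : a < b) :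
    FF ν a ha i r b hb j = PowerSeries.coeff r ((gauss ν).1 ⟨⟨b, hb⟩, j⟩ ⟨⟨a, ha⟩, i⟩) := by
  induction b with
  | zero => exact absurd hab a.not_lt_zero
  | succ b ih =>
    rw [FF]
    split_ifs with h
    · subst h
      rfl
    · rw [ih _ _ (by omega)]
      exact ((isBlockGauss_gauss ν).lower_recursion (matCoeff_blockT_zero ν) (rtt_blockT ν)
        (h := ⟨⟨a, ha⟩, i⟩) (i := ⟨⟨b, b.lt_succ_self.trans hb⟩, firstIdx ν _⟩)
        (q := ⟨⟨b + 1, hb⟩, j⟩) (Fin.mk_lt_mk.mpr (by omega)) (Fin.mk_lt_mk.mpr (by omega)) r).symm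

theorem EE_succ (a b : ℕ) (hab : a < b) (hb : b + 1 < ν.length)
    (i : Fin (ν.blocksFun ⟨a, hab.trans (b.lt_succ_self.trans hb)⟩))
    (k : Fin (ν.blocksFun ⟨b, b.lt_succ_self.trans hb⟩)) (j : Fin (ν.blocksFun ⟨b + 1, hb⟩))
    (r : ℕ) :
    EE ν a (hab.trans (b.lt_succ_self.trans hb)) i r (b + 1) hb j =
      ⁅EE ν a (hab.trans (b.lt_succ_self.trans hb)) i r b (b.lt_succ_self.trans hb) k,
        E ν b hb k j 1⁆ := by
  rw [EE_eq_coeff ν _ _ _ _ _ _ _ (by omega), EE_eq_coeff ν _ _ _ _ _ _ _ hab]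
  exact (isBlockGauss_gauss ν).upper_recursion (matCoeff_blockT_zero ν) (rtt_blockT ν)
    (Fin.mk_lt_mk.mpr hab) (Fin.mk_lt_mk.mpr b.lt_succ_self) r

theorem FF_succ (a b : ℕ) (hab : a < b) (hb : b + 1 < ν.length)
    (i : Fin (ν.blocksFun ⟨a, hab.trans (b.lt_succ_self.trans hb)⟩))
    (k : Fin (ν.blocksFun ⟨b, b.lt_succ_self.trans hb⟩)) (j : Fin (ν.blocksFun ⟨b + 1, hb⟩))
    (r : ℕ) :
    FF ν a (hab.trans (b.lt_succ_self.trans hb)) i r (b + 1) hb j =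
      ⁅F ν b hb j k 1,
        FF ν a (hab.trans (b.lt_succ_self.trans hb)) i r b (b.lt_succ_self.trans hb) k⁆ := by
  rw [FF_eq_coeff ν _ _ _ _ _ _ _ (by omega), FF_eq_coeff ν _ _ _ _ _ _ _ hab]
  exact (isBlockGauss_gauss ν).lower_recursion (matCoeff_blockT_zero ν) (rtt_blockT ν)
    (Fin.mk_lt_mk.mpr hab) (Fin.mk_lt_mk.mpr b.lt_succ_self) r

theorem EFamily_eq_coeff (x : EIndex ν) :
    EFamily ν x = PowerSeries.coeff x.r ((gauss ν).2.2 ⟨x.a, x.i⟩ ⟨x.b, x.j⟩) :=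
  EE_eq_coeff ν _ _ _ _ _ _ _ x.lt

theorem FFamily_eq_coeff (x : FIndex ν) :
    FFamily ν x = PowerSeries.coeff x.r ((gauss ν).1 ⟨x.b, x.i⟩ ⟨x.a, x.j⟩) :=
  FF_eq_coeff ν _ _ _ _ _ _ _ x.lt

/-- The `u⁻ʳ`-coefficient of an entry of `F(u) + D(u) + E(u)`. For `r ≥ 1` at most one of the three
summands is nonzero, so these are the elements of `allFamily ν`. -/
def gaussCoeff (x y : Pos ν) (r : ℕ) : Yangian n :=
  PowerSeries.coeff r ((gauss ν).1 x y) + PowerSeries.coeff r ((gauss ν).2.1 x y) +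
    PowerSeries.coeff r ((gauss ν).2.2 x y)

variable {ν}

theorem gaussCoeff_of_eq {x y : Pos ν} (h : x.1 = y.1) {r : ℕ} (hr : r ≠ 0) :
    gaussCoeff ν x y r = PowerSeries.coeff r ((gauss ν).2.1 x y) := by
  rw [gaussCoeff, (isBlockGauss_gauss ν).coeff_lower_eq_zero hr h.le,
    (isBlockGauss_gauss ν).coeff_upper_eq_zero hr h.ge, zero_add, add_zero]

theorem gaussCoeff_of_lt {x y : Pos ν} (h : x.1 < y.1) {r : ℕ} (hr : r ≠ 0) :
    gaussCoeff ν x y r = PowerSeries.coeff r ((gauss ν).2.2 x y) := by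
  rw [gaussCoeff, (isBlockGauss_gauss ν).coeff_lower_eq_zero hr h.le,
    (isBlockGauss_gauss ν).diag x y h.ne, map_zero, zero_add, zero_add]

theorem gaussCoeff_of_gt {x y : Pos ν} (h : y.1 < x.1) {r : ℕ} (hr : r ≠ 0) :
    gaussCoeff ν x y r = PowerSeries.coeff r ((gauss ν).1 x y) := by
  rw [gaussCoeff, (isBlockGauss_gauss ν).coeff_upper_eq_zero hr h.le,
    (isBlockGauss_gauss ν).diag x y h.ne', map_zero, add_zero, add_zero]

/-- The row, the column and the power of `u⁻¹` of an element of `allFamily ν`. -/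
def indexEquiv : DIndex ν ⊕ EIndex ν ⊕ FIndex ν ≃ Pos ν × Pos ν × ℕ+ where
  toFun
    | .inl x => (⟨x.a, x.i⟩, ⟨x.a, x.j⟩, x.r)
    | .inr (.inl x) => (⟨x.a, x.i⟩, ⟨x.b, x.j⟩, x.r)
    | .inr (.inr x) => (⟨x.b, x.i⟩, ⟨x.a, x.j⟩, x.r)
  invFun z :=
    if hlt : z.1.1 < z.2.1.1 then .inr (.inl ⟨z.1.1, z.2.1.1, hlt, z.1.2, z.2.1.2, z.2.2⟩)
    else if hgt : z.2.1.1 < z.1.1 then .inr (.inr ⟨z.2.1.1, z.1.1, hgt, z.1.2, z.2.1.2, z.2.2⟩)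
    else .inl ⟨z.1.1, z.1.2, Fin.cast (congrArg ν.blocksFun
      (le_antisymm (not_lt.mp hlt) (not_lt.mp hgt))) z.2.1.2, z.2.2⟩
  left_inv := by
    rintro (x | x | x)
    · simp
    · simp [x.lt]
    · simp [x.lt, x.lt.le]
  right_inv := by
    rintro ⟨⟨a, i⟩, ⟨b, j⟩, r⟩
    rcases lt_trichotomy a b with h | rfl | h
    · simp [h]
    · simp
    · simp [h, h.not_gt]

theorem allFamily_eq_gaussCoeff (x : DIndex ν ⊕ EIndex ν ⊕ FIndex ν) :
    allFamily ν x = gaussCoeff ν (indexEquiv x).1 (indexEquiv x).2.1 (indexEquiv x).2.2 := by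
  rcases x with x | x | x
  · exact (gaussCoeff_of_eq (x := ⟨x.a, x.i⟩) (y := ⟨x.a, x.j⟩) rfl x.r.ne_zero).symm
  · exact (EFamily_eq_coeff ν x).trans
      (gaussCoeff_of_lt (x := ⟨x.a, x.i⟩) (y := ⟨x.b, x.j⟩) x.lt x.r.ne_zero).symm
  · exact (FFamily_eq_coeff ν x).trans
      (gaussCoeff_of_gt (x := ⟨x.b, x.i⟩) (y := ⟨x.a, x.j⟩) x.lt x.r.ne_zero).symm

/-! ### Leading terms of the Gauss factors -/

theorem map_blockT (m : ℕ) (x y : Pos ν) :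
    (blockT ν).map (PowerSeries.map (S := (Op (Fin n))[X]) (rep n m)) x y =
      evalT n m (ν.embedding x.1 x.2) (ν.embedding y.1 y.2) := by
  ext r : 1
  rw [map_apply, PowerSeries.coeff_map, coeff_blockT]
  exact rep_T m _ _ r

theorem matCoeff_map_zero {ι R S : Type*} [DecidableEq ι] [Ring R] [Ring S]
    {M : Matrix ι ι (PowerSeries R)} (h0 : matCoeff M 0 = 1) (f : R →+* S) :
    matCoeff (M.map (PowerSeries.map f)) 0 = 1 := by
  have map_zeroth : matCoeff (M.map (PowerSeries.map f)) 0 = (matCoeff M 0).map f := by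
    ext i j
    exact PowerSeries.coeff_map f 0 (M i j)
  rw [map_zeroth, h0, Matrix.map_one f f.map_zero f.map_one]

theorem map_gaussCoeff {S : Type*} [Ring S] (f : Yangian n →+* S) (x y : Pos ν) (r : ℕ) :
    f (gaussCoeff ν x y r) =
      PowerSeries.coeff r ((gauss ν).1.map (PowerSeries.map f) x y) +
        PowerSeries.coeff r ((gauss ν).2.1.map (PowerSeries.map f) x y) +
        PowerSeries.coeff r ((gauss ν).2.2.map (PowerSeries.map f) x y) := by
  simp only [gaussCoeff, map_add, map_apply, PowerSeries.coeff_map]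

theorem rep_gaussCoeff (m r : ℕ) (x y : Pos ν) :
    (rep n m (gaussCoeff ν x y (r + 1))).natDegree ≤ 2 * r + 1 ∧
      (rep n m (gaussCoeff ν x y (r + 1))).coeff (2 * r + 1) =
        mulOp (symb m r (ν.embedding x.1 x.2) (ν.embedding y.1 y.2)) := by
  have hG := (isBlockGauss_gauss ν).map (S := (Op (Fin n))[X]) (rep n m)
  have h0 := matCoeff_map_zero (S := (Op (Fin n))[X]) (matCoeff_blockT_zero ν) (rep n m)
  have hP := isFiltration_degreeFiltration.gauss_mem hG h0 fun x y => by
    rw [map_blockT]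
    exact evalT_mem m _ _
  obtain ⟨hF, hD, hE⟩ := hG.coeff_zero h0
  have top := coeff_coeff_mul_mul hF hD hE (fun x y => (hP x y).1) (fun x y => (hP x y).2.1)
    (fun x y => (hP x y).2.2) r x y
  rw [← hG.factor, map_blockT, coeff_coeff_evalT] at top
  have map_eq := map_gaussCoeff (S := (Op (Fin n))[X]) (rep n m) x y (r + 1)
  have mem := add_mem (add_mem ((hP x y).1 (r + 1)) ((hP x y).2.1 (r + 1))) ((hP x y).2.2 (r + 1))
  exact ⟨(congrArg Polynomial.natDegree map_eq).trans_le (mem_degreeFiltration.mp mem),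
    (congrArg (Polynomial.coeff · _) map_eq).trans <| (Polynomial.coeff_add _ _ _).trans <|
      (congrArg (· + _) (Polynomial.coeff_add _ _ _)).trans top.symm⟩

theorem linearIndependent_allFamily_comp {J : Type*} (lo : LinearOrder J)
    (f : J → DIndex ν ⊕ EIndex ν ⊕ FIndex ν) (hf : Function.Injective f) :
    LinearIndependent ℂ (orderedMonomial lo (allFamily ν ∘ f)) := by
  let lab (z : Pos ν × Pos ν × ℕ+) : ℕ × Fin n × Fin n :=
    (z.2.2.natPred, ν.embedding z.1.1 z.1.2, ν.embedding z.2.1.1 z.2.1.2)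
  have lab_injective : Function.Injective lab := by
    rintro ⟨x, y, r⟩ ⟨x', y', r'⟩ e
    simp only [lab, Prod.mk.injEq] at e
    rw [ν.blocksFinEquiv.injective (a₁ := x) (a₂ := x') e.2.1,
      ν.blocksFinEquiv.injective (a₁ := y) (a₂ := y') e.2.2, PNat.natPred_injective e.1]
  have family_eq (i : J) : allFamily ν (f i) = gaussCoeff ν (indexEquiv (f i)).1
      (indexEquiv (f i)).2.1 ((indexEquiv (f i)).2.2.natPred + 1) := by
    rw [PNat.natPred_add_one, allFamily_eq_gaussCoeff]
  refine linearIndependent_orderedMonomial lo _ (fun i => lab (indexEquiv (f i)))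
    (lab_injective.comp (indexEquiv.injective.comp hf)) (fun m i => ?_) fun m i => ?_
  · rw [Function.comp_apply, family_eq]
    exact (rep_gaussCoeff m _ _ _).1
  · rw [Function.comp_apply, family_eq]
    exact (rep_gaussCoeff m _ _ _).2

end BlockGenerators

/-! ### Spanning -/

section Spanning

theorem IsFiltration.mem_seriesSubring_of_coeff {A ι : Type*} [Ring A] [DecidableEq ι]
    {P : ℕ → AddSubgroup A} (hP : IsFiltration P) {M : Matrix ι ι (PowerSeries A)}
    (h0 : matCoeff M 0 = 1) {i j : ι}
    (h : ∀ r : ℕ+, PowerSeries.coeff (r : ℕ) (M i j) ∈ P (r + 1)) : M i j ∈ hP.seriesSubring := by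
  intro r
  rcases Nat.eq_zero_or_pos r with rfl | hr
  · rw [show PowerSeries.coeff 0 (M i j) = (1 : Matrix ι ι A) i j from congrFun₂ h0 i j, one_apply]
    split_ifs
    exacts [hP.one_mem, zero_mem _]
  · exact h ⟨r, hr⟩

/-- The power series whose coefficient of `u⁻ʳ` is a combination of words of weight `≤ r`. -/
abbrev wordSeries {I A : Type*} [Ring A] [Algebra ℂ A] (x : I → A) (w : I → ℕ) :
    Subring (PowerSeries A) :=
  (isFiltration_wordSpan (k := ℂ) (x := x) (w := w)).seriesSubring

variable {n : ℕ} (ν : Composition n)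

theorem diag_mem_wordSeries (i j : Pos ν) :
    (gauss ν).2.1 i j ∈ wordSeries (DFamily ν) fun x => x.r := by
  have hG := isBlockGauss_gauss ν
  obtain ⟨a, i⟩ := i
  obtain ⟨b, j⟩ := j
  obtain rfl | hab := eq_or_ne a b
  · exact isFiltration_wordSpan.mem_seriesSubring_of_coeff
      (hG.coeff_zero (matCoeff_blockT_zero ν)).2.1 fun r =>
        mem_wordSpan (x := DFamily ν) (w := fun x => (x.r : ℕ)) ⟨a, i, j, r⟩
  · rw [hG.diag ⟨a, i⟩ ⟨b, j⟩ hab]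
    exact zero_mem _

theorem upper_mem_wordSeries (i j : Pos ν) :
    (gauss ν).2.2 i j ∈ wordSeries (EFamily ν) fun x => x.r := by
  refine isFiltration_wordSpan.mem_seriesSubring_of_coeff
    ((isBlockGauss_gauss ν).coeff_zero (matCoeff_blockT_zero ν)).2.2 fun r => ?_
  rcases le_or_gt j.1 i.1 with hij | hij
  · rw [(isBlockGauss_gauss ν).coeff_upper_eq_zero r.ne_zero hij]
    exact zero_mem _
  · exact EFamily_eq_coeff ν ⟨i.1, j.1, hij, i.2, j.2, r⟩ ▸
      mem_wordSpan (x := EFamily ν) (w := fun x => (x.r : ℕ)) ⟨i.1, j.1, hij, i.2, j.2, r⟩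

theorem lower_mem_wordSeries (i j : Pos ν) :
    (gauss ν).1 i j ∈ wordSeries (FFamily ν) fun x => x.r := by
  refine isFiltration_wordSpan.mem_seriesSubring_of_coeff
    ((isBlockGauss_gauss ν).coeff_zero (matCoeff_blockT_zero ν)).1 fun r => ?_
  rcases le_or_gt i.1 j.1 with hij | hij
  · rw [(isBlockGauss_gauss ν).coeff_lower_eq_zero r.ne_zero hij]
    exact zero_mem _
  · exact FFamily_eq_coeff ν ⟨j.1, i.1, hij, i.2, j.2, r⟩ ▸
      mem_wordSpan (x := FFamily ν) (w := fun x => (x.r : ℕ)) ⟨j.1, i.1, hij, i.2, j.2, r⟩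

theorem straightens_DFamily : Straightens ℂ (DFamily ν) fun x => x.r := fun x y =>
  isFiltration_wordSpan.lie_diag_mem (isBlockGauss_gauss ν) (matCoeff_blockT_zero ν)
    (rtt_blockT ν) (diag_mem_wordSeries ν) (i := ⟨x.a, x.i⟩) (j := ⟨x.a, x.j⟩)
    (h := ⟨y.a, y.i⟩) (l := ⟨y.a, y.j⟩) rfl rfl x.r y.r

theorem straightens_EFamily : Straightens ℂ (EFamily ν) fun x => x.r := by
  intro x y
  rw [EFamily_eq_coeff, EFamily_eq_coeff]
  exact isFiltration_wordSpan.lie_upper_mem (isBlockGauss_gauss ν) (matCoeff_blockT_zero ν)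
    (rtt_blockT ν) (upper_mem_wordSeries ν) x.lt y.lt x.r y.r

theorem straightens_FFamily : Straightens ℂ (FFamily ν) fun x => x.r := by
  intro x y
  rw [FFamily_eq_coeff, FFamily_eq_coeff]
  exact isFiltration_wordSpan.lie_lower_mem (isBlockGauss_gauss ν) (matCoeff_blockT_zero ν)
    (rtt_blockT ν) (lower_mem_wordSeries ν) x.lt y.lt x.r y.r

theorem adjoin_range_DFamily : Algebra.adjoin ℂ (Set.range (DFamily ν)) = levi ν := by
  refine le_antisymm (Algebra.adjoin_mono ?_) (Algebra.adjoin_le ?_)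
  · rintro _ ⟨x, rfl⟩
    exact ⟨x.a, x.i, x.j, x.r, rfl⟩
  · rintro _ ⟨a, i, j, r, rfl⟩
    exact wordSpan_le_adjoin _ (diag_mem_wordSeries ν ⟨a, i⟩ ⟨a, j⟩ r)

theorem EE_mem_plus (a : ℕ) (ha : a < ν.length) (i : Fin (ν.blocksFun ⟨a, ha⟩)) (r : ℕ+)
    (b : ℕ) (hb : b < ν.length) (j : Fin (ν.blocksFun ⟨b, hb⟩)) :
    EE ν a ha i r b hb j ∈ plus ν := by
  induction b with
  | zero => exact zero_mem _
  | succ b ih =>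
    rw [EE]
    split_ifs with h
    · exact Algebra.subset_adjoin ⟨_, _, _, _, r, r.pos, rfl⟩
    · exact (lieSubalgebraOfSubalgebra ℂ _ (plus ν)).lie_mem (ih _ _)
        (Algebra.subset_adjoin ⟨_, _, _, _, 1, le_rfl, rfl⟩)

theorem FF_mem_minus (a : ℕ) (ha : a < ν.length) (i : Fin (ν.blocksFun ⟨a, ha⟩)) (r : ℕ+)
    (b : ℕ) (hb : b < ν.length) (j : Fin (ν.blocksFun ⟨b, hb⟩)) :
    FF ν a ha i r b hb j ∈ minus ν := by
  induction b with
  | zero => exact zero_mem _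
  | succ b ih =>
    rw [FF]
    split_ifs with h
    · exact Algebra.subset_adjoin ⟨_, _, _, _, r, r.pos, rfl⟩
    · exact (lieSubalgebraOfSubalgebra ℂ _ (minus ν)).lie_mem
        (Algebra.subset_adjoin ⟨_, _, _, _, 1, le_rfl, rfl⟩) (ih _ _)

theorem adjoin_range_EFamily : Algebra.adjoin ℂ (Set.range (EFamily ν)) = plus ν := by
  refine le_antisymm (Algebra.adjoin_le ?_) (Algebra.adjoin_mono ?_)
  · rintro _ ⟨x, rfl⟩
    exact EE_mem_plus ν _ _ _ _ _ _ _
  · rintro _ ⟨a, ha, i, j, r, hr, rfl⟩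
    exact ⟨⟨⟨a, a.lt_succ_self.trans ha⟩, ⟨a + 1, ha⟩, Fin.mk_lt_mk.mpr a.lt_succ_self, i, j,
      ⟨r, hr⟩⟩, EFamily_eq_coeff ν _⟩

theorem adjoin_range_FFamily : Algebra.adjoin ℂ (Set.range (FFamily ν)) = minus ν := by
  refine le_antisymm (Algebra.adjoin_le ?_) (Algebra.adjoin_mono ?_)
  · rintro _ ⟨x, rfl⟩
    exact FF_mem_minus ν _ _ _ _ _ _ _
  · rintro _ ⟨a, ha, i, j, r, hr, rfl⟩
    exact ⟨⟨⟨a, a.lt_succ_self.trans ha⟩, ⟨a + 1, ha⟩, Fin.mk_lt_mk.mpr a.lt_succ_self, i, j,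
      ⟨r, hr⟩⟩, FFamily_eq_coeff ν _⟩

/-- The generators `T_{i,j}^{(r)}` with `r ≥ 1`, in block form. -/
def TFamily (x : Pos ν × Pos ν × ℕ+) : Yangian n := PowerSeries.coeff x.2.2 (blockT ν x.1 x.2.1)

theorem adjoin_range_TFamily : Algebra.adjoin ℂ (Set.range (TFamily ν)) = ⊤ := by
  have surjective : Function.Surjective (proj n) := RingQuot.mkAlgHom_surjective ℂ (Rel n)
  rw [eq_top_iff, ← (AlgHom.range_eq_top (proj n)).mpr surjective, ← Algebra.map_top,
    ← FreeAlgebra.adjoin_range_ι, AlgHom.map_adjoin]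
  refine Algebra.adjoin_mono ?_
  rintro _ ⟨_, ⟨⟨i, j, r⟩, rfl⟩, rfl⟩
  obtain ⟨x, rfl⟩ := ν.blocksFinEquiv.surjective i
  obtain ⟨y, rfl⟩ := ν.blocksFinEquiv.surjective j
  refine ⟨(x, y, r), ?_⟩
  rw [TFamily, coeff_blockT, T, freeT, dif_pos r.pos]
  rfl

theorem blockT_mem_wordSeries (i j : Pos ν) :
    blockT ν i j ∈ wordSeries (TFamily ν) fun x => x.2.2 :=
  isFiltration_wordSpan.mem_seriesSubring_of_coeff (matCoeff_blockT_zero ν) fun r =>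
    mem_wordSpan (x := TFamily ν) (w := fun x => (x.2.2 : ℕ)) (i, j, r)

theorem straightens_TFamily : Straightens ℂ (TFamily ν) fun x => x.2.2 := fun _ _ =>
  isFiltration_wordSpan.lie_mem_of_rtt (rtt_blockT ν) (blockT_mem_wordSeries ν) _ _ _ _ _ _

theorem allFamily_mem_wordSpan (x : DIndex ν ⊕ EIndex ν ⊕ FIndex ν) :
    allFamily ν x ∈ wordSpan ℂ (TFamily ν) (fun x => x.2.2) ((indexEquiv x).2.2 + 1) := by
  obtain ⟨hF, hD, hE⟩ := isFiltration_wordSpan.gauss_mem (isBlockGauss_gauss ν)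
    (matCoeff_blockT_zero ν) (blockT_mem_wordSeries ν) (indexEquiv x).1 (indexEquiv x).2.1
  rw [allFamily_eq_gaussCoeff]
  exact add_mem (add_mem (hF _) (hD _)) (hE _)

theorem gauss_mem_wordSeries (i j : Pos ν) :
    (gauss ν).1 i j ∈ wordSeries (allFamily ν) (fun x => (indexEquiv x).2.2) ∧
      (gauss ν).2.1 i j ∈ wordSeries (allFamily ν) (fun x => (indexEquiv x).2.2) ∧
      (gauss ν).2.2 i j ∈ wordSeries (allFamily ν) (fun x => (indexEquiv x).2.2) := by
  have hG := isBlockGauss_gauss ν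
  obtain ⟨hF, hD, hE⟩ := hG.coeff_zero (matCoeff_blockT_zero ν)
  have coeff_mem (r : ℕ+) := hG.coeff_mem_of_sum_mem (i := i) (j := j) r.ne_zero
    (Q := (wordSpan ℂ (allFamily ν) (fun x => (indexEquiv x).2.2) (r + 1)).toAddSubgroup) <| by
      have mem := mem_wordSpan (k := ℂ) (x := allFamily ν) (w := fun x => (indexEquiv x).2.2)
        (indexEquiv.symm (i, j, r))
      rwa [allFamily_eq_gaussCoeff, Equiv.apply_symm_apply] at mem
  exact ⟨isFiltration_wordSpan.mem_seriesSubring_of_coeff hF fun r => (coeff_mem r).1,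
    isFiltration_wordSpan.mem_seriesSubring_of_coeff hD fun r => (coeff_mem r).2.1,
    isFiltration_wordSpan.mem_seriesSubring_of_coeff hE fun r => (coeff_mem r).2.2⟩

theorem TFamily_mem_wordSpan (x : Pos ν × Pos ν × ℕ+) :
    TFamily ν x ∈ wordSpan ℂ (allFamily ν) (fun x => (indexEquiv x).2.2) (x.2.2 + 1) := by
  have mem (i j : Pos ν) :
      blockT ν i j ∈ wordSeries (allFamily ν) (fun x => (indexEquiv x).2.2) := by
    rw [(isBlockGauss_gauss ν).factor, mul_apply]
    refine sum_mem fun l _ => mul_mem ?_ (gauss_mem_wordSeries ν l j).2.2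
    rw [mul_apply]
    exact sum_mem fun k _ => mul_mem (gauss_mem_wordSeries ν i k).1 (gauss_mem_wordSeries ν k l).2.1
  exact mem x.1 x.2.1 x.2.2

theorem straightens_allFamily : Straightens ℂ (allFamily ν) fun x => (indexEquiv x).2.2 :=
  fun x y => wordSpan_le (TFamily_mem_wordSpan ν) _
    ((straightens_TFamily ν).lie_mem (allFamily_mem_wordSpan ν x) (allFamily_mem_wordSpan ν y))

theorem adjoin_range_allFamily : Algebra.adjoin ℂ (Set.range (allFamily ν)) = ⊤ := by
  rw [eq_top_iff, ← adjoin_range_TFamily ν]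
  refine Algebra.adjoin_le ?_
  rintro _ ⟨x, rfl⟩
  exact wordSpan_le_adjoin _ (TFamily_mem_wordSpan ν x)

theorem isPBWBasis_DFamily (lo : LinearOrder (DIndex ν)) : IsPBWBasis lo (DFamily ν) (levi ν) :=
  ⟨linearIndependent_allFamily_comp lo Sum.inl Sum.inl_injective, by
    rw [(straightens_DFamily ν).span_orderedMonomial, adjoin_range_DFamily]⟩

theorem isPBWBasis_EFamily (lo : LinearOrder (EIndex ν)) : IsPBWBasis lo (EFamily ν) (plus ν) :=
  ⟨linearIndependent_allFamily_comp lo (Sum.inr ∘ Sum.inl)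
    (Sum.inr_injective.comp Sum.inl_injective), by
    rw [(straightens_EFamily ν).span_orderedMonomial, adjoin_range_EFamily]⟩

theorem isPBWBasis_FFamily (lo : LinearOrder (FIndex ν)) : IsPBWBasis lo (FFamily ν) (minus ν) :=
  ⟨linearIndependent_allFamily_comp lo (Sum.inr ∘ Sum.inr)
    (Sum.inr_injective.comp Sum.inr_injective), by
    rw [(straightens_FFamily ν).span_orderedMonomial, adjoin_range_FFamily]⟩

theorem isPBWBasis_allFamily (lo : LinearOrder (DIndex ν ⊕ EIndex ν ⊕ FIndex ν)) :
    IsPBWBasis lo (allFamily ν) ⊤ :=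
  ⟨linearIndependent_allFamily_comp lo id Function.injective_id, by
    rw [(straightens_allFamily ν).span_orderedMonomial, adjoin_range_allFamily]⟩

end Spanning

/-! ### Triangular decomposition -/

section Triangular

variable {I J A : Type*}

theorem orderedMonomial_add [Monoid A] (lo : LinearOrder I) (x : I → A) {s t : Multiset I}
    (h : ∀ i ∈ s, ∀ j ∈ t, i ≤ j) :
    orderedMonomial lo x (s + t) = orderedMonomial lo x s * orderedMonomial lo x t := by
  have sort_add : (s + t).sort (fun i j => i ≤ j) =
      s.sort (fun i j => i ≤ j) ++ t.sort (fun i j => i ≤ j) := by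
    refine List.Perm.eq_of_pairwise' (r := fun i j => i ≤ j) (Multiset.pairwise_sort _ _) ?_ ?_
    · exact List.pairwise_append.mpr ⟨Multiset.pairwise_sort _ _, Multiset.pairwise_sort _ _,
        fun i hi j hj => h i ((Multiset.mem_sort _).mp hi) j ((Multiset.mem_sort _).mp hj)⟩
    · rw [← Multiset.coe_eq_coe, Multiset.sort_eq, ← Multiset.coe_add, Multiset.sort_eq,
        Multiset.sort_eq]
  rw [orderedMonomial, sort_add, List.map_append, List.prod_append]
  rfl

theorem orderedMonomial_map [Monoid A] (lo : LinearOrder I) (x : I → A) {f : J → I}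
    (hf : Function.Injective f) (s : Multiset J) :
    orderedMonomial lo x (s.map f) = orderedMonomial (LinearOrder.lift' f hf) (x ∘ f) s := by
  let _ := LinearOrder.lift' f hf
  have map_sort : (s.sort fun i j : J => i ≤ j).map f = (s.map f).sort fun i j : I => i ≤ j :=
    Multiset.map_sort f s _ _ fun _ _ _ _ => Iff.rfl
  rw [orderedMonomial, ← map_sort, List.map_map]
  rfl

theorem exists_linearOrder_le_of_lt (g : I → ℕ) :
    ∃ lo : LinearOrder I, ∀ i j, g i < g j → lo.le i j := by
  let _ : LinearOrder I := IsWellOrder.linearOrder WellOrderingRel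
  exact ⟨LinearOrder.lift' (fun i => toLex (g i, i)) fun i j h => congrArg Prod.snd h,
    fun i j h => Prod.Lex.le_iff.mpr (Or.inl h)⟩

theorem multiset_filterMap_none (s : Multiset I) :
    s.filterMap (fun _ => (none : Option J)) = 0 :=
  Multiset.eq_zero_of_forall_notMem fun _ h => by simp at h

variable {ID IE IF : Type*}

/-- The multiset on a disjoint union of three types with prescribed restrictions to the summands.
The summands are ordered as in `allFamily`, the arguments as in the product `Y⁻ ⊗ Y ⊗ Y⁺`. -/
def multisetSum (z : (Multiset IF × Multiset ID) × Multiset IE) : Multiset (ID ⊕ IE ⊕ IF) :=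
  z.1.1.map (Sum.inr ∘ Sum.inr) + z.1.2.map Sum.inl + z.2.map (Sum.inr ∘ Sum.inl)

theorem multisetSum_injective :
    Function.Injective (multisetSum (ID := ID) (IE := IE) (IF := IF)) := by
  rintro ⟨⟨s, t⟩, u⟩ ⟨⟨s', t'⟩, u'⟩ h
  have hF := congrArg (Multiset.filterMap
    (Sum.elim (fun _ : ID => none) (Sum.elim (fun _ : IE => none) (fun a : IF => some a)))) h
  have hD := congrArg (Multiset.filterMap
    (Sum.elim (fun a : ID => some a) (Sum.elim (fun _ : IE => none) (fun _ : IF => none)))) h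
  have hE := congrArg (Multiset.filterMap
    (Sum.elim (fun _ : ID => none) (Sum.elim (fun a : IE => some a) (fun _ : IF => none)))) h
  simp only [multisetSum, Multiset.filterMap_add, Multiset.filterMap_map, Function.comp_def,
    Sum.elim_inl, Sum.elim_inr, multiset_filterMap_none, Multiset.filterMap_some, zero_add,
    add_zero] at hF hD hE
  rw [hF, hD, hE]

theorem multisetSum_surjective :
    Function.Surjective (multisetSum (ID := ID) (IE := IE) (IF := IF)) := by
  intro s
  induction s using Multiset.induction with
  | empty => exact ⟨((0, 0), 0), by simp [multisetSum]⟩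
  | cons a s ih =>
    obtain ⟨⟨⟨u, t⟩, v⟩, rfl⟩ := ih
    rcases a with a | a | a
    · exact ⟨((u, a ::ₘ t), v), by simp [multisetSum]⟩
    · exact ⟨((u, t), a ::ₘ v), by simp [multisetSum]⟩
    · exact ⟨((a ::ₘ u, t), v), by simp [multisetSum]⟩

theorem exists_linearOrder_orderedMonomial_multisetSum [Monoid A] (x : ID ⊕ IE ⊕ IF → A) :
    ∃ (lo : LinearOrder (ID ⊕ IE ⊕ IF)) (loF : LinearOrder IF) (loD : LinearOrder ID)
      (loE : LinearOrder IE), ∀ s t u, orderedMonomial lo x (multisetSum ((s, t), u)) =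
        orderedMonomial loF (x ∘ Sum.inr ∘ Sum.inr) s * orderedMonomial loD (x ∘ Sum.inl) t *
          orderedMonomial loE (x ∘ Sum.inr ∘ Sum.inl) u := by
  obtain ⟨lo, le_of_lt⟩ := exists_linearOrder_le_of_lt
    (Sum.elim (fun _ => 1) (Sum.elim (fun _ => 2) fun _ => 0) : ID ⊕ IE ⊕ IF → ℕ)
  have injF : (Sum.inr ∘ Sum.inr : IF → ID ⊕ IE ⊕ IF).Injective :=
    Sum.inr_injective.comp Sum.inr_injective
  have injD : (Sum.inl : ID → ID ⊕ IE ⊕ IF).Injective := Sum.inl_injective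
  have injE : (Sum.inr ∘ Sum.inl : IE → ID ⊕ IE ⊕ IF).Injective :=
    Sum.inr_injective.comp Sum.inl_injective
  refine ⟨lo, LinearOrder.lift' _ injF, LinearOrder.lift' _ injD, LinearOrder.lift' _ injE,
    fun s t u => ?_⟩
  rw [multisetSum, orderedMonomial_add, orderedMonomial_add, orderedMonomial_map lo x injF,
    orderedMonomial_map lo x injD, orderedMonomial_map lo x injE]
  · simp only [Multiset.mem_map]
    rintro _ ⟨i, -, rfl⟩ _ ⟨j, -, rfl⟩
    exact le_of_lt _ _ (by simp)
  · simp only [Multiset.mem_add, Multiset.mem_map]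
    rintro _ (⟨i, -, rfl⟩ | ⟨i, -, rfl⟩) _ ⟨j, -, rfl⟩ <;> exact le_of_lt _ _ (by simp)

variable [Ring A] [Algebra ℂ A]

theorem IsPBWBasis.exists_basis {lo : LinearOrder I} {x : I → A} {S : Subalgebra ℂ A}
    (h : IsPBWBasis lo x S) :
    ∃ b : Module.Basis (Multiset I) ℂ S, ∀ s, (b s : A) = orderedMonomial lo x s := by
  refine ⟨(Module.Basis.span h.1).map
    ((LinearEquiv.ofEq _ _ h.2).trans S.toSubmoduleEquiv), fun s => ?_⟩
  rw [Module.Basis.map_apply]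
  exact congrArg Subtype.val (Module.Basis.span_apply h.1 s)

theorem mulMap3_tmul (P Q S : Subalgebra ℂ A) (x : P) (y : Q) (z : S) :
    mulMap3 P Q S ((x ⊗ₜ y) ⊗ₜ z) = (x : A) * y * z := rfl

theorem mulMap3_bijective {x : ID ⊕ IE ⊕ IF → A} {P Q S : Subalgebra ℂ A}
    (hF : ∀ lo : LinearOrder IF, IsPBWBasis lo (x ∘ Sum.inr ∘ Sum.inr) P)
    (hD : ∀ lo : LinearOrder ID, IsPBWBasis lo (x ∘ Sum.inl) Q)
    (hE : ∀ lo : LinearOrder IE, IsPBWBasis lo (x ∘ Sum.inr ∘ Sum.inl) S)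
    (hA : ∀ lo : LinearOrder (ID ⊕ IE ⊕ IF), IsPBWBasis lo x ⊤) :
    Function.Bijective (mulMap3 P Q S) := by
  obtain ⟨lo, loF, loD, loE, monomial_eq⟩ := exists_linearOrder_orderedMonomial_multisetSum x
  obtain ⟨bF, hbF⟩ := (hF loF).exists_basis
  obtain ⟨bD, hbD⟩ := (hD loD).exists_basis
  obtain ⟨bE, hbE⟩ := (hE loE).exists_basis
  obtain ⟨bA, hbA⟩ := (hA lo).exists_basis
  let b := (bF.tensorProduct bD).tensorProduct bE
  let σ := Equiv.ofBijective multisetSum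
    ⟨multisetSum_injective (ID := ID) (IE := IE) (IF := IF), multisetSum_surjective⟩
  let φ := (b.equiv bA σ).trans Subalgebra.topEquiv.toLinearEquiv
  have mulMap3_eq : mulMap3 P Q S = φ.toLinearMap := by
    refine b.ext fun ⟨⟨s, t⟩, u⟩ => ?_
    calc mulMap3 P Q S (b ((s, t), u))
        = orderedMonomial lo x (multisetSum ((s, t), u)) := by
          rw [Module.Basis.tensorProduct_apply, Module.Basis.tensorProduct_apply, mulMap3_tmul,
            hbF, hbD, hbE, monomial_eq]
      _ = bA (multisetSum ((s, t), u)) := (hbA _).symm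
      _ = φ (b ((s, t), u)) :=
          congrArg Subtype.val (b.equiv_apply ((s, t), u) bA σ).symm
  rw [mulMap3_eq]
  exact φ.bijective

end Triangular

end Yang

end

theorem theoremB (n : ℕ) (ν : Composition n) :
    -- the iterated commutators do not depend on the choice of `k`
    (∀ (a b : ℕ) (hab : a < b) (hb : b + 1 < ν.length)
      (i : Fin (ν.blocksFun ⟨a, hab.trans (b.lt_succ_self.trans hb)⟩))
      (k : Fin (ν.blocksFun ⟨b, b.lt_succ_self.trans hb⟩))
      (j : Fin (ν.blocksFun ⟨b + 1, hb⟩)) (r : ℕ), 1 ≤ r →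
      Yang.EE ν a (hab.trans (b.lt_succ_self.trans hb)) i r (b + 1) hb j =
        ⁅Yang.EE ν a (hab.trans (b.lt_succ_self.trans hb)) i r b (b.lt_succ_self.trans hb) k,
          Yang.E ν b hb k j 1⁆ ∧
      Yang.FF ν a (hab.trans (b.lt_succ_self.trans hb)) i r (b + 1) hb j =
        ⁅Yang.F ν b hb j k 1,
          Yang.FF ν a (hab.trans (b.lt_succ_self.trans hb)) i r b (b.lt_succ_self.trans hb) k⁆) ∧
    (∀ lo : LinearOrder (Yang.DIndex ν),
      Yang.IsPBWBasis lo (Yang.DFamily ν) (Yang.levi ν)) ∧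
    (∀ lo : LinearOrder (Yang.EIndex ν),
      Yang.IsPBWBasis lo (Yang.EFamily ν) (Yang.plus ν)) ∧
    (∀ lo : LinearOrder (Yang.FIndex ν),
      Yang.IsPBWBasis lo (Yang.FFamily ν) (Yang.minus ν)) ∧
    (∀ lo : LinearOrder (Yang.DIndex ν ⊕ Yang.EIndex ν ⊕ Yang.FIndex ν),
      Yang.IsPBWBasis lo (Yang.allFamily ν) ⊤) ∧
    Function.Bijective (Yang.mulMap3 (Yang.minus ν) (Yang.levi ν) (Yang.plus ν)) :=
  ⟨fun a b hab hb i k j r _ =>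
      ⟨Yang.EE_succ ν a b hab hb i k j r, Yang.FF_succ ν a b hab hb i k j r⟩,
    Yang.isPBWBasis_DFamily ν, Yang.isPBWBasis_EFamily ν, Yang.isPBWBasis_FFamily ν,
    Yang.isPBWBasis_allFamily ν,
    Yang.mulMap3_bijective (x := Yang.allFamily ν) (Yang.isPBWBasis_FFamily ν)
      (Yang.isPBWBasis_DFamily ν) (Yang.isPBWBasis_EFamily ν) (Yang.isPBWBasis_allFamily ν)⟩
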